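/- Let $N\ge 1$, $0<q<1$, $t\ge 0$, and let $a_1,\dots,a_N\ge 0$ and $\alpha_1,\dots,\alpha_N\ge 0$ be real numbers with $\alpha_i>a_j$ for all $i,j$. Write $(x;q)_\infty=\prod_{k\ge0}(1-xq^k)$, $(q;q)_m=\prod_{k=1}^m(1-q^k)$, $q^s=(q^{s_1},\dots,q^{s_N})$, and for $z=(z_1,\dots,z_N)$ $$\Pi(z;q^\alpha,t)=\prod_{i,j=1}^N\frac1{(q^{\alpha_i}/z_j;q)_\infty}\prod_{j=1}^N e^{z_jt}.$$ For a signature $\lambda=(\lambda_1\ge\dots\ge\lambda_N)\in\mathbb Z^N$ let $$P_\lambda(x_1,\dots,x_N)=\sum\ \prod_{j=1}^N x_j^{\sum_{i\le j}\lambda^{(j)}_i-\sum_{i\le j-1}\lambda^{(j-1)}_i}\prod_{i=1}^{j-1}\frac{(q;q)_{\lambda^{(j)}_i-\lambda^{(j)}_{i+1}}}{(q;q)_{\lambda^{(j)}_i-\lambda^{(j-1)}_i}(q;q)_{\lambda^{(j-1)}_i-\lambda^{(j)}_{i+1}}},$$ the sum being over all integer arrays $(\lambda^{(j)}_i)_{1\le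 i\le j\le N}$ with $\lambda^{(N)}=\lambda$ and $\lambda^{(j+1)}_{i+1}\le\lambda^{(j)}_i\le\lambda^{(j+1)}_i$, and, with $\mathbb T$ the unit circle, let $$Q_\lambda(q^\alpha,t)=\prod_{i=1}^{N-1}(q^{\lambda_i-\lambda_{i+1}+1};q)_\infty\int_{\mathbb T^N}\prod_{i=1}^N\frac{dz_i}{z_i}\,P_\lambda(1/z)\,\Pi(z;q^\alpha,t)\,\frac{\prod_{i<j}(z_i/z_j;q)_\infty(z_j/z_i;q)_\infty}{(2\pi i)^N N!}.$$ Let $W_t(\lambda)=P_\lambda(q^a)Q_\lambda(q^\alpha,t)/\Pi(q^a;q^\alpha,t)$ be the two-sided $q$-Whittaker measure on signatures, and let $\langle\cdot\rangle$ denote the sum over all signatures weighted by $W_t$. Then for every $\epsilon>0$ and every $\zeta\in\mathbb C\setminus[0,\infty)$ the sum defining the left-hand side below converges absolutely, the integral on the right-hand side converges absolutely, and $$\begin{aligned}\left\langle\frac1{(\zeta q^{\lambda_N};q)_\infty}\right\rangle=\frac{(-\pi)^N}{(2\pi i)^NN!}\int_{(i\mathbb R-\epsilon)^N}&\prod_{j=1}^N\frac{ds_j}{q^{(N-1)a_j}(q;q)_\infty}\frac{(-\zeta)^{s_j}}{(-\zeta)^{a_j}}\cdot\frac{\Pi(q^s;q^\alpha,t)}{\Pi(q^a;q^\alpha,t)}\cdot\prod_{i,j=1}^N\frac{(q^{s_i-a_j+1};q)_\infty}{\sin\pi(s_i-a_j)}\\&\times\prod_{1\le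 i<j\le N}\frac{\sin\pi(s_j-s_i)\,\sin\pi(a_j-a_i)\,(q^{s_j}-q^{s_i})(q^{a_j}-q^{a_i})}{(q^{a_i-a_j};q)_\infty(q^{a_j-a_i};q)_\infty}.\end{aligned}$$ Here the lines $i\mathbb R-\epsilon$ are oriented upwards, powers of $-\zeta$ are taken with the principal branch (cut along the negative real axis), and when $a_i-a_j\in\mathbb Z$ the quotient $\sin\pi(a_j-a_i)(q^{a_j}-q^{a_i})/\big((q^{a_i-a_j};q)_\infty(q^{a_j-a_i};q)_\infty\big)$, which then reads $0/0$, denotes its limit (a removable singularity). -/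

import Mathlib

open scoped Real Topology
open MeasureTheory Filter

noncomputable section

namespace QWhittaker

/-- The infinite `q`-Pochhammer symbol `(x; q)_∞ = ∏_{k ≥ 0} (1 - x q^k)`. -/
def qPochInf (q : ℝ) (x : ℂ) : ℂ := ∏' k : ℕ, (1 - x * (q : ℂ) ^ k)

/-- The finite symbol `(q; q)_m = ∏_{k = 1}^{m} (1 - q^k)`. -/
def qFact (q : ℝ) (m : ℕ) : ℂ := ∏ k ∈ Finset.range m, (1 - (q : ℂ) ^ (k + 1))

/-- The point `q^s = (q^{s_1}, …, q^{s_N})`. -/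
def qPow {N : ℕ} (q : ℝ) (s : Fin N → ℂ) : Fin N → ℂ := fun j => (q : ℂ) ^ s j

/-- The rows `μ = λ^{(N-1)}` that interlace with the row `λ = λ^{(N)}`:
`λ_{i+1} ≤ μ_i ≤ λ_i` for every `i`. -/
def interlacing {n : ℕ} (lam : Fin (n + 1) → ℤ) : Finset (Fin n → ℤ) :=
  Fintype.piFinset fun i : Fin n => Finset.Icc (lam i.succ) (lam i.castSucc)

/-- The `q`-Whittaker function `P_λ(x_1, …, x_N)`: the sum over all interlacing triangular arrays
`(λ^{(j)}_i)_{1 ≤ i ≤ j ≤ N}` of integers with top row `λ^{(N)} = λ` of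
`∏_j x_j^{|λ^{(j)}| - |λ^{(j-1)}|} ∏_{i < j} (q;q)_{λ^{(j)}_i - λ^{(j)}_{i+1}} /
  ((q;q)_{λ^{(j)}_i - λ^{(j-1)}_i} (q;q)_{λ^{(j-1)}_i - λ^{(j)}_{i+1}})`,
organised row by row from the top. All the integers passed to `Int.toNat` are nonnegative
when `λ` is weakly decreasing. -/
def whittakerP (q : ℝ) : (N : ℕ) → (Fin N → ℂ) → (Fin N → ℤ) → ℂ
  | 0, _, _ => 1
  | n + 1, x, lam =>
      ∑ mu ∈ interlacing lam,
        x (Fin.last n) ^ ((∑ i, lam i) - ∑ i, mu i) *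
        (∏ i : Fin n,
          qFact q (lam i.castSucc - lam i.succ).toNat /
            (qFact q (lam i.castSucc - mu i).toNat * qFact q (mu i - lam i.succ).toNat)) *
        whittakerP q n (fun i => x i.castSucc) mu

/-- `Π(z; q^α, t) = ∏_{i,j} 1 / (q^{α_i} / z_j; q)_∞ · ∏_j e^{z_j t}`. -/
def cauchyPi {N : ℕ} (q : ℝ) (α : Fin N → ℝ) (t : ℝ) (z : Fin N → ℂ) : ℂ :=
  (∏ i, ∏ j, 1 / qPochInf q ((q : ℂ) ^ (α i : ℂ) / z j)) * ∏ j, Complex.exp (z j * t)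

/-- The `q`-Sklyanin density
`m_N^q(z) = 1 / ((2πi)^N N!) ∏_{i<j} (z_i/z_j; q)_∞ (z_j/z_i; q)_∞`. -/
def sklyanin {N : ℕ} (q : ℝ) (z : Fin N → ℂ) : ℂ :=
  1 / ((2 * π * Complex.I) ^ N * (N.factorial : ℂ)) *
    ∏ i : Fin N, ∏ j ∈ Finset.Ioi i, qPochInf q (z i / z j) * qPochInf q (z j / z i)

/-- The function `Q_λ(q^α, t)`, for `N = n + 1`; the integral is over the product of `N` unit
circles. -/
def whittakerQ {n : ℕ} (q : ℝ) (α : Fin (n + 1) → ℝ) (t : ℝ) (lam : Fin (n + 1) → ℤ) : ℂ :=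
  (∏ i : Fin n, qPochInf q ((q : ℂ) ^ (lam i.castSucc - lam i.succ + 1))) *
    torusIntegral (fun z : Fin (n + 1) → ℂ =>
      (∏ i, 1 / z i) * whittakerP q (n + 1) (fun i => 1 / z i) lam *
        cauchyPi q α t z * sklyanin q z) 0 1

/-- The weight `W_t(λ) = P_λ(q^a) Q_λ(q^α, t) / Π(q^a; q^α, t)` of the two-sided
`q`-Whittaker measure, for `N = n + 1`. -/
def whittakerW {n : ℕ} (q : ℝ) (a α : Fin (n + 1) → ℝ) (t : ℝ) (lam : Fin (n + 1) → ℤ) : ℂ :=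
  whittakerP q (n + 1) (qPow q fun j => (a j : ℂ)) lam * whittakerQ q α t lam /
    cauchyPi q α t (qPow q fun j => (a j : ℂ))

/-- The set of signatures `λ_1 ≥ ⋯ ≥ λ_N` with integer (possibly negative) entries. -/
abbrev Signature (N : ℕ) : Type := {lam : Fin N → ℤ // Antitone lam}

/-- The quotient `sin π(c - b) (q^c - q^b) / ((q^{b-c}; q)_∞ (q^{c-b}; q)_∞)`. -/
def pairQuotient (q b c : ℝ) : ℂ :=
  Complex.sin (π * ((c : ℂ) - b)) * ((q : ℂ) ^ (c : ℂ) - (q : ℂ) ^ (b : ℂ)) /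
    (qPochInf q ((q : ℂ) ^ ((b : ℂ) - c)) * qPochInf q ((q : ℂ) ^ ((c : ℂ) - b)))

open Classical in
/-- The quotient above, with its removable singularities at `c - b ∈ ℤ` (where it reads `0 / 0`)
filled in by the limit. -/
def pairFactor (q b c : ℝ) : ℂ :=
  if ∃ m : ℤ, c - b = m then limUnder (𝓝[≠] c) (fun c' => pairQuotient q b c')
  else pairQuotient q b c

/-- The integrand, a function of `s = (s_1, …, s_N)`, of the `N`-fold integral, for `N = n + 1`. -/
def nfoldIntegrand {n : ℕ} (q : ℝ) (a α : Fin (n + 1) → ℝ) (t : ℝ) (ζ : ℂ)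
    (s : Fin (n + 1) → ℂ) : ℂ :=
  (∏ j, 1 / ((q : ℂ) ^ ((n : ℂ) * a j) * qPochInf q q) * ((-ζ) ^ s j / (-ζ) ^ (a j : ℂ))) *
    (cauchyPi q α t (qPow q s) / cauchyPi q α t (qPow q fun j => (a j : ℂ))) *
    (∏ i, ∏ j, qPochInf q ((q : ℂ) ^ (s i - a j + 1)) / Complex.sin (π * (s i - a j))) *
    ∏ i : Fin (n + 1), ∏ j ∈ Finset.Ioi i,
      Complex.sin (π * (s j - s i)) * ((q : ℂ) ^ s j - (q : ℂ) ^ s i) * pairFactor q (a i) (a j)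

/-- The point of `(iℝ - ε)^N` with imaginary parts `y_1, …, y_N`. -/
def linePoint {N : ℕ} (ε : ℝ) (y : Fin N → ℝ) : Fin N → ℂ :=
  fun j => -(ε : ℂ) + Complex.I * (y j : ℂ)

end QWhittaker

end

/-! Write N = n + 1, x_j = q^{a_j} and θ(x) = (x;q)_∞ (q/x;q)_∞. The expectation turns into an
integral over a torus |z_j| = R, and the integral over lines folds onto that same torus integral.

Sum side. The integrand of Q_λ is holomorphic for |z_j| ≥ 1, so the circles may be enlarged to
radius R = q^{-ε} > 1 (`whittakerQ_eq`). There |x_i/z_j| < 1, and the sum over λ passes under the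
integral. Put λ = (κ, 0) + m(1,…,1). Homogeneity of P_λ splits the sum into a sum over κ times Σ_m
X^m/(ζq^m;q)_∞ with X = ∏ x_j/z_j. The sum over m is Ramanujan's bilateral sum. The sum over κ is
read off from the Cauchy identity, where m carries the weight 1/(q;q)_m and contributes 1/(X;q)_∞.
The outcome is `laplaceKernel` (see `hasSum_laplaceTerm`). The Cauchy identity `hasSum_cauchy`
follows from the branching rule and its one-variable case; the latter solves a q-difference equation
in y that comes from the Pieri rule `pieri`, itself a transfer-matrix identity (`chain_pieri`).

Line side. Under z = q^s the line Re s = -ε wraps around the circle with period ω = 2πi/log q. The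
integrand is an ω-periodic function times `trigTerm`, and Cauchy's trigonometric determinant
identifies the latter, up to factors depending on a and ζ only, with det[(-ζ)^{s_i-a_j}/sin
π(s_i-a_j)]. Summing over the shifts s_i + k_i ω acts row by row. Each entry is summed by
Kronecker's formula at the dual nome followed by modular inversion (`hasSum_cpow_div_sin`) and
becomes a constant times θ(ζq^{a_j-s_i})/(θ(ζ)θ(q^{a_j-s_i})). Frobenius' elliptic Cauchy
determinant (`det_qTheta`), a consequence of the three-term theta relation, evaluates the new
determinant. All other factors then cancel down to `laplaceKernel` times the Sklyanin product
(`periodicPart_mul_trigSum`).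

The condition ζ ∉ [0,∞) enters twice: it puts Kronecker's sum inside its annulus of convergence, and
it gives the decay exp(-(π - |arg(-ζ)|)|y_j|) along the lines.

When a_i - a_j is an integer the factor sin π(a_i - a_j) of the determinant vanishes. The summed
formula, with that factor divided out, extends by continuity in a, and `thetaSinRatio` gives the
value at the removable singularity. -/

noncomputable section

namespace QWhittaker

/-! ### q-Pochhammer symbols and Euler's two expansions. -/

section QPochhammer

variable {q : ℝ}

theorem summable_norm_neg_mul_pow (hq0 : 0 < q) (hq1 : q < 1) (x : ℂ) :
    Summable fun k : ℕ => ‖-(x * (q : ℂ) ^ k)‖ := by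
  simp only [norm_neg, norm_mul, norm_pow, Complex.norm_real, Real.norm_eq_abs, abs_of_pos hq0]
  exact (summable_geometric_of_lt_one hq0.le hq1).mul_left _

theorem multipliable_qPochInf (hq0 : 0 < q) (hq1 : q < 1) (x : ℂ) :
    Multipliable fun k : ℕ => (1 - x * (q : ℂ) ^ k) := by
  simpa only [sub_eq_add_neg] using
    multipliable_one_add_of_summable (summable_norm_neg_mul_pow hq0 hq1 x)

theorem tendsto_prod_qPochInf (hq0 : 0 < q) (hq1 : q < 1) (x : ℂ) :
    Tendsto (fun M : ℕ => ∏ k ∈ Finset.range M, (1 - x * (q : ℂ) ^ k)) atTop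
      (𝓝 (qPochInf q x)) :=
  (multipliable_qPochInf hq0 hq1 x).hasProd.tendsto_prod_nat

theorem qPochInf_eq (hq0 : 0 < q) (hq1 : q < 1) (x : ℂ) :
    qPochInf q x = (1 - x) * qPochInf q (x * q) := by
  have h := multipliable_qPochInf hq0 hq1 (x * q)
  have e : (fun k : ℕ => (1 - x * (q : ℂ) ^ (k + 1))) = fun k : ℕ => (1 - x * q * (q : ℂ) ^ k) := by
    funext k; ring
  have := tprod_eq_zero_mul' (f := fun k : ℕ => (1 - x * (q : ℂ) ^ k)) (e ▸ h)
  simp only [qPochInf]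
  rw [this, e]; simp

theorem qPochInf_eq_prod_mul (hq0 : 0 < q) (hq1 : q < 1) (x : ℂ) (M : ℕ) :
    qPochInf q x = (∏ k ∈ Finset.range M, (1 - x * (q : ℂ) ^ k)) * qPochInf q (x * (q : ℂ) ^ M) := by
  induction M with
  | zero => simp
  | succ M ih =>
    rw [ih, Finset.prod_range_succ, qPochInf_eq hq0 hq1 (x * (q : ℂ) ^ M), pow_succ]; ring_nf

theorem qPochInf_ne_zero (hq0 : 0 < q) (hq1 : q < 1) {x : ℂ} (h : ∀ k : ℕ, x * (q : ℂ) ^ k ≠ 1) :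
    qPochInf q x ≠ 0 := by
  have := tprod_one_add_ne_zero_of_summable (f := fun k : ℕ => -(x * (q : ℂ) ^ k))
    (fun i hi => h i (by linear_combination -hi)) (summable_norm_neg_mul_pow hq0 hq1 x)
  simpa only [qPochInf, sub_eq_add_neg] using this

theorem qPochInf_ne_zero_of_norm_lt_one (hq0 : 0 < q) (hq1 : q < 1) {x : ℂ} (h : ‖x‖ < 1) :
    qPochInf q x ≠ 0 := by
  refine qPochInf_ne_zero hq0 hq1 fun k hk => ?_
  have h1 := congrArg norm hk
  simp only [norm_mul, norm_pow, Complex.norm_real, Real.norm_eq_abs, abs_of_pos hq0,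
    norm_one] at h1
  have h2 : q ^ k ≤ 1 := pow_le_one₀ hq0.le hq1.le
  have h3 : 0 < q ^ k := pow_pos hq0 k
  nlinarith [norm_nonneg x]

theorem qPochInf_eq_zero (hq0 : 0 < q) (hq1 : q < 1) {x : ℂ} {k : ℕ} (h : x * (q : ℂ) ^ k = 1) :
    qPochInf q x = 0 := by
  rw [qPochInf_eq_prod_mul hq0 hq1 x (k + 1), Finset.prod_range_succ, h]; simp

theorem differentiable_qPochInf (hq0 : 0 < q) (hq1 : q < 1) : Differentiable ℂ (qPochInf q) := by
  have key : ∀ r : ℝ, DifferentiableOn ℂ (qPochInf q) (Metric.ball 0 r) := by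
    intro r
    have h := Summable.hasProdLocallyUniformlyOn_nat_one_add (R := ℂ)
      (f := fun (k : ℕ) (x : ℂ) => -(x * (q : ℂ) ^ k)) (K := Metric.ball (0 : ℂ) r)
      (u := fun k => |r| * q ^ k) Metric.isOpen_ball
      ((summable_geometric_of_lt_one hq0.le hq1).mul_left _)
      (.of_forall fun k x hx => by
        simp only [norm_neg, norm_mul, norm_pow, Complex.norm_real, Real.norm_eq_abs,
          abs_of_pos hq0]
        have : ‖x‖ ≤ |r| := ((by simpa using hx : ‖x‖ < r).le).trans (le_abs_self r)
        gcongr) (fun k => by fun_prop)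
    have h2 := h.differentiableOn (.of_forall fun s => by
      simpa [Finset.prod_fn] using DifferentiableOn.finsetProd (fun _ _ => by fun_prop))
      Metric.isOpen_ball
    have e : qPochInf q = fun x => ∏' k : ℕ, (1 + -(x * (q : ℂ) ^ k)) := by
      funext x; simp only [qPochInf, ← sub_eq_add_neg]
    rw [e]
    exact h2
  intro x
  exact (key (‖x‖ + 1)).differentiableAt (Metric.isOpen_ball.mem_nhds (by simp))

theorem continuous_qPochInf (hq0 : 0 < q) (hq1 : q < 1) : Continuous (qPochInf q) :=
  (differentiable_qPochInf hq0 hq1).continuous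

@[simp] theorem qPochInf_zero : qPochInf q 0 = 1 := by simp [qPochInf]

theorem tendsto_ofReal_pow_zero (hq0 : 0 < q) (hq1 : q < 1) :
    Tendsto (fun M : ℕ => (q : ℂ) ^ M) atTop (𝓝 0) :=
  tendsto_pow_atTop_nhds_zero_of_norm_lt_one (by simpa [abs_of_pos hq0] using hq1)

theorem one_sub_ofReal_pow_ne_zero (hq0 : 0 < q) (hq1 : q < 1) (k : ℕ) :
    (1 - (q : ℂ) ^ (k + 1)) ≠ 0 := by
  rw [← Complex.ofReal_pow, ← Complex.ofReal_one, ← Complex.ofReal_sub]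
  exact_mod_cast (sub_pos.2 (pow_lt_one₀ hq0.le hq1 (Nat.succ_ne_zero k))).ne'

theorem qFact_ne_zero (hq0 : 0 < q) (hq1 : q < 1) (m : ℕ) : qFact q m ≠ 0 :=
  Finset.prod_ne_zero_iff.2 fun k _ => one_sub_ofReal_pow_ne_zero hq0 hq1 k

@[simp] theorem qFact_zero : qFact q 0 = 1 := by simp [qFact]

theorem qFact_succ (m : ℕ) : qFact q (m + 1) = qFact q m * (1 - (q : ℂ) ^ (m + 1)) := by
  simp [qFact, Finset.prod_range_succ]

/-- The reciprocal `1 / (q; q)_k`, extended by zero to negative integers. -/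
def invQFact (q : ℝ) (k : ℤ) : ℂ := if 0 ≤ k then 1 / qFact q k.toNat else 0

theorem invQFact_of_neg {k : ℤ} (h : k < 0) : invQFact q k = 0 := by
  simp [invQFact, not_le.2 h]

theorem invQFact_natCast (k : ℕ) : invQFact q k = 1 / qFact q k := by simp [invQFact]

@[simp] theorem invQFact_zero : invQFact q 0 = 1 := by simp [invQFact]

/-- Extension by zero makes the recurrence hold for every integer: at k = 0 the factor 1 - q^k
vanishes. Interlacing conditions can thus be encoded in vanishing weights and sums taken over all of
ℤ^n. -/
theorem invQFact_sub_one (hq0 : 0 < q) (hq1 : q < 1) (k : ℤ) :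
    invQFact q (k - 1) = (1 - (q : ℂ) ^ k) * invQFact q k := by
  rcases lt_trichotomy k 0 with h | rfl | h
  · rw [invQFact_of_neg h, invQFact_of_neg (by omega), mul_zero]
  · rw [invQFact_of_neg (by omega)]; simp
  · obtain ⟨m, rfl⟩ : ∃ m : ℕ, k = (m + 1 : ℕ) := ⟨(k - 1).toNat, by omega⟩
    have e : (((m + 1 : ℕ) : ℤ) - 1) = (m : ℕ) := by omega
    rw [e, invQFact_natCast, invQFact_natCast, qFact_succ, zpow_natCast]
    have := qFact_ne_zero hq0 hq1 m
    have := one_sub_ofReal_pow_ne_zero hq0 hq1 m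
    field_simp

theorem qFact_eq_prod (m : ℕ) : qFact q m = ∏ k ∈ Finset.range m, (1 - (q : ℂ) * (q : ℂ) ^ k) := by
  simp [qFact, pow_succ']

/-- For k < 0 the infinite product contains the factor 1 - q^0, which matches the convention
1/(q;q)_k = 0. -/
theorem qPochInf_zpow_add_one (hq0 : 0 < q) (hq1 : q < 1) (k : ℤ) :
    qPochInf q ((q : ℂ) ^ (k + 1)) = qPochInf q q * invQFact q k := by
  have hq : (q : ℂ) ≠ 0 := by exact_mod_cast hq0.ne'
  rcases lt_or_ge k 0 with h | h
  · rw [invQFact_of_neg h, mul_zero]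
    refine qPochInf_eq_zero hq0 hq1 (k := (-(k + 1)).toNat) ?_
    rw [← zpow_natCast, ← zpow_add₀ hq]
    have : k + 1 + ((-(k + 1)).toNat : ℤ) = 0 := by omega
    rw [this, zpow_zero]
  · obtain ⟨m, rfl⟩ := Int.eq_ofNat_of_zero_le h
    rw [qPochInf_eq_prod_mul hq0 hq1 q m, ← qFact_eq_prod, invQFact_natCast]
    have := qFact_ne_zero hq0 hq1 m
    have e : (q : ℂ) ^ ((m : ℤ) + 1) = q * (q : ℂ) ^ m := by
      rw [zpow_add₀ hq, zpow_natCast, zpow_one, mul_comm]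
    rw [e]; field_simp

theorem qPochInf_self_ne_zero (hq0 : 0 < q) (hq1 : q < 1) : qPochInf q q ≠ 0 :=
  qPochInf_ne_zero_of_norm_lt_one hq0 hq1 (by simpa [abs_of_pos hq0] using hq1)

theorem tendsto_invQFact (hq0 : 0 < q) (hq1 : q < 1) :
    Tendsto (fun k : ℕ => invQFact q k) atTop (𝓝 (1 / qPochInf q q)) := by
  simp only [invQFact_natCast, qFact_eq_prod]
  exact tendsto_const_nhds.div (tendsto_prod_qPochInf hq0 hq1 q) (qPochInf_self_ne_zero hq0 hq1)

theorem exists_norm_invQFact_le (hq0 : 0 < q) (hq1 : q < 1) : ∃ C : ℝ, 1 ≤ C ∧ ∀ k : ℤ, ‖invQFact q k‖ ≤ C := by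
  obtain ⟨C, hC⟩ := (tendsto_invQFact hq0 hq1).norm.bddAbove_range
  refine ⟨max C 1, le_max_right _ _, fun k => ?_⟩
  rcases lt_or_ge k 0 with h | h
  · rw [invQFact_of_neg h]; simp
  · obtain ⟨m, rfl⟩ := Int.eq_ofNat_of_zero_le h
    exact (hC ⟨m, rfl⟩).trans (le_max_left _ _)

theorem norm_qFact_le_one (hq0 : 0 < q) (hq1 : q < 1) (m : ℕ) : ‖qFact q m‖ ≤ 1 := by
  rw [qFact, norm_prod]
  refine Finset.prod_le_one (fun _ _ => norm_nonneg _) fun k _ => ?_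
  rw [← Complex.ofReal_pow, ← Complex.ofReal_one, ← Complex.ofReal_sub, Complex.norm_real,
    Real.norm_eq_abs, abs_le]
  have := pow_pos hq0 (k + 1)
  have := pow_le_one₀ hq0.le hq1.le (n := k + 1)
  constructor <;> linarith

/-- The triangular number `n (n - 1) / 2`. -/
def tri (n : ℤ) : ℤ := n * (n - 1) / 2

theorem two_mul_tri (n : ℤ) : 2 * tri n = n * (n - 1) :=
  Int.mul_ediv_cancel' (Int.even_mul_pred_self n).two_dvd

theorem tri_add (n k : ℤ) : tri (n + k) = tri n + tri k + n * k := by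
  have h1 := two_mul_tri n
  have h2 := two_mul_tri k
  have h3 := two_mul_tri (n + k)
  have : 2 * tri (n + k) = 2 * (tri n + tri k + n * k) := by rw [h3, mul_add, mul_add, h1, h2]; ring
  omega

@[simp] theorem tri_zero : tri 0 = 0 := rfl
@[simp] theorem tri_one : tri 1 = 0 := rfl

theorem tri_neg (n : ℤ) : tri (-n) = tri n + n := by
  have h1 := two_mul_tri n
  have h2 := two_mul_tri (-n)
  nlinarith

/-- Ratio test: consecutive terms have ratio of modulus q^k |r| / (1 - q^{k+1}), which tends to 0.
-/
theorem summable_euler_exp (hq0 : 0 < q) (hq1 : q < 1) (r : ℝ) :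
    Summable fun k : ℕ => (-1 : ℂ) ^ k * (q : ℂ) ^ tri k * (r : ℂ) ^ k * invQFact q k := by
  have hq : (q : ℂ) ≠ 0 := by exact_mod_cast hq0.ne'
  rcases eq_or_ne r 0 with rfl | hr
  · refine summable_of_ne_finset_zero (s := {0}) fun k hk => ?_
    have : k ≠ 0 := by simpa using hk
    simp [this]
  have hr' : (r : ℂ) ≠ 0 := by exact_mod_cast hr
  refine summable_of_ratio_test_tendsto_lt_one (l := 0) one_pos (.of_forall fun k => ?_) ?_
  · rw [invQFact_natCast]
    have := qFact_ne_zero hq0 hq1 k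
    simp [hr', this]
    exact fun h => absurd h (zpow_ne_zero _ hq)
  · have : Tendsto (fun k : ℕ => ‖(q : ℂ) ^ k‖ * ‖(r : ℂ)‖ / ‖1 - (q : ℂ) ^ (k + 1)‖) atTop (𝓝 0) := by
      have h1 := (tendsto_ofReal_pow_zero hq0 hq1)
      have h2 : Tendsto (fun k : ℕ => ‖1 - (q : ℂ) ^ (k + 1)‖) atTop (𝓝 ‖(1 : ℂ) - 0‖) :=
        (tendsto_const_nhds.sub (h1.comp (tendsto_add_atTop_nat 1))).norm
      have h3 := (h1.norm.mul_const ‖(r : ℂ)‖).div h2 (by simp)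
      rw [norm_zero, zero_mul, zero_div] at h3
      exact h3
    refine this.congr fun k => ?_
    rw [invQFact_natCast, invQFact_natCast, qFact_succ]
    push_cast
    rw [tri_add, tri_one]
    simp only [norm_mul, norm_pow, norm_neg, norm_one, one_pow, norm_div]
    rw [add_zero, mul_one, zpow_add₀ hq, zpow_natCast, pow_succ]
    have h1 : ‖qFact q k‖ ≠ 0 := norm_ne_zero_iff.2 (qFact_ne_zero hq0 hq1 k)
    have h2 : ‖(q : ℂ) ^ tri k‖ ≠ 0 := norm_ne_zero_iff.2 (zpow_ne_zero _ hq)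
    have h3 : ‖(r : ℂ)‖ ≠ 0 := norm_ne_zero_iff.2 hr'
    have h4 : ‖1 - (q : ℂ) ^ (k + 1)‖ ≠ 0 :=
      norm_ne_zero_iff.2 (one_sub_ofReal_pow_ne_zero hq0 hq1 k)
    rw [pow_succ] at h4 ⊢
    field_simp
    rw [norm_mul, norm_pow]

/-- Uniqueness for the functional equation `S (x) = (1 - x) S (q x)` with continuity along
`x q^M → 0`. -/
theorem eq_qPochInf_of_functional_equation (hq0 : 0 < q) (hq1 : q < 1) {S : ℂ → ℂ} {x : ℂ}
    (h : ∀ M : ℕ, S (x * (q : ℂ) ^ M) = (1 - x * (q : ℂ) ^ M) * S (x * (q : ℂ) ^ (M + 1)))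
    (hS : Tendsto (fun M : ℕ => S (x * (q : ℂ) ^ M)) atTop (𝓝 1)) : S x = qPochInf q x := by
  have key : ∀ M : ℕ, S x = (∏ k ∈ Finset.range M, (1 - x * (q : ℂ) ^ k)) * S (x * (q : ℂ) ^ M) := by
    intro M
    induction M with
    | zero => simp
    | succ M ih => rw [ih, Finset.prod_range_succ, h M]; ring
  have := (tendsto_prod_qPochInf hq0 hq1 x).mul hS
  rw [mul_one] at this
  exact tendsto_nhds_unique (tendsto_const_nhds.congr key) this

theorem summable_norm_euler_exp (hq0 : 0 < q) (hq1 : q < 1) (x : ℂ) :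
    Summable fun k : ℕ => ‖(-1 : ℂ) ^ k * (q : ℂ) ^ tri k * x ^ k * invQFact q k‖ := by
  have := (summable_euler_exp hq0 hq1 ‖x‖).norm
  simpa using this

/-- A power series tends to its constant coefficient along `x q^M → 0`. -/
theorem tendsto_tsum_mul_pow_zero (hq0 : 0 < q) (hq1 : q < 1) {c : ℕ → ℂ} {x : ℂ}
    (hc : Summable fun k => ‖c k * x ^ k‖) :
    Tendsto (fun M : ℕ => ∑' k, c k * (x * (q : ℂ) ^ M) ^ k) atTop (𝓝 (c 0)) := by
  have h : Tendsto (fun M : ℕ => ∑' k, c k * (x * (q : ℂ) ^ M) ^ k) atTop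
      (𝓝 (∑' k, if k = 0 then c 0 else 0)) := by
    refine tendsto_tsum_of_dominated_convergence (bound := fun k => ‖c k * x ^ k‖) hc ?_ ?_
    · intro k
      have h1 : Tendsto (fun M : ℕ => c k * (x * (q : ℂ) ^ M) ^ k) atTop (𝓝 (c k * (x * 0) ^ k)) :=
        (((tendsto_ofReal_pow_zero hq0 hq1).const_mul x).pow k).const_mul _
      rcases eq_or_ne k 0 with rfl | hk
      · simpa using h1
      · simpa [hk] using h1
    · refine .of_forall fun M k => ?_
      rw [mul_pow, ← mul_assoc, norm_mul]
      refine mul_le_of_le_one_right (norm_nonneg _) ?_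
      simp only [norm_pow, Complex.norm_real, Real.norm_eq_abs, abs_of_pos hq0]
      exact pow_le_one₀ (pow_nonneg hq0.le _) (pow_le_one₀ hq0.le hq1.le)
  simpa using h

/-- Euler's expansion `(x; q)_∞ = ∑ (-1)^k q^{k (k - 1) / 2} x^k / (q; q)_k`. -/
theorem hasSum_qPochInf (hq0 : 0 < q) (hq1 : q < 1) (x : ℂ) :
    HasSum (fun k : ℕ => (-1 : ℂ) ^ k * (q : ℂ) ^ tri k * x ^ k * invQFact q k) (qPochInf q x) := by
  have hq : (q : ℂ) ≠ 0 := by exact_mod_cast hq0.ne'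
  set c : ℕ → ℂ := fun k => (-1 : ℂ) ^ k * (q : ℂ) ^ tri k * invQFact q k with hcdef
  have hs : ∀ x : ℂ, Summable fun k => ‖c k * x ^ k‖ := fun x => by
    refine (summable_norm_euler_exp hq0 hq1 x).congr fun k => ?_
    simp only [hcdef]; congr 1; ring
  have e : (fun k : ℕ => (-1 : ℂ) ^ k * (q : ℂ) ^ tri k * x ^ k * invQFact q k) =
    fun k => c k * x ^ k := by funext k; simp only [hcdef]; ring
  rw [e]
  -- Comparing coefficients of x^{k+1} through `invQFact_sub_one` gives S(x) = (1 - x) S(qx), which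
  -- together with S → 1 along x q^M determines S.
  have hfun : ∀ x : ℂ, ∑' k, c k * x ^ k = (1 - x) * ∑' k, c k * (x * q) ^ k := by
    intro x
    have a1 := (hs x).of_norm
    have a2 := (hs (x * q)).of_norm
    rw [sub_mul, one_mul]
    have a4 : Summable fun k : ℕ => x * (c k * (x * q) ^ k) := a2.mul_left x
    rw [← tsum_mul_left, eq_sub_iff_add_eq, a1.tsum_eq_zero_add, a2.tsum_eq_zero_add, add_assoc,
      ← ((summable_nat_add_iff 1).2 a1).tsum_add a4]
    congr 1
    · refine tsum_congr fun k => ?_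
      have h1 := invQFact_sub_one hq0 hq1 ((k + 1 : ℕ) : ℤ)
      have h0 : (((k + 1 : ℕ) : ℤ) - 1) = (k : ℤ) := by omega
      rw [h0, zpow_natCast] at h1
      simp only [hcdef]
      rw [h1]
      push_cast
      rw [tri_add, tri_one, add_zero, mul_one, zpow_add₀ hq, zpow_natCast]
      ring
  have := eq_qPochInf_of_functional_equation hq0 hq1 (S := fun x => ∑' k, c k * x ^ k) (x := x)
    (fun M => by rw [hfun, pow_succ, mul_assoc]) (by
      have := tendsto_tsum_mul_pow_zero hq0 hq1 (hs x)
      simpa [hcdef] using this)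
  rw [← this]
  exact (hs x).of_norm.hasSum

theorem summable_norm_pow_mul_invQFact (hq0 : 0 < q) (hq1 : q < 1) {x : ℂ} (hx : ‖x‖ < 1) :
    Summable fun k : ℕ => ‖invQFact q k * x ^ k‖ := by
  obtain ⟨C, -, hC⟩ := exists_norm_invQFact_le hq0 hq1
  refine Summable.of_nonneg_of_le (fun _ => norm_nonneg _) (fun k => ?_)
    ((summable_geometric_of_lt_one (norm_nonneg x) hx).mul_left C)
  rw [norm_mul, norm_pow]
  gcongr
  exact hC k

/-- Euler's expansion `1 / (x; q)_∞ = ∑ x^k / (q; q)_k` for `|x| < 1`. -/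
theorem hasSum_inv_qPochInf (hq0 : 0 < q) (hq1 : q < 1) {x : ℂ} (hx : ‖x‖ < 1) :
    HasSum (fun k : ℕ => invQFact q k * x ^ k) (1 / qPochInf q x) := by
  set c : ℕ → ℂ := fun k => invQFact q k with hcdef
  have hs : ∀ {x : ℂ}, ‖x‖ < 1 → Summable fun k => ‖c k * x ^ k‖ := fun hx =>
    summable_norm_pow_mul_invQFact hq0 hq1 hx
  have hn : ∀ M : ℕ, ‖x * (q : ℂ) ^ M‖ < 1 := fun M => by
    simp only [norm_mul, norm_pow, Complex.norm_real, Real.norm_eq_abs, abs_of_pos hq0]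
    exact (mul_le_of_le_one_right (norm_nonneg _) (pow_le_one₀ hq0.le hq1.le)).trans_lt hx
  have hfun : ∀ x : ℂ, ‖x‖ < 1 → ‖x * q‖ < 1 →
      (1 - x) * ∑' k, c k * x ^ k = ∑' k, c k * (x * q) ^ k := by
    intro x hx hxq
    have a1 := (hs hx).of_norm
    have a2 := (hs hxq).of_norm
    rw [sub_mul, one_mul]
    have a4 : Summable fun k : ℕ => x * (c k * x ^ k) := a1.mul_left x
    rw [← tsum_mul_left, sub_eq_iff_eq_add, a1.tsum_eq_zero_add, a2.tsum_eq_zero_add, add_assoc,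
      ← ((summable_nat_add_iff 1).2 a2).tsum_add a4]
    congr 1
    · refine tsum_congr fun k => ?_
      have h1 := invQFact_sub_one hq0 hq1 ((k + 1 : ℕ) : ℤ)
      have h0 : (((k + 1 : ℕ) : ℤ) - 1) = (k : ℤ) := by omega
      rw [h0, zpow_natCast] at h1
      simp only [hcdef]
      rw [h1]
      ring
  have key : ∀ M : ℕ, (∏ k ∈ Finset.range M, (1 - x * (q : ℂ) ^ k)) * ∑' k, c k * x ^ k =
      ∑' k, c k * (x * (q : ℂ) ^ M) ^ k := by
    intro M
    induction M with
    | zero => simp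
    | succ M ih =>
      have := hn (M + 1)
      rw [pow_succ, ← mul_assoc] at this
      rw [Finset.prod_range_succ, mul_right_comm, ih, mul_comm, hfun _ (hn M) this, pow_succ,
        ← mul_assoc]
  have h1 := (tendsto_prod_qPochInf hq0 hq1 x).mul_const (∑' k, c k * x ^ k)
  have h2 := tendsto_tsum_mul_pow_zero hq0 hq1 (hs hx)
  have h3 := tendsto_nhds_unique (h1.congr key) h2
  have h4 : ∑' k, c k * x ^ k = 1 / qPochInf q x := by
    rw [eq_div_iff (qPochInf_ne_zero_of_norm_lt_one hq0 hq1 hx), mul_comm, h3]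
    simp [hcdef]
  rw [← h4]
  exact (hs hx).of_norm.hasSum

end QPochhammer

/-! ### Theta functions: triple product, Ramanujan's and Kronecker's sums. -/

section Theta

variable {q : ℝ}

/-- The theta function `(x; q)_∞ (q / x; q)_∞`. -/
def qTheta (q : ℝ) (x : ℂ) : ℂ := qPochInf q x * qPochInf q (q / x)

/-- The theta series `∑ (-u)^m q^{m (m - 1) / 2}` over the integers. -/
def thetaSum (q : ℝ) (u : ℂ) : ℂ := ∑' m : ℤ, (-u) ^ m * (q : ℂ) ^ tri m

theorem ofReal_ne_zero' (hq0 : 0 < q) : (q : ℂ) ≠ 0 := by exact_mod_cast hq0.ne'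

theorem summable_norm_thetaSum (hq0 : 0 < q) (hq1 : q < 1) (u : ℂ) :
    Summable fun m : ℤ => ‖(-u) ^ m * (q : ℂ) ^ tri m‖ := by
  have hq := ofReal_ne_zero' hq0
  have key : ∀ x : ℂ, Summable fun k : ℕ => ‖(-x) ^ k * (q : ℂ) ^ tri k‖ := by
    intro x
    refine Summable.of_nonneg_of_le (fun _ => norm_nonneg _) (fun k => ?_)
      (summable_norm_euler_exp hq0 hq1 x)
    have e : (-x) ^ k * (q : ℂ) ^ tri k =
        ((-1 : ℂ) ^ k * (q : ℂ) ^ tri k * x ^ k * invQFact q k) * qFact q k := by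
      rw [invQFact_natCast, neg_pow]
      have := qFact_ne_zero hq0 hq1 k
      field_simp
    rw [e, norm_mul]
    exact mul_le_of_le_one_right (norm_nonneg _) (norm_qFact_le_one hq0 hq1 k)
  refine Summable.of_nat_of_neg ?_ ?_
  · simpa using key u
  · refine (key (q / u)).congr fun k => ?_
    rw [tri_neg, zpow_add₀ hq, zpow_neg, zpow_natCast, zpow_natCast, ← inv_pow, neg_inv.symm,
      neg_pow, neg_pow (u⁻¹), div_eq_mul_inv, mul_pow]
    congr 1
    ring

theorem hasSum_thetaSum (hq0 : 0 < q) (hq1 : q < 1) (u : ℂ) :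
    HasSum (fun m : ℤ => (-u) ^ m * (q : ℂ) ^ tri m) (thetaSum q u) :=
  (summable_norm_thetaSum hq0 hq1 u).of_norm.hasSum

/-- Multiply the theta series by Euler's series for 1/(w;q)_∞ and substitute (m, j) ↦ (m - j, j):
the sum over j is then Euler's series for (q^{1-m}w/u;q)_∞. The choice w = u yields the triple
product, and u = ζX, w = X yields Ramanujan's sum. -/
theorem hasSum_theta_mul_qPochInf (hq0 : 0 < q) (hq1 : q < 1) {u w : ℂ} (hu : u ≠ 0)
    (hw : ‖w‖ < 1) :
    HasSum (fun m : ℤ => (-u) ^ m * (q : ℂ) ^ tri m * qPochInf q ((q : ℂ) ^ (1 - m) * w / u))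
      (thetaSum q u * (1 / qPochInf q w)) := by
  have hq := ofReal_ne_zero' hq0
  have h1 := summable_norm_thetaSum hq0 hq1 u
  have h2 := summable_norm_pow_mul_invQFact hq0 hq1 hw
  have h3 := summable_mul_of_summable_norm h1 h2
  have h4 := (hasSum_thetaSum hq0 hq1 u).mul (hasSum_inv_qPochInf hq0 hq1 hw) h3
  let e : ℤ × ℕ ≃ ℤ × ℕ :=
    { toFun := fun p => (p.1 - p.2, p.2)
      invFun := fun p => (p.1 + p.2, p.2)
      left_inv := fun p => by simp
      right_inv := fun p => by simp }
  have h5 := (e.hasSum_iff (f := fun x : ℤ × ℕ => (-u) ^ x.1 * (q : ℂ) ^ tri x.1 * (invQFact q x.2 * w ^ x.2))).2 h4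
  refine h5.prod_fiberwise fun m => ?_
  refine ((hasSum_qPochInf hq0 hq1 ((q : ℂ) ^ (1 - m) * w / u)).mul_left
    ((-u) ^ m * (q : ℂ) ^ tri m)).congr_fun fun j => ?_
  simp only [Function.comp, e, Equiv.coe_fn_mk]
  have hu' : -u ≠ 0 := neg_ne_zero.2 hu
  have t : tri (m - j) = tri m + tri j + (1 - m) * j := by
    rw [sub_eq_add_neg, tri_add, tri_neg]; ring
  rw [t, zpow_sub₀ hu', zpow_add₀ hq, zpow_add₀ hq, zpow_mul, zpow_natCast, zpow_natCast, div_pow,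
    mul_pow, neg_pow u j]
  have h1 : ((-1 : ℂ) ^ j) * (-1) ^ j = 1 := by rw [← mul_pow]; simp
  have h2 : ((-1 : ℂ) ^ j) ≠ 0 := by simp
  field_simp
  linear_combination (-(invQFact q j * w ^ j)) * h1

theorem qTheta_mul_self (hq0 : 0 < q) (hq1 : q < 1) {x : ℂ} (hx : x ≠ 0) :
    qTheta q (x * q) = -qTheta q x / x := by
  have hq := ofReal_ne_zero' hq0
  rw [qTheta, qTheta, qPochInf_eq hq0 hq1 x, qPochInf_eq hq0 hq1 ((q : ℂ) / (x * q))]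
  have e1 : (q : ℂ) / (x * q) = 1 / x := by field_simp
  have e2 : (1 : ℂ) / x * q = q / x := by ring
  rw [e1, e2]
  field_simp
  ring

theorem thetaSum_mul_self (hq0 : 0 < q) (hq1 : q < 1) {x : ℂ} (hx : x ≠ 0) :
    thetaSum q (x * q) = -thetaSum q x / x := by
  have hq := ofReal_ne_zero' hq0
  have h1 := ((Equiv.addRight (1 : ℤ)).hasSum_iff).2 (hasSum_thetaSum hq0 hq1 x)
  have h2 := h1.mul_left (-(1 / x))
  rw [show -thetaSum q x / x = -(1 / x) * thetaSum q x by ring]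
  refine (hasSum_thetaSum hq0 hq1 (x * q)).unique (h2.congr_fun fun m => ?_)
  simp only [Function.comp, Equiv.coe_addRight]
  rw [tri_add, tri_one, zpow_add₀ (neg_ne_zero.2 hx), zpow_add₀ hq, ← neg_mul, mul_zpow]
  simp only [add_zero, mul_one, zpow_one]
  field_simp

/-- The Jacobi triple product. -/
theorem thetaSum_eq (hq0 : 0 < q) (hq1 : q < 1) {u : ℂ} (hu : u ≠ 0) :
    thetaSum q u = qPochInf q q * qTheta q u := by
  have hq := ofReal_ne_zero' hq0
  -- For w = u the terms with m > 0 vanish, since (q^{1-m};q)_∞ = 0, and those with m = -k ≤ 0 form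
  -- Euler's series for (q/u;q)_∞.
  have base : ∀ u : ℂ, u ≠ 0 → ‖u‖ < 1 → thetaSum q u = qPochInf q q * qTheta q u := by
    intro u hu hu1
    have h1 := hasSum_theta_mul_qPochInf hq0 hq1 hu hu1
    have h2 := (hasSum_qPochInf hq0 hq1 (q / u)).mul_left (qPochInf q q)
    have h3 : HasSum (fun m : ℤ => (-u) ^ m * (q : ℂ) ^ tri m *
        qPochInf q ((q : ℂ) ^ (1 - m) * u / u)) (qPochInf q q * qPochInf q (q / u)) := by
      have hinj : Function.Injective (fun k : ℕ => -(k : ℤ)) := fun a b h => by simpa using h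
      rw [← hinj.hasSum_iff]
      · refine h2.congr_fun fun k => ?_
        simp only [Function.comp]
        rw [mul_div_cancel_right₀ _ hu, show (1 : ℤ) - -(k : ℤ) = k + 1 by ring,
          qPochInf_zpow_add_one hq0 hq1, tri_neg, zpow_neg, zpow_natCast, zpow_add₀ hq,
          zpow_natCast, neg_pow u, div_pow]
        have h1 : ((-1 : ℂ) ^ k) * (-1) ^ k = 1 := by rw [← mul_pow]; simp
        have h2 : ((-1 : ℂ) ^ k) ≠ 0 := by simp
        field_simp
        linear_combination (-(qPochInf q q * invQFact q k)) * h1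
      · intro m hm
        have : 0 < m := by
          by_contra h
          exact hm ⟨(-m).toNat, by simp; omega⟩
        rw [mul_div_cancel_right₀ _ hu, show (1 : ℤ) - m = -m + 1 by ring,
          qPochInf_zpow_add_one hq0 hq1, invQFact_of_neg (by omega)]
        simp
    have h4 := h1.unique h3
    have h5 := qPochInf_ne_zero_of_norm_lt_one hq0 hq1 hu1
    rw [qTheta]
    field_simp at h4
    linear_combination h4
  -- Both sides obey the same quasi-periodicity under u ↦ uq, so |u| can be brought below 1.
  have step : ∀ M : ℕ, ∀ u : ℂ, u ≠ 0 → ‖u * (q : ℂ) ^ M‖ < 1 →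
      thetaSum q u = qPochInf q q * qTheta q u := by
    intro M
    induction M with
    | zero => intro u hu h; exact base u hu (by simpa using h)
    | succ M ih =>
      intro u hu h
      have := ih (u * q) (mul_ne_zero hu hq) (by rwa [mul_assoc, ← pow_succ'])
      rw [thetaSum_mul_self hq0 hq1 hu, qTheta_mul_self hq0 hq1 hu] at this
      field_simp at this
      linear_combination -this
  have ht := ((tendsto_ofReal_pow_zero hq0 hq1).const_mul u).norm
  rw [mul_zero, norm_zero] at ht
  obtain ⟨M, hM⟩ := (ht.eventually (gt_mem_nhds one_pos)).exists
  exact step M u hu hM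

/-- Iteration of θ(qx) = -θ(x)/x in both directions; the triangular number collects the powers of q.
-/
theorem qTheta_zpow_mul (hq0 : 0 < q) (hq1 : q < 1) {x : ℂ} (hx : x ≠ 0) (m : ℤ) :
    qTheta q ((q : ℂ) ^ m * x) * (-x) ^ m * (q : ℂ) ^ tri m = qTheta q x := by
  have hq := ofReal_ne_zero' hq0
  have hx' := neg_ne_zero.2 hx
  have step : ∀ m : ℤ, qTheta q ((q : ℂ) ^ (m + 1) * x) * (-x) ^ (m + 1) * (q : ℂ) ^ tri (m + 1) =
      qTheta q ((q : ℂ) ^ m * x) * (-x) ^ m * (q : ℂ) ^ tri m := by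
    intro m
    have := qTheta_mul_self hq0 hq1 (mul_ne_zero (zpow_ne_zero m hq) hx)
    rw [zpow_add₀ hq, zpow_one, mul_right_comm ((q : ℂ) ^ m), this, tri_add, tri_one,
      zpow_add₀ hx', zpow_add₀ hq]
    simp only [add_zero, mul_one, zpow_one]
    field_simp
  induction m with
  | zero => simp
  | succ m ih => rw [step, ih]
  | pred m ih =>
    have := step (-(m : ℤ) - 1)
    rw [sub_add_cancel, ih] at this
    exact this.symm

theorem qTheta_ne_zero (hq0 : 0 < q) (hq1 : q < 1) {x : ℂ} (hx : x ≠ 0)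
    (h : ∀ m : ℤ, (q : ℂ) ^ m * x ≠ 1) : qTheta q x ≠ 0 := by
  have hq := ofReal_ne_zero' hq0
  refine mul_ne_zero (qPochInf_ne_zero hq0 hq1 fun k hk => h k ?_)
    (qPochInf_ne_zero hq0 hq1 fun k hk => h (-(k + 1 : ℤ)) ?_)
  · rw [zpow_natCast, mul_comm]; exact hk
  · rw [zpow_neg, zpow_add₀ hq, zpow_one, zpow_natCast]
    field_simp at hk ⊢
    linear_combination -hk

theorem qTheta_inv (hq0 : 0 < q) (hq1 : q < 1) {x : ℂ} (hx : x ≠ 0) :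
    qTheta q x⁻¹ = -qTheta q x / x := by
  rw [← qTheta_mul_self hq0 hq1 hx, qTheta, qTheta]
  have hq := ofReal_ne_zero' hq0
  rw [mul_comm]
  congr 2 <;> field_simp

theorem continuousOn_qTheta (hq0 : 0 < q) (hq1 : q < 1) : ContinuousOn (qTheta q) {0}ᶜ := by
  unfold qTheta
  exact (continuous_qPochInf hq0 hq1).continuousOn.mul
    ((continuous_qPochInf hq0 hq1).comp_continuousOn
      (continuousOn_const.div continuousOn_id fun x hx => hx))

/-- Ramanujan's bilateral summation with lower parameter zero. -/
theorem hasSum_ramanujan (hq0 : 0 < q) (hq1 : q < 1) {ζ X : ℂ} (hζ0 : ζ ≠ 0)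
    (hζ : ∀ m : ℤ, (q : ℂ) ^ m * ζ ≠ 1) (hX0 : X ≠ 0) (hX : ‖X‖ < 1) :
    HasSum (fun m : ℤ => X ^ m * (1 / qPochInf q (ζ * (q : ℂ) ^ m)))
      (qPochInf q q * qTheta q (ζ * X) / (qTheta q ζ * qPochInf q X)) := by
  have hq := ofReal_ne_zero' hq0
  have h1 := (hasSum_theta_mul_qPochInf hq0 hq1 (mul_ne_zero hζ0 hX0) hX).mul_left (1 / qTheta q ζ)
  rw [thetaSum_eq hq0 hq1 (mul_ne_zero hζ0 hX0)] at h1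
  rw [show qPochInf q q * qTheta q (ζ * X) / (qTheta q ζ * qPochInf q X) =
    1 / qTheta q ζ * (qPochInf q q * qTheta q (ζ * X) * (1 / qPochInf q X)) by ring]
  refine h1.congr_fun fun m => ?_
  have h2 := qTheta_zpow_mul hq0 hq1 hζ0 m
  have h3 := qTheta_ne_zero hq0 hq1 hζ0 hζ
  have e : (q : ℂ) ^ (1 - m) * X / (ζ * X) = q / ((q : ℂ) ^ m * ζ) := by
    rw [zpow_sub₀ hq, zpow_one]; field_simp
  have h4 : qTheta q ((q : ℂ) ^ m * ζ) ≠ 0 := fun h => h3 (by rw [← h2, h]; simp)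
  rw [← h2, e, mul_comm ζ ((q : ℂ) ^ m)]
  rw [qTheta] at h4 ⊢
  have h5 := left_ne_zero_of_mul h4
  have h6 := right_ne_zero_of_mul h4
  have h7 := zpow_ne_zero m (neg_ne_zero.2 hζ0)
  rw [← neg_mul, mul_zpow]
  field_simp

/-- A telescoping case of the `q`-binomial theorem. -/
theorem tendsto_sum_pow_mul_invQFact (hq0 : 0 < q) (hq1 : q < 1) {w : ℂ}
    (hw : ∀ k : ℕ, w * (q : ℂ) ^ k ≠ 1) :
    Tendsto (fun J : ℕ => ∑ j ∈ Finset.range (J + 1),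
      (q : ℂ) ^ j * invQFact q j * (1 / qPochInf q (w * (q : ℂ) ^ j))) atTop
      (𝓝 (1 / (qPochInf q q * (1 - w)))) := by
  have hw0 : 1 - w ≠ 0 := fun h => hw 0 (by rw [pow_zero, mul_one]; linear_combination -h)
  have hne : ∀ j : ℕ, qPochInf q (w * (q : ℂ) ^ j) ≠ 0 := fun j =>
    qPochInf_ne_zero hq0 hq1 fun k => by rw [mul_assoc, ← pow_add]; exact hw _
  have key : ∀ J : ℕ, ∑ j ∈ Finset.range (J + 1),
      (q : ℂ) ^ j * invQFact q j * (1 / qPochInf q (w * (q : ℂ) ^ j)) =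
      invQFact q J * (1 / ((1 - w) * qPochInf q (w * (q : ℂ) ^ (J + 1)))) := by
    intro J
    induction J with
    | zero =>
      have := qPochInf_eq hq0 hq1 w
      simp [this]
    | succ J ih =>
      rw [Finset.sum_range_succ, ih]
      have h1 := invQFact_sub_one hq0 hq1 ((J + 1 : ℕ) : ℤ)
      rw [show (((J + 1 : ℕ) : ℤ) - 1) = (J : ℤ) by omega, zpow_natCast] at h1
      rw [h1]
      have h2 := qPochInf_eq hq0 hq1 (w * (q : ℂ) ^ (J + 1))
      rw [mul_assoc, ← pow_succ] at h2
      have h3 := hne (J + 1)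
      have h4 := hne (J + 1 + 1)
      rw [h2] at h3 ⊢
      have h5 := left_ne_zero_of_mul h3
      generalize (q : ℂ) ^ (J + 1) = Z at *
      have h6 : 1 - Z * w ≠ 0 := by rwa [mul_comm]
      field_simp
      ring
  simp only [key]
  have h1 : Tendsto (fun J : ℕ => qPochInf q (w * (q : ℂ) ^ (J + 1))) atTop (𝓝 1) := by
    have := ((continuous_qPochInf hq0 hq1).tendsto (w * 0)).comp
      (((tendsto_ofReal_pow_zero hq0 hq1).comp (tendsto_add_atTop_nat 1)).const_mul w)
    simpa [Function.comp_def] using this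
  have h0 : Tendsto (fun J : ℕ => 1 / ((1 - w) * qPochInf q (w * (q : ℂ) ^ (J + 1)))) atTop
      (𝓝 (1 / ((1 - w) * 1))) := tendsto_const_nhds.div (h1.const_mul (1 - w)) (by simpa using hw0)
  have h2 := (tendsto_invQFact hq0 hq1).mul h0
  rwa [mul_one, one_div_mul_one_div] at h2

/-- Kronecker's summation. -/
theorem hasSum_kronecker (hq0 : 0 < q) (hq1 : q < 1) {ζ X : ℂ} (hζ0 : ζ ≠ 0)
    (hζ : ∀ m : ℤ, (q : ℂ) ^ m * ζ ≠ 1) (hX0 : X ≠ 0) (hX : ‖X‖ < 1) (hqX : ‖q / X‖ < 1) :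
    HasSum (fun m : ℤ => X ^ m * (1 / (1 - ζ * (q : ℂ) ^ m)))
      (qPochInf q q ^ 2 * qTheta q (ζ * X) / (qTheta q ζ * qTheta q X)) := by
  have hq := ofReal_ne_zero' hq0
  have h1 := hasSum_ramanujan hq0 hq1 hζ0 hζ hX0 hX
  have h2 := hasSum_inv_qPochInf hq0 hq1 hqX
  have h3 := summable_mul_of_summable_norm h1.summable.norm (summable_norm_pow_mul_invQFact hq0 hq1 hqX)
  have h4 := h1.mul h2 h3
  -- Ramanujan's series is multiplied by Euler's series for 1/(q/X;q)_∞. After (m, j) ↦ (m + j, j)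
  -- the power of X no longer depends on j, and the inner sum is the telescoping one of
  -- `tendsto_sum_pow_mul_invQFact`.
  let e : ℤ × ℕ ≃ ℤ × ℕ :=
    { toFun := fun p => (p.1 + p.2, p.2)
      invFun := fun p => (p.1 - p.2, p.2)
      left_inv := fun p => by simp
      right_inv := fun p => by simp }
  have h5 := (e.hasSum_iff (f := fun x : ℤ × ℕ =>
    X ^ x.1 * (1 / qPochInf q (ζ * (q : ℂ) ^ x.1)) * (invQFact q x.2 * (q / X) ^ x.2))).2 h4
  have h6 : HasSum (fun m : ℤ => X ^ m * (1 / (qPochInf q q * (1 - ζ * (q : ℂ) ^ m))))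
      (qPochInf q q * qTheta q (ζ * X) / (qTheta q ζ * qPochInf q X) *
        (1 / qPochInf q (q / X))) := by
    refine h5.prod_fiberwise fun m => ?_
    have hs := h5.summable.prod_factor m
    have ht := tendsto_sum_pow_mul_invQFact hq0 hq1 (w := ζ * (q : ℂ) ^ m) (fun k => by
      have := hζ (m + k)
      rwa [zpow_add₀ hq, zpow_natCast, mul_comm, ← mul_assoc] at this)
    have ht' := ht.const_mul (X ^ m)
    have hs' := hs.hasSum.tendsto_sum_nat.comp (tendsto_add_atTop_nat 1)
    have : ∑' j : ℕ, ((fun x : ℤ × ℕ => X ^ x.1 * (1 / qPochInf q (ζ * (q : ℂ) ^ x.1)) *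
        (invQFact q x.2 * (q / X) ^ x.2)) ∘ e) (m, j) =
        X ^ m * (1 / (qPochInf q q * (1 - ζ * (q : ℂ) ^ m))) := by
      refine tendsto_nhds_unique hs' (ht'.congr fun J => ?_)
      rw [Finset.mul_sum]
      refine Finset.sum_congr rfl fun j _ => ?_
      simp only [Function.comp, e, Equiv.coe_fn_mk]
      rw [zpow_add₀ hX0, zpow_add₀ hq, div_pow, zpow_natCast, zpow_natCast, mul_assoc ζ]
      field_simp
    rw [← this]
    exact hs.hasSum
  have h7 := h6.mul_left (qPochInf q q)
  have hqq := qPochInf_self_ne_zero hq0 hq1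
  have e2 : qPochInf q q ^ 2 * qTheta q (ζ * X) / (qTheta q ζ * qTheta q X) =
      qPochInf q q * (qPochInf q q * qTheta q (ζ * X) / (qTheta q ζ * qPochInf q X) *
        (1 / qPochInf q (q / X))) := by
    simp only [qTheta]; ring
  rw [e2]
  refine h7.congr_fun fun m => ?_
  field_simp

end Theta

/-! ### Addition formulas for the theta function. -/

section ThetaAddition

variable {q : ℝ}

/-- The lattice ℤ² splits by the parity of m + n, and each class is parametrised by rotated
coordinates in which a product of two theta series decouples. -/
theorem hasSum_int_prod_of_parity {f : ℤ × ℤ → ℂ} {A B : ℂ}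
    (hA : HasSum (fun p : ℤ × ℤ => f (p.1 + p.2, p.1 - p.2)) A)
    (hB : HasSum (fun p : ℤ × ℤ => f (p.1 + p.2 + 1, p.1 - p.2)) B) : HasSum f (A + B) := by
  have i0 : Function.Injective (fun p : ℤ × ℤ => (p.1 + p.2, p.1 - p.2)) := fun a b h => by
    simp only [Prod.mk.injEq] at h
    ext <;> omega
  have i1 : Function.Injective (fun p : ℤ × ℤ => (p.1 + p.2 + 1, p.1 - p.2)) := fun a b h => by
    simp only [Prod.mk.injEq] at h
    ext <;> omega
  refine HasSum.add_isCompl ?_ (i0.hasSum_range_iff.2 hA) (i1.hasSum_range_iff.2 hB)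
  rw [isCompl_iff, Set.disjoint_iff_forall_ne, codisjoint_iff]
  constructor
  · rintro _ ⟨a, rfl⟩ _ ⟨b, rfl⟩ h
    simp only [Prod.mk.injEq] at h
    omega
  · refine Set.eq_univ_iff_forall.2 ?_
    rintro ⟨m, n⟩
    refine (Set.mem_union _ _ _).2 ?_
    simp only [Set.mem_range, Prod.exists, Prod.mk.injEq]
    rcases Int.emod_two_eq_zero_or_one (m + n) with h | h
    · exact Or.inl ⟨(m + n) / 2, (m - n) / 2, by omega, by omega⟩
    · exact Or.inr ⟨(m + n - 1) / 2, (m - n - 1) / 2, by omega, by omega⟩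

/-- The even part `∑ q^{n ^ 2} u^{2 n}`. -/
def thetaEven (q : ℝ) (u : ℂ) : ℂ := thetaSum (q ^ 2) (-(q * u ^ 2))

/-- The odd part `∑ q^{n ^ 2 + n} u^{2 n + 1}`. -/
def thetaOdd (q : ℝ) (u : ℂ) : ℂ := u * thetaSum (q ^ 2) (-((q : ℂ) ^ 2 * u ^ 2))

theorem thetaEven_term {u : ℂ} (hq0 : 0 < q) (n : ℤ) :
    (-(-((q : ℂ) * u ^ 2))) ^ n * ((q ^ 2 : ℝ) : ℂ) ^ tri n = (q : ℂ) ^ (n * n) * (u ^ n) ^ 2 := by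
  have hq := ofReal_ne_zero' hq0
  have h : n * n = n + tri n * 2 := by have := two_mul_tri n; nlinarith
  have h2 : ∀ (x : ℂ) (m : ℤ), (x ^ 2) ^ m = (x ^ m) ^ 2 := fun x m => by
    rw [sq, sq, mul_zpow]
  push_cast
  rw [neg_neg, mul_zpow, h, zpow_add₀ hq, zpow_mul, h2, h2, ← zpow_ofNat ((q : ℂ) ^ tri n)]
  ring

theorem thetaOdd_term {u : ℂ} (hq0 : 0 < q) (n : ℤ) :
    u * ((-(-((q : ℂ) ^ 2 * u ^ 2))) ^ n * ((q ^ 2 : ℝ) : ℂ) ^ tri n) =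
      (q : ℂ) ^ (n * n + n) * ((u ^ n) ^ 2 * u) := by
  have h1 : (-(-((q : ℂ) ^ 2 * u ^ 2))) ^ n = (q : ℂ) ^ n * (-(-((q : ℂ) * u ^ 2))) ^ n := by
    rw [neg_neg, neg_neg, ← mul_zpow]; congr 1; ring
  rw [h1, mul_assoc, thetaEven_term hq0, zpow_add₀ (ofReal_ne_zero' hq0)]
  ring

theorem hasSum_thetaEven (hq0 : 0 < q) (hq1 : q < 1) (u : ℂ) :
    HasSum (fun n : ℤ => (q : ℂ) ^ (n * n) * (u ^ n) ^ 2) (thetaEven q u) := by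
  refine (hasSum_thetaSum (pow_pos hq0 2) (pow_lt_one₀ hq0.le hq1 two_ne_zero)
    (-(q * u ^ 2))).congr_fun fun n => ?_
  rw [thetaEven_term hq0]

theorem hasSum_thetaOdd (hq0 : 0 < q) (hq1 : q < 1) (u : ℂ) :
    HasSum (fun n : ℤ => (q : ℂ) ^ (n * n + n) * ((u ^ n) ^ 2 * u)) (thetaOdd q u) := by
  refine ((hasSum_thetaSum (pow_pos hq0 2) (pow_lt_one₀ hq0.le hq1 two_ne_zero)
    (-((q : ℂ) ^ 2 * u ^ 2))).mul_left u).congr_fun fun n => ?_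
  rw [thetaOdd_term hq0]

/-- With indices c + d and c - d the exponent tri(c+d) + tri(c-d) + (c+d) equals c² + (d² + d), so
the variables u and v separate. The even class gives the first product on the right, the odd class
the second one. -/
theorem thetaSum_mul_thetaSum (hq0 : 0 < q) (hq1 : q < 1) {u v : ℂ} (hu : u ≠ 0) (hv : v ≠ 0) :
    v * (thetaSum q (u * v * q) * thetaSum q (u / v)) =
      thetaEven q u * thetaOdd q v - thetaOdd q u * thetaEven q v := by
  have hq := ofReal_ne_zero' hq0
  have hs : ∀ {x y : ℂ} {f g : ℤ → ℂ}, HasSum f x → HasSum g y →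
      HasSum (fun p : ℤ × ℤ => f p.1 * g p.2) (x * y) := fun hf hg =>
    hf.mul hg (summable_mul_of_summable_norm hf.summable.norm hg.summable.norm)
  have h1 := (hs (hasSum_thetaSum hq0 hq1 (u * v * q)) (hasSum_thetaSum hq0 hq1 (u / v))).mul_left v
  refine h1.unique ?_
  rw [sub_eq_add_neg]
  have sgn : ∀ c d : ℤ, (-1 : ℂ) ^ (c + d) * (-1) ^ (c - d) = 1 := fun c d => by
    rw [← zpow_add₀ (by norm_num), show c + d + (c - d) = 2 * c by ring, zpow_mul]; simp
  have e1 : ∀ c d : ℤ, tri (c + d) + tri (c - d) + (c + d) = c * c + (d * d + d) := fun c d => by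
    have := two_mul_tri (c + d)
    have := two_mul_tri (c - d)
    nlinarith
  have base : ∀ c d : ℤ, v * ((-(u * v * q)) ^ (c + d) * (q : ℂ) ^ tri (c + d) *
      ((-(u / v)) ^ (c - d) * (q : ℂ) ^ tri (c - d))) =
      (q : ℂ) ^ (c * c) * (u ^ c) ^ 2 * ((q : ℂ) ^ (d * d + d) * ((v ^ d) ^ 2 * v)) := by
    intro c d
    have h2 : (q : ℂ) ^ (c * c) * (q : ℂ) ^ (d * d + d) =
        (q : ℂ) ^ tri (c + d) * (q : ℂ) ^ tri (c - d) * (q : ℂ) ^ (c + d) := by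
      rw [← zpow_add₀ hq, ← e1, zpow_add₀ hq, zpow_add₀ hq]
    have h3 : (-(u * v * q)) ^ (c + d) * (-(u / v)) ^ (c - d) =
        (q : ℂ) ^ (c + d) * ((u ^ c) ^ 2 * (v ^ d) ^ 2) := by
      rw [neg_eq_neg_one_mul, neg_eq_neg_one_mul (u / v), mul_zpow, mul_zpow (-1 : ℂ) (u / v),
        mul_mul_mul_comm, sgn, one_mul, mul_zpow, mul_zpow, div_zpow, zpow_add₀ hu, zpow_sub₀ hu,
        zpow_add₀ hv, zpow_sub₀ hv]
      have := zpow_ne_zero d hu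
      have := zpow_ne_zero d hv
      have := zpow_ne_zero c hv
      field_simp
    linear_combination (v * (q : ℂ) ^ tri (c + d) * (q : ℂ) ^ tri (c - d)) * h3 -
      (v * (u ^ c) ^ 2 * (v ^ d) ^ 2) * h2
  refine hasSum_int_prod_of_parity ?_ ?_
  · refine (hs (hasSum_thetaEven hq0 hq1 u) (hasSum_thetaOdd hq0 hq1 v)).congr_fun fun p => ?_
    exact base p.1 p.2
  · have h2 := ((Equiv.addRight (1 : ℤ)).hasSum_iff).2 (hasSum_thetaEven hq0 hq1 v)
    refine (hs (hasSum_thetaOdd hq0 hq1 u) h2).neg.congr_fun fun p => ?_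
    have h3 := base p.1 p.2
    have hn : -(u * v * q) ≠ 0 := neg_ne_zero.2 (mul_ne_zero (mul_ne_zero hu hv) hq)
    simp only [Function.comp, Equiv.coe_addRight]
    rw [tri_add, tri_one, zpow_add₀ hn, zpow_add₀ hq, mul_one, add_zero, zpow_one]
    rw [zpow_add₀ hq (p.1 * p.1) p.1, zpow_add₀ hq p.1 p.2,
      show (p.2 + 1) * (p.2 + 1) = (p.2 * p.2 + p.2) + p.2 + 1 by ring,
      zpow_add₀ hq (p.2 * p.2 + p.2 + p.2), zpow_add₀ hq (p.2 * p.2 + p.2), zpow_add₀ hv,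
      zpow_one, zpow_one]
    linear_combination (-(u * v * q) * (q : ℂ) ^ p.1 * (q : ℂ) ^ p.2) * h3

/-- θ(uv)θ(u/v) is, up to a simple factor, the 2 × 2 minor of the columns (E(u), O(u)) and (E(v),
O(v)) formed from `thetaEven` and `thetaOdd`. -/
theorem thetaSum_mul_thetaSum' (hq0 : 0 < q) (hq1 : q < 1) {u v : ℂ} (hu : u ≠ 0) (hv : v ≠ 0) :
    qPochInf q q ^ 2 * (qTheta q (u * v) * qTheta q (u / v)) =
      -u * (thetaEven q u * thetaOdd q v - thetaOdd q u * thetaEven q v) := by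
  rw [← thetaSum_mul_thetaSum hq0 hq1 hu hv, thetaSum_mul_self hq0 hq1 (mul_ne_zero hu hv),
    thetaSum_eq hq0 hq1 (mul_ne_zero hu hv), thetaSum_eq hq0 hq1 (div_ne_zero hu hv)]
  field_simp

/-- The three-term (Weierstrass) addition formula. -/
theorem qTheta_three_term (hq0 : 0 < q) (hq1 : q < 1) {a b c d : ℂ} (ha : a ≠ 0) (hb : b ≠ 0)
    (hc : c ≠ 0) (hd : d ≠ 0) :
    qTheta q (a * b) * qTheta q (a / b) * (qTheta q (c * d) * qTheta q (c / d)) -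
      qTheta q (a * d) * qTheta q (a / d) * (qTheta q (c * b) * qTheta q (c / b)) =
    c / b * (qTheta q (a * c) * qTheta q (a / c) * (qTheta q (b * d) * qTheta q (b / d))) := by
  have hqq := pow_ne_zero 2 (qPochInf_self_ne_zero hq0 hq1)
  refine mul_left_cancel₀ (mul_ne_zero hqq hqq) ?_
  -- All six products become 2 × 2 minors of one 2 × 4 matrix, so the claim is the Plücker relation.
  have T := @thetaSum_mul_thetaSum' q hq0 hq1
  have h1 := T ha hb
  have h2 := T hc hd
  have h3 := T ha hd
  have h4 := T hc hb
  have h5 := T ha hc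
  have h6 := T hb hd
  set Q := qPochInf q q ^ 2
  calc _ = (Q * (qTheta q (a * b) * qTheta q (a / b))) * (Q * (qTheta q (c * d) * qTheta q (c / d)))
      - (Q * (qTheta q (a * d) * qTheta q (a / d))) * (Q * (qTheta q (c * b) * qTheta q (c / b))) := by
        ring
    _ = c / b * ((Q * (qTheta q (a * c) * qTheta q (a / c))) *
        (Q * (qTheta q (b * d) * qTheta q (b / d)))) := by
        rw [h1, h2, h3, h4, h5, h6]; field_simp; ring
    _ = _ := by ring

theorem exists_sq_eq (x : ℂ) (hx : x ≠ 0) : ∃ y : ℂ, y ≠ 0 ∧ y ^ 2 = x := by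
  obtain ⟨y, hy⟩ := IsAlgClosed.exists_pow_nat_eq x two_pos
  exact ⟨y, fun h => hx (by rw [← hy, h]; simp), hy⟩

/-- The two by two case of Frobenius' determinant. -/
theorem qTheta_fay (hq0 : 0 < q) (hq1 : q < 1) {ζ x y z w : ℂ} (hζ : ζ ≠ 0) (hx : x ≠ 0)
    (hy : y ≠ 0) (hz : z ≠ 0) (hw : w ≠ 0) :
    qTheta q (ζ * (x / z)) * qTheta q (ζ * (y / w)) * (qTheta q (y / z) * qTheta q (x / w)) -
      qTheta q (ζ * (y / z)) * qTheta q (ζ * (x / w)) * (qTheta q (x / z) * qTheta q (y / w)) =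
    y / w * (qTheta q ζ * qTheta q (ζ * (x / z) * (y / w)) * (qTheta q (w / z) * qTheta q (x / y))) := by
  -- The parameters that specialise the three-term relation involve square roots of ζ, x and y; only
  -- their squares survive in the arguments of θ.
  obtain ⟨e, he, rfl⟩ := exists_sq_eq ζ hζ
  obtain ⟨f, hf, rfl⟩ := exists_sq_eq x hx
  obtain ⟨g, hg, rfl⟩ := exists_sq_eq y hy
  have h := qTheta_three_term hq0 hq1 (a := e * f * g / z) (b := e * f / g) (c := e * f * g / w)
    (d := e * g / f) (by positivity) (by positivity) (by positivity) (by positivity)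
  have e1 : e * f * g / z * (e * f / g) = e ^ 2 * (f ^ 2 / z) := by field_simp
  have e2 : e * f * g / z / (e * f / g) = g ^ 2 / z := by field_simp
  have e3 : e * f * g / w * (e * g / f) = e ^ 2 * (g ^ 2 / w) := by field_simp
  have e4 : e * f * g / w / (e * g / f) = f ^ 2 / w := by field_simp
  have e5 : e * f * g / z * (e * g / f) = e ^ 2 * (g ^ 2 / z) := by field_simp
  have e6 : e * f * g / z / (e * g / f) = f ^ 2 / z := by field_simp
  have e7 : e * f * g / w * (e * f / g) = e ^ 2 * (f ^ 2 / w) := by field_simp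
  have e8 : e * f * g / w / (e * f / g) = g ^ 2 / w := by field_simp
  have e9 : e * f * g / z * (e * f * g / w) = e ^ 2 * (f ^ 2 / z) * (g ^ 2 / w) := by field_simp
  have e10 : e * f * g / z / (e * f * g / w) = w / z := by field_simp
  have e11 : e * f / g * (e * g / f) = e ^ 2 := by field_simp
  have e12 : e * f / g / (e * g / f) = f ^ 2 / g ^ 2 := by field_simp
  rw [e1, e2, e3, e4, e5, e6, e7, e8, e9, e10, e11, e12] at h
  linear_combination h

end ThetaAddition

/-! ### Cauchy determinants, trigonometric and elliptic. -/

section Determinants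

/-- Row 0 clears the first column. For Cauchy-type matrices the Schur complement is again of the
same type up to row and column factors, which drives both inductions below. -/
theorem det_eq_mul_det_schur {K : Type*} [Field K] {n : ℕ} (M : Matrix (Fin (n + 1)) (Fin (n + 1)) K)
    (h : M 0 0 ≠ 0) :
    M.det = M 0 0 * (Matrix.of fun i j : Fin n =>
      M i.succ j.succ - M i.succ 0 * M 0 j.succ / M 0 0).det := by
  let c : Fin (n + 1) → K := fun i => M i 0 / M 0 0
  let B : Matrix (Fin (n + 1)) (Fin (n + 1)) K := Matrix.of
    (Fin.cons (M 0) fun i j => M i.succ j - c i.succ * M 0 j)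
  have hM : M.det = B.det := by
    refine Matrix.det_eq_of_forall_row_eq_smul_add_const (Fin.cons 0 fun i => c i.succ) 0 (by simp)
      fun i j => ?_
    refine Fin.cases ?_ (fun i => ?_) i
    · simp [B]
    · simp [B]
  rw [hM, Matrix.det_succ_column_zero, Finset.sum_eq_single 0]
  · simp only [Fin.val_zero, pow_zero, one_mul, Fin.succAbove_zero]
    congr 2
    ext i j
    simp [B, c]
    ring
  · intro i _ hi
    obtain ⟨k, rfl⟩ := Fin.exists_succ_eq.2 hi
    have : B k.succ 0 = 0 := by simp [B, c, h]
    rw [this]; simp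
  · simp

theorem prod_Ioi_fin_succ {M : Type*} [CommMonoid M] {n : ℕ} (f : Fin (n + 1) → Fin (n + 1) → M) :
    ∏ i, ∏ j ∈ Finset.Ioi i, f i j =
      (∏ j : Fin n, f 0 j.succ) * ∏ i : Fin n, ∏ j ∈ Finset.Ioi i, f i.succ j.succ := by
  rw [Fin.prod_univ_succ, Fin.prod_Ioi_zero]
  simp only [Fin.prod_Ioi_succ]

theorem det_mul_row_col {K : Type*} [CommRing K] {n : ℕ} (r c : Fin n → K) (M : Matrix (Fin n) (Fin n) K) :
    (Matrix.of fun i j => r i * (c j * M i j)).det = (∏ i, r i) * ((∏ j, c j) * M.det) := by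
  rw [← Matrix.det_mul_row, ← Matrix.det_mul_column]
  rfl

theorem sin_mul_sin_sub (s₀ s₁ a₀ a₁ : ℂ) :
    Complex.sin (s₁ - a₀) * Complex.sin (s₀ - a₁) - Complex.sin (s₁ - a₁) * Complex.sin (s₀ - a₀) =
      Complex.sin (s₁ - s₀) * Complex.sin (a₀ - a₁) := by
  simp only [Complex.sin_sub]
  have h1 := Complex.sin_sq_add_cos_sq s₀
  have h2 := Complex.sin_sq_add_cos_sq s₁
  have h3 := Complex.sin_sq_add_cos_sq a₀
  have h4 := Complex.sin_sq_add_cos_sq a₁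
  ring

/-- Cauchy's determinant in trigonometric form. -/
theorem det_inv_sin {n : ℕ} (s a : Fin n → ℂ) (h : ∀ i j, Complex.sin (π * (s i - a j)) ≠ 0) :
    (Matrix.of fun i j => 1 / Complex.sin (π * (s i - a j))).det =
      (∏ i, ∏ j ∈ Finset.Ioi i, Complex.sin (π * (s j - s i)) * Complex.sin (π * (a i - a j))) /
        ∏ i, ∏ j, Complex.sin (π * (s i - a j)) := by
  induction n with
  | zero => simp
  | succ n ih =>
    rw [det_eq_mul_det_schur _ (by simpa using h 0 0)]
    -- By `sin_mul_sin_sub` the complement is a cosecant matrix in the remaining variables, times a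
    -- factor for each row and one for each column.
    have e : (Matrix.of fun i j : Fin n =>
        (Matrix.of fun i j => 1 / Complex.sin (π * (s i - a j))) i.succ j.succ -
          (Matrix.of fun i j => 1 / Complex.sin (π * (s i - a j))) i.succ 0 *
          (Matrix.of fun i j => 1 / Complex.sin (π * (s i - a j))) 0 j.succ /
          (Matrix.of fun i j => 1 / Complex.sin (π * (s i - a j))) 0 0) =
        Matrix.of fun i j : Fin n =>
          (Complex.sin (π * (s i.succ - s 0)) / Complex.sin (π * (s i.succ - a 0))) *
          ((Complex.sin (π * (a 0 - a j.succ)) / Complex.sin (π * (s 0 - a j.succ))) *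
          (Matrix.of fun i j : Fin n => 1 / Complex.sin (π * (s i.succ - a j.succ))) i j) := by
      ext i j
      simp only [Matrix.of_apply]
      have h1 := h i.succ j.succ
      have h2 := h i.succ 0
      have h3 := h 0 j.succ
      have h4 := h 0 0
      have h5 := sin_mul_sin_sub (π * s 0) (π * s i.succ) (π * a 0) (π * a j.succ)
      simp only [← mul_sub] at h5
      field_simp
      linear_combination h5
    rw [e, det_mul_row_col, ih (fun i => s i.succ) (fun i => a i.succ) fun i j => h _ _,
      prod_Ioi_fin_succ, Fin.prod_univ_succ (fun i => ∏ j, Complex.sin (π * (s i - a j))),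
      Fin.prod_univ_succ (fun j => Complex.sin (π * (s 0 - a j)))]
    simp only [Fin.prod_univ_succ (fun j => Complex.sin (π * (s _ - a j)))]
    simp only [Finset.prod_mul_distrib, Finset.prod_div_distrib, Matrix.of_apply]
    simp only [div_eq_mul_inv, mul_inv]
    ring

variable {q : ℝ}

/-- A countable set has dense complement in ℂ, so the countably many ζ with a vanishing pivot can be
ignored. -/
theorem eqOn_of_continuousOn_of_countable {f g : ℂ → ℂ} {S : Set ℂ} (hS : S.Countable)
    (hf : ContinuousOn f {0}ᶜ) (hg : ContinuousOn g {0}ᶜ) (h : ∀ ζ, ζ ≠ 0 → ζ ∉ S → f ζ = g ζ) :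
    Set.EqOn f g {0}ᶜ := by
  have hd : Dense (S ∪ {0})ᶜ := (hS.union (Set.countable_singleton 0)).dense_compl ℝ
  refine Set.EqOn.of_subset_closure (s := (S ∪ {0})ᶜ) (fun ζ hζ => h ζ ?_ ?_) hf hg ?_ ?_
  · exact fun h0 => hζ (Or.inr h0)
  · exact fun h0 => hζ (Or.inl h0)
  · exact fun ζ hζ h0 => hζ (Or.inr h0)
  · rw [hd.closure_eq]; exact Set.subset_univ _

/-- Frobenius' elliptic Cauchy determinant. -/
theorem det_qTheta (hq0 : 0 < q) (hq1 : q < 1) {n : ℕ} (x z : Fin (n + 1) → ℂ)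
    (hx : ∀ i, x i ≠ 0) (hz : ∀ i, z i ≠ 0) (h : ∀ i j, qTheta q (x j / z i) ≠ 0) {ζ : ℂ}
    (hζ : ζ ≠ 0) :
    (Matrix.of fun i j => qTheta q (ζ * (x j / z i)) / qTheta q (x j / z i)).det =
      qTheta q ζ ^ n * qTheta q (ζ * ∏ j, (x j / z j)) *
        (∏ i, ∏ j ∈ Finset.Ioi i, (x j / z j) * (qTheta q (z j / z i) * qTheta q (x i / x j))) /
        ∏ i, ∏ j, qTheta q (x j / z i) := by
  induction n generalizing ζ with
  | zero => simp [Matrix.det_unique]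
  | succ n ih =>
    have hT := continuousOn_qTheta hq0 hq1
    have hcont : ∀ c : ℂ, c ≠ 0 → ContinuousOn (fun ζ => qTheta q (ζ * c)) {0}ᶜ := fun c hc =>
      hT.comp (by fun_prop) fun ζ hζ => mul_ne_zero hζ hc
    have hxz : ∀ i j, x j / z i ≠ 0 := fun i j => div_ne_zero (hx j) (hz i)
    refine eqOn_of_continuousOn_of_countable
      (S := Set.range fun m : ℤ => ((q : ℂ) ^ m * (x 0 / z 0))⁻¹) (Set.countable_range _)
      (f := fun ζ => (Matrix.of fun i j => qTheta q (ζ * (x j / z i)) / qTheta q (x j / z i)).det)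
      (g := fun ζ => qTheta q ζ ^ (n + 1) * qTheta q (ζ * ∏ j, (x j / z j)) *
        (∏ i, ∏ j ∈ Finset.Ioi i, (x j / z j) * (qTheta q (z j / z i) * qTheta q (x i / x j))) /
        ∏ i, ∏ j, qTheta q (x j / z i)) ?_ ?_ ?_ hζ
    · simp only [Matrix.det_apply]
      refine continuousOn_finsetSum _ fun σ _ => ContinuousOn.const_smul ?_ _
      refine continuousOn_finsetProd _ fun i _ => ?_
      simp only [Matrix.of_apply]
      exact (hcont _ (hxz _ _)).div_const _
    · exact (((hT.pow _).mul (hcont _ (Finset.prod_ne_zero_iff.2 fun j _ => hxz _ _))).mul_const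
        _).div_const _
    · intro ζ hζ hS
      have hζ' : ζ * (x 0 / z 0) ≠ 0 := mul_ne_zero hζ (hxz _ _)
      have hp : qTheta q (ζ * (x 0 / z 0)) ≠ 0 := qTheta_ne_zero hq0 hq1 hζ' fun m hm => hS
        ⟨m, by
          have h1 := hxz 0 0
          have h2 := zpow_ne_zero m (ofReal_ne_zero' hq0)
          show ((q : ℂ) ^ m * (x 0 / z 0))⁻¹ = ζ
          rw [inv_eq_iff_eq_inv]
          refine eq_inv_of_mul_eq_one_left ?_
          linear_combination hm⟩
      rw [det_eq_mul_det_schur _ (by simpa using ⟨hp, h 0 0⟩)]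
      -- By `qTheta_fay` the Schur complement is the same kind of matrix with ζ replaced by ζ
      -- x_0/z_0. This is why the induction is over all ζ at once.
      have e : (Matrix.of fun i j : Fin (n + 1) =>
          (Matrix.of fun i j => qTheta q (ζ * (x j / z i)) / qTheta q (x j / z i)) i.succ j.succ -
          (Matrix.of fun i j => qTheta q (ζ * (x j / z i)) / qTheta q (x j / z i)) i.succ 0 *
          (Matrix.of fun i j => qTheta q (ζ * (x j / z i)) / qTheta q (x j / z i)) 0 j.succ /
          (Matrix.of fun i j => qTheta q (ζ * (x j / z i)) / qTheta q (x j / z i)) 0 0) =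
          Matrix.of fun i j : Fin (n + 1) =>
          (qTheta q ζ / qTheta q (ζ * (x 0 / z 0)) * (qTheta q (z i.succ / z 0) /
            (z i.succ * qTheta q (x 0 / z i.succ)))) *
          ((x j.succ * qTheta q (x 0 / x j.succ) / qTheta q (x j.succ / z 0)) *
          (Matrix.of fun i j : Fin (n + 1) => qTheta q (ζ * (x 0 / z 0) * (x j.succ / z i.succ)) /
            qTheta q (x j.succ / z i.succ)) i j) := by
        ext i j
        simp only [Matrix.of_apply]
        have h1 := h i.succ j.succ
        have h2 := h i.succ 0
        have h3 := h 0 j.succ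
        have h4 := h 0 0
        have h5 := qTheta_fay hq0 hq1 hζ (hx 0) (hx j.succ) (hz 0) (hz i.succ)
        have h6 := hz i.succ
        have h7 := hx j.succ
        generalize qTheta q (ζ * (x 0 / z 0)) = t1 at *
        generalize qTheta q (ζ * (x j.succ / z i.succ)) = t2 at *
        generalize qTheta q (ζ * (x 0 / z i.succ)) = t3 at *
        generalize qTheta q (ζ * (x j.succ / z 0)) = t4 at *
        generalize qTheta q (ζ * (x 0 / z 0) * (x j.succ / z i.succ)) = t5 at *
        generalize qTheta q (x 0 / z 0) = t6 at *
        generalize qTheta q (x j.succ / z 0) = t7 at *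
        generalize qTheta q (x 0 / z i.succ) = t8 at *
        generalize qTheta q (x j.succ / z i.succ) = t9 at *
        generalize qTheta q (z i.succ / z 0) = t10 at *
        generalize qTheta q (x 0 / x j.succ) = t11 at *
        generalize qTheta q ζ = t12 at *
        field_simp at h5 ⊢
        linear_combination h5
      rw [e, det_mul_row_col, ih (fun i => x i.succ) (fun i => z i.succ) (fun i => hx _)
        (fun i => hz _) (fun i j => h _ _) hζ',
        prod_Ioi_fin_succ (fun i j => (x j / z j) * (qTheta q (z j / z i) * qTheta q (x i / x j))),
        Fin.prod_univ_succ (fun i => ∏ j, qTheta q (x j / z i))]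
      simp only [Fin.prod_univ_succ (fun j => qTheta q (x j / z _)),
        Fin.prod_univ_succ (fun j => x j / z j)]
      simp only [Finset.prod_mul_distrib, Finset.prod_div_distrib, Matrix.of_apply,
        Finset.prod_const, Finset.card_univ, Fintype.card_fin, mul_assoc ζ]
      generalize qTheta q (ζ * (x 0 / z 0)) = t1 at hp ⊢
      -- Let t1 = θ(ζ x_0/z_0). It enters through the pivot, through the row factors θ(ζ)/t1 and as
      -- t1^n from the induction hypothesis; with θ(ζ) = w t1 these collect without division.
      obtain ⟨w, hw⟩ : ∃ w, qTheta q ζ = w * t1 := ⟨qTheta q ζ / t1, (div_mul_cancel₀ _ hp).symm⟩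
      rw [hw, mul_pow, mul_div_cancel_right₀ _ (pow_ne_zero _ hp)]
      simp only [div_eq_mul_inv, mul_inv]
      ring

end Determinants

/-! ### Modular inversion and the periodisation of (-ζ)^s / sin πs. -/

section Modular

open Complex in
theorem thetaSum_exp_eq_jacobiTheta₂ {q : ℝ} (hq0 : 0 < q) {τ : ℂ}
    (hτ : 2 * π * I * τ = (Real.log q : ℂ)) (v : ℂ) :
    thetaSum q (exp (2 * π * I * v)) = jacobiTheta₂ (v - τ / 2 + 1 / 2) τ := by
  unfold thetaSum jacobiTheta₂
  refine tsum_congr fun m => ?_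
  have h1 : (q : ℂ) = exp (2 * π * I * τ) := by
    rw [hτ, ← ofReal_exp, Real.exp_log hq0]
  have h2 : -exp (2 * π * I * v) = exp (2 * π * I * v + π * I) := by
    rw [exp_add, exp_pi_mul_I]; ring
  rw [h2, h1, ← exp_int_mul, ← exp_int_mul, ← exp_add, jacobiTheta₂_term]
  congr 1
  have h3 : (2 : ℂ) * (tri m : ℂ) = (m : ℂ) * (m - 1) := by exact_mod_cast two_mul_tri m
  linear_combination (π * I * τ) * h3

variable {q : ℝ}

theorem ofReal_cpow_eq_exp (hq0 : 0 < q) (s : ℂ) :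
    (q : ℂ) ^ s = Complex.exp ((Real.log q : ℂ) * s) := by
  rw [Complex.cpow_def_of_ne_zero (ofReal_ne_zero' hq0), Complex.ofReal_log hq0.le]

/-- The nome of the theta function obtained by the modular inversion. -/
def dualNome (q : ℝ) : ℝ := Real.exp (4 * π ^ 2 / Real.log q)

theorem dualNome_pos (q : ℝ) : 0 < dualNome q := Real.exp_pos _

theorem dualNome_lt_one (hq0 : 0 < q) (hq1 : q < 1) : dualNome q < 1 :=
  Real.exp_lt_one_iff.2 (div_neg_of_pos_of_neg (by positivity) (Real.log_neg hq0 hq1))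

/-- The gaussian factor of the modular inversion. -/
def gaussFactor (q : ℝ) (s : ℂ) : ℂ :=
  Complex.exp (-(π * Complex.I * s) + (Real.log q : ℂ) / 2 * (s - s ^ 2))

/-- The constant of the modular inversion. -/
def modularConst (q : ℝ) : ℂ :=
  qPochInf q q ^ 3 * (Real.log q : ℂ) /
    (qPochInf (dualNome q) (dualNome q) ^ 3 * (2 * π * Complex.I))

/-- The theta function has a zero at 1, and its derivative there is a cube of (q;q)_∞. Comparing
such derivatives fixes the constant in the modular inversion. -/
theorem hasDerivAt_thetaSum_exp (hq0 : 0 < q) (hq1 : q < 1) (c : ℂ) :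
    HasDerivAt (fun s : ℂ => thetaSum q (Complex.exp (c * s))) (-(c * qPochInf q q ^ 3)) 0 := by
  have e : (fun s : ℂ => thetaSum q (Complex.exp (c * s))) = fun s =>
      (1 - Complex.exp (c * s)) * (qPochInf q q * (qPochInf q (Complex.exp (c * s) * q) *
        qPochInf q (q * Complex.exp (-(c * s))))) := by
    funext s
    rw [thetaSum_eq hq0 hq1 (Complex.exp_ne_zero _), qTheta,
      qPochInf_eq hq0 hq1 (Complex.exp (c * s)), Complex.exp_neg]
    ring_nf
  rw [e]
  have hd := differentiable_qPochInf hq0 hq1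
  have h1 : HasDerivAt (fun s : ℂ => 1 - Complex.exp (c * s)) (-c) 0 := by
    have := (((hasDerivAt_id (0 : ℂ)).const_mul c).cexp).const_sub 1
    simpa using this
  have h2 : Differentiable ℂ fun s : ℂ => (qPochInf q q * (qPochInf q (Complex.exp (c * s) * q) *
        qPochInf q (q * Complex.exp (-(c * s))))) := by
    have h3 := hd.comp (f := fun s : ℂ => Complex.exp (c * s) * q) (by fun_prop)
    have h4 := hd.comp (f := fun s : ℂ => q * Complex.exp (-(c * s))) (by fun_prop)
    exact (h3.mul h4).const_mul _
  refine (h1.mul (h2 0).hasDerivAt).congr_deriv ?_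
  simp only [mul_zero, Complex.exp_zero, sub_self, zero_mul, add_zero, one_mul, mul_one, neg_zero]
  ring

open Complex in
-- Jacobi's imaginary transformation with τ = log q/(2πi). The functional equation of `jacobiTheta₂`
-- gives the identity up to a constant; both sides vanish at s = 0, and their derivatives there
-- identify the constant as `modularConst`.
theorem thetaSum_modular (hq0 : 0 < q) (hq1 : q < 1) (s : ℂ) :
    thetaSum q ((q : ℂ) ^ s) =
      modularConst q * gaussFactor q s * thetaSum (dualNome q) (exp (2 * π * I * s)) := by
  have hL : (Real.log q : ℂ) ≠ 0 := by exact_mod_cast (Real.log_neg hq0 hq1).ne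
  have hpi : (π : ℂ) ≠ 0 := by exact_mod_cast Real.pi_ne_zero
  set τ : ℂ := (Real.log q : ℂ) / (2 * π * I) with hτdef
  have hτ0 : τ ≠ 0 := div_ne_zero hL (mul_ne_zero (mul_ne_zero two_ne_zero hpi) I_ne_zero)
  have hτ : 2 * π * I * τ = (Real.log q : ℂ) := by
    rw [hτdef]; field_simp
  have hτ' : 2 * π * I * (-1 / τ) = (Real.log (dualNome q) : ℂ) := by
    rw [dualNome, Real.log_exp, hτdef]; push_cast; field_simp
    linear_combination (-(4 : ℂ)) * I_sq
  obtain ⟨c, hc⟩ : ∃ c : ℂ, ∀ s : ℂ, thetaSum q ((q : ℂ) ^ s) =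
      c * gaussFactor q s * thetaSum (dualNome q) (exp (2 * π * I * s)) := by
    refine ⟨1 / (-I * τ) ^ (1 / 2 : ℂ) * exp (-π * I * ((1 - τ) / 2) ^ 2 / τ), fun s => ?_⟩
    have e1 : (q : ℂ) ^ s = exp (2 * π * I * (τ * s)) := by
      rw [ofReal_cpow_eq_exp hq0, ← hτ]; ring_nf
    rw [e1, thetaSum_exp_eq_jacobiTheta₂ hq0 hτ, jacobiTheta₂_functional_equation,
      thetaSum_exp_eq_jacobiTheta₂ (dualNome_pos q) hτ', gaussFactor, mul_assoc (1 / _),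
      mul_assoc (1 / _), mul_assoc (1 / _), mul_assoc (exp _), ← mul_assoc (exp _) (exp _), ← exp_add,
      ← hτ]
    -- The half-period shifts on the two sides differ by 1, a period of `jacobiTheta₂` in its first
    -- argument.
    have e2 : (τ * s - τ / 2 + 1 / 2) / τ + 1 = s - -1 / τ / 2 + 1 / 2 := by field_simp; ring
    rw [← e2, jacobiTheta₂_add_left]
    congr 3
    field_simp
    ring
  have hp0 := dualNome_pos q
  have hp1 := dualNome_lt_one hq0 hq1
  have hpp := qPochInf_self_ne_zero hp0 hp1
  have d1 := hasDerivAt_thetaSum_exp hq0 hq1 (Real.log q)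
  have d2 := hasDerivAt_thetaSum_exp hp0 hp1 (2 * π * I)
  have hg : Differentiable ℂ (gaussFactor q) := by unfold gaussFactor; fun_prop
  have d3 := (((hg 0).hasDerivAt.const_mul c).mul d2)
  have e : (fun s : ℂ => thetaSum q (exp ((Real.log q : ℂ) * s))) = fun s =>
      c * gaussFactor q s * thetaSum (dualNome q) (exp (2 * π * I * s)) := by
    funext s; rw [← hc, ofReal_cpow_eq_exp hq0]
  rw [e] at d1
  have h0 : thetaSum (dualNome q) 1 = 0 := by
    rw [thetaSum_eq hp0 hp1 one_ne_zero, qTheta, qPochInf_eq hp0 hp1 1]; simp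
  have hu := d1.unique d3
  simp only [mul_zero, exp_zero, h0, gaussFactor] at hu
  have hcm : c = modularConst q := by
    rw [modularConst, eq_div_iff (by
      exact mul_ne_zero (pow_ne_zero _ hpp) (mul_ne_zero (mul_ne_zero two_ne_zero hpi) I_ne_zero))]
    simp at hu
    linear_combination (-1 : ℂ) * hu
  rw [hc, hcm]

theorem modularConst_ne_zero (hq0 : 0 < q) (hq1 : q < 1) : modularConst q ≠ 0 := by
  have hL : (Real.log q : ℂ) ≠ 0 := by exact_mod_cast (Real.log_neg hq0 hq1).ne
  have hpi : (π : ℂ) ≠ 0 := by exact_mod_cast Real.pi_ne_zero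
  exact div_ne_zero (mul_ne_zero (pow_ne_zero _ (qPochInf_self_ne_zero hq0 hq1)) hL)
    (mul_ne_zero (pow_ne_zero _ (qPochInf_self_ne_zero (dualNome_pos q) (dualNome_lt_one hq0 hq1)))
      (mul_ne_zero (mul_ne_zero two_ne_zero hpi) Complex.I_ne_zero))

open Complex in
theorem one_div_sin (x : ℂ) :
    1 / sin x = -2 * I * exp (x * I) / (1 - exp (2 * (x * I))) := by
  have h1 : 1 - exp (2 * (x * I)) = -2 * I * exp (x * I) * sin x := by
    have e1 : exp (2 * (x * I)) = exp (x * I) * exp (x * I) := by rw [← exp_add]; ring_nf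
    have e2 : exp (x * I) * exp (-x * I) = 1 := by rw [← exp_add]; simp
    rw [sin, e1]
    linear_combination (-1 : ℂ) * e2 + (exp (-x * I) * exp (x * I) - exp (x * I) ^ 2) * I_sq
  have h2 : -2 * I * exp (x * I) ≠ 0 := by simp
  rw [h1, div_mul_cancel_left₀ h2, one_div]

/-- Because |sin x|² = sin²(Re x) + sinh²(Im x). -/
theorem norm_sinh_le_norm_sin (x : ℂ) : |Real.sinh x.im| ≤ ‖Complex.sin x‖ := by
  have h : ‖Complex.sin x‖ ^ 2 = Real.sin x.re ^ 2 + Real.sinh x.im ^ 2 := by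
    rw [← Complex.normSq_eq_norm_sq, Complex.sin_eq, Complex.normSq_apply]
    rw [← Complex.ofReal_sin, ← Complex.ofReal_cos, ← Complex.ofReal_sinh, ← Complex.ofReal_cosh]
    simp only [Complex.add_re, Complex.add_im, Complex.mul_re, Complex.mul_im, Complex.ofReal_re,
      Complex.ofReal_im, Complex.I_re, Complex.I_im, mul_zero, zero_mul, sub_zero, zero_add,
      add_zero, mul_one]
    have h1 := Real.sin_sq_add_cos_sq x.re
    have h2 := Real.cosh_sq x.im
    linear_combination (Real.sin x.re ^ 2) * h2 + (Real.sinh x.im ^ 2) * h1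
  rw [← Real.sqrt_sq (norm_nonneg (Complex.sin x)), h]
  exact Real.abs_le_sqrt (by nlinarith [sq_nonneg (Real.sin x.re)])

theorem re_two_pi_I_mul (v : ℂ) : (2 * π * Complex.I * v).re = -(2 * π * v.im) := by
  have : 2 * π * Complex.I * v = ((2 * π : ℝ) : ℂ) * (Complex.I * v) := by push_cast; ring
  rw [this, Complex.re_ofReal_mul, Complex.I_mul_re]; ring

theorem sin_ne_zero_of_im_ne_zero {x : ℂ} (h : x.im ≠ 0) : Complex.sin x ≠ 0 := by
  have := norm_sinh_le_norm_sin x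
  have h1 : 0 < |Real.sinh x.im| := abs_pos.2 (Real.sinh_ne_zero.2 h)
  exact norm_pos_iff.1 (h1.trans_le this)

/-- The imaginary period `2 π i / log q` of `s ↦ q ^ s`. -/
def qPeriod (q : ℝ) : ℂ := 2 * π * Complex.I / (Real.log q : ℂ)

open Complex in
/-- The periodisation of `(-ζ)^s / sin π s`. -/
theorem hasSum_cpow_div_sin (hq0 : 0 < q) (hq1 : q < 1) {ζ : ℂ} (hζ : -ζ ∈ slitPlane)
    (hζq : ∀ m : ℤ, (q : ℂ) ^ m * ζ ≠ 1) {s : ℂ} (hs : ∀ k : ℤ, (s + k * qPeriod q).im ≠ 0) :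
    HasSum (fun k : ℤ => (-ζ) ^ (s + k * qPeriod q) / sin (π * (s + k * qPeriod q)))
      ((Real.log q : ℂ) / π * qPochInf q q ^ 2 * qTheta q (ζ * (q : ℂ) ^ (-s)) /
        (qTheta q ζ * qTheta q ((q : ℂ) ^ (-s)))) := by
  have hLr := Real.log_neg hq0 hq1
  have hL : (Real.log q : ℂ) ≠ 0 := by exact_mod_cast hLr.ne
  have hpi : (π : ℂ) ≠ 0 := by exact_mod_cast Real.pi_ne_zero
  have hpi0 := Real.pi_pos
  have hζ0 : -ζ ≠ 0 := slitPlane_ne_zero hζ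
  have hζ0' : ζ ≠ 0 := neg_ne_zero.1 hζ0
  have hp0 := dualNome_pos q
  have hp1 := dualNome_lt_one hq0 hq1
  have hpp := qPochInf_self_ne_zero hp0 hp1
  set p := dualNome q with hp
  set ω := qPeriod q with hω
  -- A is the logarithm of ζ with imaginary part in (0, 2π), which exists because ζ is off [0,∞).
  -- With w = -A/log q one has q^w = 1/ζ.
  set A : ℂ := log (-ζ) + π * I with hA
  have hexpA : exp A = ζ := by rw [hA, exp_add, exp_log hζ0, exp_pi_mul_I]; ring
  have harg1 : (log (-ζ)).im < π := by
    rw [log_im]; exact lt_of_le_of_ne (arg_le_pi _) (mem_slitPlane_iff_arg.1 hζ).1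
  have harg2 : -π < (log (-ζ)).im := by rw [log_im]; exact neg_pi_lt_arg _
  set w : ℂ := -A / (Real.log q : ℂ) with hw
  have hpz : ∀ m : ℤ, (p : ℂ) ^ m = exp (-(2 * π * I * (m * ω))) := fun m => by
    have : (p : ℂ) = exp (4 * π ^ 2 / (Real.log q : ℂ)) := by rw [hp, dualNome]; push_cast; rfl
    rw [this, ← exp_int_mul]
    congr 1
    rw [hω, qPeriod]
    field_simp
    linear_combination (4 * (m : ℂ)) * I_sq
  have hη : ∀ m : ℤ, (p : ℂ) ^ m * exp (2 * π * I * s) ≠ 1 := fun m h => by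
    rw [hpz, ← exp_add] at h
    have h1 := congrArg norm h
    rw [norm_exp, norm_one, Real.exp_eq_one_iff] at h1
    refine hs (-m) ?_
    have h2 : (-(2 * π * I * (m * ω)) + 2 * π * I * s) = 2 * π * I * (s + (-m : ℤ) * ω) := by
      push_cast; ring
    rw [h2] at h1
    rw [re_two_pi_I_mul] at h1
    have : (2 * π) ≠ 0 := by positivity
    simpa [this] using h1
  have hre : (2 * π * I * w).re = 2 * π * ((log (-ζ)).im + π) / Real.log q := by
    rw [re_two_pi_I_mul, hw, div_ofReal_im, neg_im, hA, add_im, im_ofReal_mul, I_im]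
    ring
  -- The annulus p < |e^{2πiw}| < 1 required by Kronecker's sum at the dual nome p is exactly the
  -- condition |arg(-ζ)| < π.
  have hY : ‖exp (2 * π * I * w)‖ < 1 := by
    rw [norm_exp, hre, Real.exp_lt_one_iff]
    exact div_neg_of_pos_of_neg (by nlinarith) hLr
  have hpY : ‖(p : ℂ) / exp (2 * π * I * w)‖ < 1 := by
    rw [norm_div, norm_exp, hre, norm_real, Real.norm_eq_abs, abs_of_pos hp0, hp, dualNome,
      ← Real.exp_sub, Real.exp_lt_one_iff, ← sub_div]
    exact div_neg_of_pos_of_neg (by nlinarith) hLr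
  have hK := (hasSum_kronecker hp0 hp1 (exp_ne_zero (2 * π * I * s)) hη (exp_ne_zero _) hY hpY).mul_left
    (-2 * I * exp (A * s))
  have hK2 := ((Equiv.neg ℤ).hasSum_iff).2 hK
  have hTp : ∀ v : ℂ, qTheta p (exp (2 * π * I * v)) = thetaSum p (exp (2 * π * I * v)) / qPochInf p p :=
    fun v => by rw [thetaSum_eq hp0 hp1 (exp_ne_zero _), mul_div_cancel_left₀ _ hpp]
  have hqq := qPochInf_self_ne_zero hq0 hq1
  have hqw : (q : ℂ) ^ w = ζ⁻¹ := by
    rw [ofReal_cpow_eq_exp hq0, hw, mul_div_cancel₀ _ hL, exp_neg, hexpA]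
  have hqcp : ∀ v : ℂ, (q : ℂ) ^ v ≠ 0 := fun v => by simp [ofReal_ne_zero' hq0]
  have hM : ∀ v : ℂ, thetaSum p (exp (2 * π * I * v)) =
      qPochInf q q * qTheta q ((q : ℂ) ^ v) / (modularConst q * gaussFactor q v) := fun v => by
    rw [← thetaSum_eq hq0 hq1 (hqcp v), thetaSum_modular hq0 hq1, mul_div_cancel_left₀]
    exact mul_ne_zero (modularConst_ne_zero hq0 hq1) (exp_ne_zero _)
  -- Each theta function at nome p is inverted to nome q. The three Gaussian factors combine to
  -- exp(-As), cancelling the prefactor.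
  have hval : -2 * I * exp (A * s) * (qPochInf p p ^ 2 *
      qTheta p (exp (2 * π * I * s) * exp (2 * π * I * w)) /
      (qTheta p (exp (2 * π * I * s)) * qTheta p (exp (2 * π * I * w)))) =
      (Real.log q : ℂ) / π * qPochInf q q ^ 2 * qTheta q (ζ * (q : ℂ) ^ (-s)) /
        (qTheta q ζ * qTheta q ((q : ℂ) ^ (-s))) := by
    have h1 : exp (2 * π * I * s) * exp (2 * π * I * w) = exp (2 * π * I * (s + w)) := by
      rw [← exp_add]; ring_nf
    have hgg : gaussFactor q s * gaussFactor q w = gaussFactor q (s + w) * exp (-(A * s)) := by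
      rw [gaussFactor, gaussFactor, gaussFactor, ← exp_add, ← exp_add]
      congr 1
      have : A = -((Real.log q : ℂ) * w) := by rw [hw]; field_simp
      rw [this]; ring
    have hqs : (q : ℂ) ^ (s + w) = (ζ * (q : ℂ) ^ (-s))⁻¹ := by
      rw [cpow_add _ _ (ofReal_ne_zero' hq0), hqw, cpow_neg, mul_inv, inv_inv, mul_comm]
    have hqs2 : (q : ℂ) ^ s = ((q : ℂ) ^ (-s))⁻¹ := by rw [cpow_neg, inv_inv]
    have hX := hqcp (-s)
    rw [h1, hTp, hTp, hTp, hM, hM, hM, hqs, hqw, hqs2]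
    set X := (q : ℂ) ^ (-s)
    rw [qTheta_inv hq0 hq1 (mul_ne_zero hζ0' hX), qTheta_inv hq0 hq1 hX, qTheta_inv hq0 hq1 hζ0']
    have hθζ := qTheta_ne_zero hq0 hq1 hζ0' hζq
    have hg1 : gaussFactor q s ≠ 0 := exp_ne_zero _
    have hg2 : gaussFactor q w ≠ 0 := exp_ne_zero _
    have hg3 : gaussFactor q (s + w) ≠ 0 := exp_ne_zero _
    have hc : modularConst q * (qPochInf p p ^ 3 * (2 * π * I)) = qPochInf q q ^ 3 * (Real.log q : ℂ) := by
      rw [modularConst, ← hp, div_mul_cancel₀]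
      exact mul_ne_zero (pow_ne_zero _ hpp) (mul_ne_zero (mul_ne_zero two_ne_zero hpi) I_ne_zero)
    have hc0 := modularConst_ne_zero hq0 hq1
    have hee : exp (A * s) * exp (-(A * s)) = 1 := by rw [← exp_add]; simp
    have hg4 : gaussFactor q s * gaussFactor q w * exp (A * s) = gaussFactor q (s + w) := by
      rw [hgg]; linear_combination gaussFactor q (s + w) * hee
    by_cases hθX : qTheta q X = 0
    · simp [hθX]
    rw [← hg4]
    have hea := exp_ne_zero (A * s)
    field_simp
    linear_combination (qTheta q (ζ * X)) * hc
  rw [hval] at hK2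
  refine hK2.congr_fun fun k => ?_
  have hwω : w * (2 * π * I) = -(A * ω) := by rw [hw, hω, qPeriod]; ring
  simp only [Function.comp, Equiv.neg_apply]
  rw [div_eq_mul_one_div, one_div_sin, cpow_def_of_ne_zero hζ0, hpz, ← exp_int_mul, ← exp_add]
  have e1 : exp (log (-ζ) * (s + k * ω)) * (-2 * I * exp (π * (s + k * ω) * I)) =
      -2 * I * exp (A * s) * exp (((-k : ℤ) : ℂ) * (2 * π * I * w)) := by
    rw [mul_left_comm, ← exp_add, mul_assoc (-2 * I), ← exp_add]
    congr 2
    push_cast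
    rw [hA] at hwω ⊢
    linear_combination (k : ℂ) * hwω
  have e2 : 2 * (π * (s + k * ω) * I) = 2 * π * I * s + -(2 * π * I * (((-k : ℤ) : ℂ) * ω)) := by
    push_cast; ring
  rw [← mul_div_assoc, e1, e2]
  ring

end Modular

/-! ### The removable singularity in the factors depending on a. -/

section PairFactor

variable {q : ℝ}

/-- The entire function `(q^u; q)_∞ (q^{1 - u}; q)_∞ / sin π u`. -/
def thetaSinRatio (q : ℝ) (u : ℂ) : ℂ :=
  modularConst q * gaussFactor q u * qPochInf (dualNome q) (dualNome q) *
    (-2 * Complex.I * Complex.exp (π * u * Complex.I)) *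
    (qPochInf (dualNome q) (Complex.exp (2 * π * Complex.I * u) * dualNome q) *
      qPochInf (dualNome q) (dualNome q * Complex.exp (-(2 * π * Complex.I * u)))) / qPochInf q q

theorem continuous_thetaSinRatio (q : ℝ) (hq0 : 0 < q) (hq1 : q < 1) :
    Continuous (thetaSinRatio q) := by
  have h := continuous_qPochInf (dualNome_pos q) (dualNome_lt_one hq0 hq1)
  unfold thetaSinRatio gaussFactor
  have h1 : Continuous fun u : ℂ =>
      qPochInf (dualNome q) (Complex.exp (2 * π * Complex.I * u) * dualNome q) :=
    h.comp (by fun_prop)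
  have h2 : Continuous fun u : ℂ =>
      qPochInf (dualNome q) (dualNome q * Complex.exp (-(2 * π * Complex.I * u))) :=
    h.comp (by fun_prop)
  exact ((Continuous.mul (by fun_prop) (h1.mul h2))).div_const _

theorem one_sub_exp_eq (u : ℂ) : 1 - Complex.exp (2 * π * Complex.I * u) =
    -2 * Complex.I * Complex.exp (π * u * Complex.I) * Complex.sin (π * u) := by
  have e1 : Complex.exp (2 * π * Complex.I * u) =
      Complex.exp (π * u * Complex.I) * Complex.exp (π * u * Complex.I) := by
    rw [← Complex.exp_add]; ring_nf
  have e2 : Complex.exp (π * u * Complex.I) * Complex.exp (-(π * u) * Complex.I) = 1 := by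
    rw [← Complex.exp_add]; simp
  rw [Complex.sin, e1]
  linear_combination (-1 : ℂ) * e2 + (Complex.exp (-(π * u) * Complex.I) *
    Complex.exp (π * u * Complex.I) - Complex.exp (π * u * Complex.I) ^ 2) * Complex.I_sq

/-- In the product at the dual nome the factor 1 - e^{2πiu} is an explicit multiple of sin πu. It
carries all real zeros; the remaining factors form `thetaSinRatio`. -/
theorem qTheta_cpow_eq_sin_mul (hq0 : 0 < q) (hq1 : q < 1) (u : ℂ) :
    qTheta q ((q : ℂ) ^ u) = Complex.sin (π * u) * thetaSinRatio q u := by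
  have hqq := qPochInf_self_ne_zero hq0 hq1
  have hp0 := dualNome_pos q
  have hp1 := dualNome_lt_one hq0 hq1
  have hx : (q : ℂ) ^ u ≠ 0 := by simp [ofReal_ne_zero' hq0]
  have h1 := thetaSum_modular hq0 hq1 u
  rw [thetaSum_eq hq0 hq1 hx, thetaSum_eq hp0 hp1 (Complex.exp_ne_zero _), qTheta, qTheta,
    qPochInf_eq hp0 hp1 (Complex.exp (2 * π * Complex.I * u)), one_sub_exp_eq] at h1
  have e1 : (dualNome q : ℂ) / Complex.exp (2 * π * Complex.I * u) =
      dualNome q * Complex.exp (-(2 * π * Complex.I * u)) := by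
    rw [div_eq_mul_inv, ← Complex.exp_neg]
  rw [e1] at h1
  rw [thetaSinRatio, mul_div_assoc', eq_div_iff hqq, qTheta]
  linear_combination h1

/-- For real u one has |e^{2πiu}| = 1, so the remaining products have arguments of modulus p < 1. -/
theorem thetaSinRatio_ofReal_ne_zero (hq0 : 0 < q) (hq1 : q < 1) (u : ℝ) :
    thetaSinRatio q u ≠ 0 := by
  have hp0 := dualNome_pos q
  have hp1 := dualNome_lt_one hq0 hq1
  have hn : ∀ v : ℝ, ‖Complex.exp (2 * π * Complex.I * v)‖ = 1 := fun v => by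
    rw [Complex.norm_exp, re_two_pi_I_mul]; simp
  have h1 : qPochInf (dualNome q) (Complex.exp (2 * π * Complex.I * u) * dualNome q) ≠ 0 :=
    qPochInf_ne_zero_of_norm_lt_one hp0 hp1 (by
      rw [norm_mul, hn, one_mul, Complex.norm_real, Real.norm_eq_abs, abs_of_pos hp0]; exact hp1)
  have h2 : qPochInf (dualNome q) (dualNome q * Complex.exp (-(2 * π * Complex.I * u))) ≠ 0 :=
    qPochInf_ne_zero_of_norm_lt_one hp0 hp1 (by
      have := hn (-u)
      push_cast at this
      rw [mul_neg] at this
      rw [norm_mul, this, mul_one, Complex.norm_real, Real.norm_eq_abs, abs_of_pos hp0]; exact hp1)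
  unfold thetaSinRatio
  refine div_ne_zero (mul_ne_zero (mul_ne_zero (mul_ne_zero (mul_ne_zero
    (modularConst_ne_zero hq0 hq1) (Complex.exp_ne_zero _)) (qPochInf_self_ne_zero hp0 hp1)) ?_)
    (mul_ne_zero h1 h2)) (qPochInf_self_ne_zero hq0 hq1)
  simp

theorem pairQuotient_eq (hq0 : 0 < q) (hq1 : q < 1) {b c : ℝ} (h : ∀ m : ℤ, c - b ≠ m) :
    pairQuotient q b c = (q : ℂ) ^ (b : ℂ) / thetaSinRatio q ((b - c : ℝ) : ℂ) := by
  have hpi : (π : ℂ) ≠ 0 := by exact_mod_cast Real.pi_ne_zero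
  have hq := ofReal_ne_zero' hq0
  have hsin : Complex.sin (π * ((b : ℂ) - c)) ≠ 0 := by
    rw [Ne, Complex.sin_eq_zero_iff]
    rintro ⟨k, hk⟩
    have h1 : ((b - c : ℝ) : ℂ) = ((k : ℝ) : ℂ) := by
      push_cast
      exact mul_left_cancel₀ hpi (by linear_combination hk)
    have h2 := Complex.ofReal_injective h1
    exact h (-k) (by push_cast; linarith)
  have hσ := thetaSinRatio_ofReal_ne_zero hq0 hq1 (b - c)
  have hT := qTheta_cpow_eq_sin_mul hq0 hq1 ((b - c : ℝ) : ℂ)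
  have hinv : (q : ℂ) ^ ((c : ℂ) - b) = ((q : ℂ) ^ ((b : ℂ) - c))⁻¹ := by
    rw [← Complex.cpow_neg, neg_sub]
  have hmul : (q : ℂ) ^ (c : ℂ) = (q : ℂ) ^ (b : ℂ) * (q : ℂ) ^ ((c : ℂ) - b) := by
    rw [← Complex.cpow_add _ _ hq, add_sub_cancel]
  push_cast at hT hσ ⊢
  rw [qTheta, div_eq_mul_inv, ← hinv, mul_comm (q : ℂ)] at hT
  have hP : qPochInf q ((q : ℂ) ^ ((b : ℂ) - c)) * qPochInf q ((q : ℂ) ^ ((c : ℂ) - b) * q) ≠ 0 := by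
    rw [hT]; exact mul_ne_zero hsin hσ
  have h3 := left_ne_zero_of_mul hP
  have h4 := right_ne_zero_of_mul hP
  have hX : 1 - (q : ℂ) ^ ((c : ℂ) - b) ≠ 0 := fun h0 => by
    have h1 : qPochInf q ((q : ℂ) ^ ((b : ℂ) - c)) = 0 := by
      have : (q : ℂ) ^ ((b : ℂ) - c) = 1 := by
        rw [← inv_inv ((q : ℂ) ^ ((b : ℂ) - c)), ← hinv]
        rw [sub_eq_zero] at h0; rw [← h0, inv_one]
      rw [this, qPochInf_eq hq0 hq1]; simp
    exact h3 h1
  rw [pairQuotient, qPochInf_eq hq0 hq1 ((q : ℂ) ^ ((c : ℂ) - b)), hmul,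
    show (π : ℂ) * ((c : ℂ) - b) = -(π * (b - c)) by ring, Complex.sin_neg,
    div_eq_div_iff (mul_ne_zero h3 (mul_ne_zero hX h4)) hσ]
  linear_combination (-(q : ℂ) ^ (b : ℂ) * (1 - (q : ℂ) ^ ((c : ℂ) - b))) * hT

/-- A closed form valid also for c - b ∈ ℤ: the sine cancels, and what remains is continuous with
nonvanishing denominator, so its value is the limit. -/
theorem pairFactor_eq (hq0 : 0 < q) (hq1 : q < 1) (b c : ℝ) :
    pairFactor q b c = (q : ℂ) ^ (b : ℂ) / thetaSinRatio q ((b - c : ℝ) : ℂ) := by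
  rw [pairFactor]
  split_ifs with h
  · obtain ⟨m, hm⟩ := h
    refine Tendsto.limUnder_eq ?_
    have h1 : Tendsto (fun c' : ℝ => (q : ℂ) ^ (b : ℂ) / thetaSinRatio q ((b - c' : ℝ) : ℂ)) (𝓝[≠] c)
        (𝓝 ((q : ℂ) ^ (b : ℂ) / thetaSinRatio q ((b - c : ℝ) : ℂ))) := by
      refine tendsto_const_nhds.div ?_ (thetaSinRatio_ofReal_ne_zero hq0 hq1 _)
      refine Tendsto.mono_left ?_ nhdsWithin_le_nhds
      exact ((continuous_thetaSinRatio q hq0 hq1).comp (by fun_prop :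
        Continuous fun c' : ℝ => ((b - c' : ℝ) : ℂ))).tendsto c
    refine h1.congr' ?_
    -- Within distance 1 of c the only c' with c' - b an integer is c itself, so the generic formula
    -- applies on the punctured ball.
    have h2 : ∀ᶠ c' in 𝓝[≠] c, c' ∈ Metric.ball c 1 :=
      nhdsWithin_le_nhds (Metric.ball_mem_nhds c one_pos)
    filter_upwards [h2, self_mem_nhdsWithin] with c' hc' hne
    refine (pairQuotient_eq hq0 hq1 fun k hk => hne ?_).symm
    rw [Metric.mem_ball, Real.dist_eq] at hc'
    have h3 : c' - c = ((k - m : ℤ) : ℝ) := by push_cast; linarith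
    rw [h3, ← Int.cast_abs] at hc'
    have h4 : |k - m| < 1 := by exact_mod_cast hc'
    have h5 : k = m := by rw [Int.abs_lt_one_iff] at h4; omega
    simp only [Set.mem_singleton_iff]
    rw [h5] at hk; linarith
  · exact pairQuotient_eq hq0 hq1 fun m hm => h ⟨m, hm⟩

end PairFactor

/-! ### Multiple sums of products and of determinants. -/

section PiSums

variable {ι 𝕜 : Type*} [NormedField 𝕜] [CompleteSpace 𝕜]

theorem hasSum_pi_prod {n : ℕ} (f : Fin n → ι → 𝕜) (S : Fin n → 𝕜) (hf : ∀ i, HasSum (f i) (S i))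
    (hs : ∀ i, Summable fun k => ‖f i k‖) :
    HasSum (fun k : Fin n → ι => ∏ i, f i (k i)) (∏ i, S i) ∧
      Summable fun k : Fin n → ι => ‖∏ i, f i (k i)‖ := by
  induction n with
  | zero =>
    constructor
    · simp
    · exact (hasSum_fintype _).summable
  | succ n ih =>
    obtain ⟨h1, h2⟩ := ih (fun i => f i.succ) (fun i => S i.succ) (fun i => hf _) fun i => hs _
    have h3 := summable_mul_of_summable_norm (hs 0) h2
    have h4 := (hf 0).mul h1 h3
    have h5 := (hs 0).mul_norm h2
    let E : (Fin (n + 1) → ι) ≃ ι × (Fin n → ι) := (Fin.consEquiv fun _ => ι).symm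
    have e : ∀ k : Fin (n + 1) → ι, ∏ i, f i (k i) =
        f 0 (E k).1 * ∏ i : Fin n, f i.succ ((E k).2 i) := fun k => by
      rw [Fin.prod_univ_succ]; rfl
    rw [Fin.prod_univ_succ]
    constructor
    · have h6 := (Equiv.hasSum_iff E).2 h4
      exact h6.congr_fun e
    · have h6 := (Equiv.summable_iff E).2 h5
      exact h6.congr fun k => by rw [e k]; rfl

/-- The index k i occurs only in row i, so each term of the permutation expansion is a product of
independent sums. -/
theorem hasSum_det {n : ℕ} (f : Fin n → Fin n → ι → 𝕜) (S : Fin n → Fin n → 𝕜)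
    (hf : ∀ i j, HasSum (f i j) (S i j)) (hs : ∀ i j, Summable fun k => ‖f i j k‖) :
    HasSum (fun k : Fin n → ι => (Matrix.of fun i j => f i j (k i)).det) (Matrix.of S).det := by
  rw [← Matrix.det_transpose, Matrix.det_apply']
  simp only [fun k : Fin n → ι => (Matrix.det_transpose (Matrix.of fun i j => f i j (k i))).symm,
    Matrix.det_apply']
  refine hasSum_sum fun σ _ => HasSum.mul_left _ ?_
  exact (hasSum_pi_prod (fun i => f i (σ i)) (fun i => S i (σ i)) (fun i => hf _ _)
    fun i => hs _ _).1

end PiSums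

/-- Each of the n + 1 indices belongs to n pairs. -/
theorem prod_Ioi_mul {M : Type*} [CommMonoid M] {n : ℕ} (f : Fin (n + 1) → M) :
    ∏ i, ∏ j ∈ Finset.Ioi i, f i * f j = (∏ i, f i) ^ n := by
  induction n with
  | zero => simp [Subsingleton.elim (_ : Fin 1) 0]
  | succ n ih =>
    rw [prod_Ioi_fin_succ (fun i j => f i * f j), ih fun i => f i.succ, Fin.prod_univ_succ f,
      Finset.prod_mul_distrib]
    simp only [Finset.prod_const, Finset.card_univ, Fintype.card_fin, mul_pow, pow_succ]
    ac_rfl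

/-! ### Summation of the trigonometric part over the period lattice. -/

section TrigSum

variable {q : ℝ} {n : ℕ} {ζ : ℂ}

/-- The part of the integrand not periodic under `qPeriod`. The factors sin π(a_i - a_j) of the
Cauchy determinant are left out, so that nothing degenerates when a_i - a_j is an integer. -/
def trigTerm (ζ : ℂ) (a : Fin (n + 1) → ℝ) (s : Fin (n + 1) → ℂ) : ℂ :=
  (∏ j, (-ζ) ^ s j) * (∏ i, ∏ j ∈ Finset.Ioi i, Complex.sin (π * (s j - s i))) /
    ∏ i, ∏ j, Complex.sin (π * (s i - a j))

/-- The value of the lattice sum. `thetaSinRatio` stands where Frobenius' formula has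
θ(q^{a_i-a_j}), the sine having been divided out. -/
def trigSum (q : ℝ) (ζ : ℂ) (a : Fin (n + 1) → ℝ) (s : Fin (n + 1) → ℂ) : ℂ :=
  (∏ j, (-ζ) ^ (a j : ℂ)) * (((Real.log q : ℂ) / π * qPochInf q q ^ 2) ^ (n + 1) / qTheta q ζ *
    qTheta q (ζ * ∏ j, (q : ℂ) ^ (a j - s j)) *
    (∏ i, ∏ j ∈ Finset.Ioi i, (q : ℂ) ^ (a j - s j) * (qTheta q ((q : ℂ) ^ (s j - s i)) *
      thetaSinRatio q ((a i - a j : ℝ) : ℂ))) / ∏ i, ∏ j, qTheta q ((q : ℂ) ^ (a j - s i)))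

theorem qTheta_cpow_ne_zero (hq0 : 0 < q) (hq1 : q < 1) {s : ℂ}
    (hs : ∀ k : ℤ, (s + k * qPeriod q).im ≠ 0) (b : ℝ) : qTheta q ((q : ℂ) ^ (b - s)) ≠ 0 := by
  have hq := ofReal_ne_zero' hq0
  have hL : (Real.log q : ℂ) ≠ 0 := by exact_mod_cast (Real.log_neg hq0 hq1).ne
  refine qTheta_ne_zero hq0 hq1 (by simp [hq]) fun m hm => ?_
  rw [← Complex.cpow_intCast, ← Complex.cpow_add _ _ hq, ofReal_cpow_eq_exp hq0,
    Complex.exp_eq_one_iff] at hm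
  obtain ⟨k, hk⟩ := hm
  refine hs k ?_
  have : s + k * qPeriod q = ((m + b : ℝ) : ℂ) := by
    rw [qPeriod]
    push_cast
    field_simp
    linear_combination -hk
  rw [this, Complex.ofReal_im]

theorem det_cpow_div_sin (hζ : ζ ≠ 0) (a : Fin (n + 1) → ℝ) (s : Fin (n + 1) → ℂ)
    (hs : ∀ i, (s i).im ≠ 0) :
    (Matrix.of fun i j => (-ζ) ^ (s i - a j) / Complex.sin (π * (s i - a j))).det =
      trigTerm ζ a s * ((∏ j, (-ζ) ^ (-(a j : ℂ))) *
        ∏ i, ∏ j ∈ Finset.Ioi i, Complex.sin (π * (a i - a j))) := by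
  have hζ' : -ζ ≠ 0 := neg_ne_zero.2 hζ
  have e : (Matrix.of fun i j => (-ζ) ^ (s i - a j) / Complex.sin (π * (s i - a j))) =
      Matrix.of fun i j => (-ζ) ^ s i * ((-ζ) ^ (-(a j : ℂ)) *
        (Matrix.of fun i j => 1 / Complex.sin (π * (s i - a j))) i j) := by
    ext i j
    simp only [Matrix.of_apply]
    rw [sub_eq_add_neg (s i), Complex.cpow_add _ _ hζ']
    ring
  rw [e, det_mul_row_col, det_inv_sin s (fun j => (a j : ℂ)), trigTerm]
  · simp only [Finset.prod_mul_distrib]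
    ring
  · intro i j
    refine sin_ne_zero_of_im_ne_zero ?_
    simpa [Real.pi_ne_zero] using hs i

/-- Write the term as a determinant, sum each entry by `hasSum_cpow_div_sin` and evaluate by
`det_qTheta`. Genericity of a is needed only to divide by ∏ sin π(a_i - a_j). -/
theorem hasSum_trigTerm_of_generic (hq0 : 0 < q) (hq1 : q < 1) (hζ : -ζ ∈ Complex.slitPlane)
    (hζq : ∀ m : ℤ, (q : ℂ) ^ m * ζ ≠ 1) {s : Fin (n + 1) → ℂ}
    (hs : ∀ i, ∀ k : ℤ, (s i + k * qPeriod q).im ≠ 0) (a : Fin (n + 1) → ℝ)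
    (ha : ∀ i, ∀ j ∈ Finset.Ioi i, Complex.sin (π * (a i - a j)) ≠ 0) :
    HasSum (fun k : Fin (n + 1) → ℤ => trigTerm ζ a fun i => s i + k i * qPeriod q)
      (trigSum q ζ a s) := by
  have hq := ofReal_ne_zero' hq0
  have hζ0 : ζ ≠ 0 := fun h => Complex.slitPlane_ne_zero hζ (by simp [h])
  have hζ' : -ζ ≠ 0 := neg_ne_zero.2 hζ0
  have hT := qTheta_ne_zero hq0 hq1 hζ0 hζq
  have hsh : ∀ i j, ∀ k : ℤ, (s i - a j + k * qPeriod q).im ≠ 0 := fun i j k => by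
    have := hs i k
    rw [sub_add_eq_add_sub, Complex.sub_im, Complex.ofReal_im, sub_zero]
    exact this
  have h1 := fun i j => hasSum_cpow_div_sin hq0 hq1 hζ hζq (hsh i j)
  have h2 := hasSum_det _ _ h1 fun i j => (h1 i j).summable.norm
  have e1 : ∀ k : Fin (n + 1) → ℤ, (Matrix.of fun i j => (-ζ) ^ (s i - a j + k i * qPeriod q) /
      Complex.sin (π * (s i - a j + k i * qPeriod q))).det =
      (trigTerm ζ a fun i => s i + k i * qPeriod q) * ((∏ j, (-ζ) ^ (-(a j : ℂ))) *
        ∏ i, ∏ j ∈ Finset.Ioi i, Complex.sin (π * (a i - a j))) := fun k => by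
    rw [← det_cpow_div_sin hζ0 _ _ fun i => hs i (k i)]
    simp only [sub_add_eq_add_sub]
  simp only [e1] at h2
  have hA : (∏ j, (-ζ) ^ (-(a j : ℂ))) ≠ 0 :=
    Finset.prod_ne_zero_iff.2 fun j _ => by simp [hζ0]
  have hS : (∏ i, ∏ j ∈ Finset.Ioi i, Complex.sin (π * (a i - a j))) ≠ 0 :=
    Finset.prod_ne_zero_iff.2 fun i _ => Finset.prod_ne_zero_iff.2 fun j hj => ha i j hj
  have h3 := h2.div_const ((∏ j, (-ζ) ^ (-(a j : ℂ))) *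
        ∏ i, ∏ j ∈ Finset.Ioi i, Complex.sin (π * (a i - a j)))
  simp only [mul_div_cancel_right₀ _ (mul_ne_zero hA hS)] at h3
  convert h3 using 1
  · rfl
  rw [eq_div_iff (mul_ne_zero hA hS)]
  have e2 : (Matrix.of fun i j => (Real.log q : ℂ) / π * qPochInf q q ^ 2 *
      qTheta q (ζ * (q : ℂ) ^ (-(s i - a j))) /
        (qTheta q ζ * qTheta q ((q : ℂ) ^ (-(s i - a j))))) =
      Matrix.of fun i j => ((Real.log q : ℂ) / π * qPochInf q q ^ 2 / qTheta q ζ) * (1 *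
        (Matrix.of fun i j => qTheta q (ζ * ((q : ℂ) ^ (a j : ℂ) / (q : ℂ) ^ s i)) /
          qTheta q ((q : ℂ) ^ (a j : ℂ) / (q : ℂ) ^ s i)) i j) := by
    ext i j
    simp only [Matrix.of_apply, neg_sub, Complex.cpow_sub _ _ hq, one_mul]
    rw [div_mul_div_comm]
  have hp : ∀ s : ℂ, (q : ℂ) ^ s ≠ 0 := fun s => by simp [hq]
  rw [e2, det_mul_row_col, det_qTheta hq0 hq1 (fun j => (q : ℂ) ^ (a j : ℂ)) (fun i => (q : ℂ) ^ s i)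
    (fun i => hp _) (fun i => hp _) _ hζ0, trigSum]
  · simp only [← Complex.cpow_sub _ _ hq, Finset.prod_const, Finset.card_univ, Fintype.card_fin,
      one_pow, one_mul]
    have e3 : ∀ i j : Fin (n + 1), qTheta q ((q : ℂ) ^ ((a i : ℂ) - a j)) =
        Complex.sin (π * (a i - a j)) * thetaSinRatio q ((a i - a j : ℝ) : ℂ) := fun i j => by
      rw [qTheta_cpow_eq_sin_mul hq0 hq1]; push_cast; rfl
    have e4 : (∏ j, (-ζ) ^ (a j : ℂ)) * (∏ j, (-ζ) ^ (-(a j : ℂ))) = 1 := by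
      rw [← Finset.prod_mul_distrib]
      refine Finset.prod_eq_one fun j _ => ?_
      rw [← Complex.cpow_add _ _ hζ', add_neg_cancel, Complex.cpow_zero]
    simp only [e3, Finset.prod_mul_distrib] at e4 ⊢
    have e5 : (1 : ℂ) / qTheta q ζ = qTheta q ζ ^ n / qTheta q ζ ^ (n + 1) := by
      rw [pow_succ]; field_simp
    rw [div_pow]
    generalize (∏ j, (-ζ) ^ (a j : ℂ)) = A at *
    generalize (∏ j, (-ζ) ^ (-(a j : ℂ))) = A' at *
    linear_combination ((Real.log q : ℂ) / π * qPochInf q q ^ 2) ^ (n + 1) / qTheta q ζ *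
      qTheta q (ζ * ∏ j, (q : ℂ) ^ (a j - s j)) *
      ((∏ i, ∏ j ∈ Finset.Ioi i, (q : ℂ) ^ (a j - s j)) *
      ((∏ i, ∏ j ∈ Finset.Ioi i, qTheta q ((q : ℂ) ^ (s j - s i))) *
      ∏ i, ∏ j ∈ Finset.Ioi i, thetaSinRatio q ((a i - a j : ℝ) : ℂ))) /
      (∏ i, ∏ j, qTheta q ((q : ℂ) ^ (a j - s i))) *
      (∏ i, ∏ j ∈ Finset.Ioi i, Complex.sin (π * (a i - a j))) * e4 +
      ((Real.log q : ℂ) / π * qPochInf q q ^ 2) ^ (n + 1) *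
      qTheta q (ζ * ∏ j, (q : ℂ) ^ (a j - s j)) *
      ((∏ i, ∏ j ∈ Finset.Ioi i, (q : ℂ) ^ (a j - s j)) *
      ((∏ i, ∏ j ∈ Finset.Ioi i, qTheta q ((q : ℂ) ^ (s j - s i))) *
      ∏ i, ∏ j ∈ Finset.Ioi i, thetaSinRatio q ((a i - a j : ℝ) : ℂ))) /
      (∏ i, ∏ j, qTheta q ((q : ℂ) ^ (a j - s i))) *
      (∏ i, ∏ j ∈ Finset.Ioi i, Complex.sin (π * (a i - a j))) * e5
  · intro i j
    rw [← Complex.cpow_sub _ _ hq]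
    exact qTheta_cpow_ne_zero hq0 hq1 (hs i) _

theorem norm_sin_le_exp (x : ℂ) : ‖Complex.sin x‖ ≤ Real.exp |x.im| := by
  rw [Complex.sin, norm_div, norm_mul, Complex.norm_I, mul_one, Complex.norm_ofNat,
    div_le_iff₀ two_pos]
  refine (norm_sub_le _ _).trans ?_
  rw [Complex.norm_exp, Complex.norm_exp]
  have h1 : (-x * Complex.I).re = x.im := by simp
  have h2 : (x * Complex.I).re = -x.im := by simp
  rw [h1, h2]
  have := Real.exp_le_exp.2 (le_abs_self x.im)
  have := Real.exp_le_exp.2 (neg_le_abs x.im)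
  linarith

/-- The numbers Im(s + kω) form an arithmetic progression avoiding 0, hence stay at distance at
least δ > 0 from it, attained at the k nearest to the real zero of the progression. -/
theorem exists_exp_le_mul_sinh (hq0 : 0 < q) (hq1 : q < 1) {s : ℂ}
    (hs : ∀ k : ℤ, (s + k * qPeriod q).im ≠ 0) :
    ∃ K : ℝ, 0 < K ∧ ∀ k : ℤ, Real.exp (π * |(s + k * qPeriod q).im|) ≤
      K * |Real.sinh (π * (s + k * qPeriod q).im)| := by
  have hL := Real.log_neg hq0 hq1
  have him : ∀ k : ℤ, (s + k * qPeriod q).im = (2 * π / Real.log q) *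
      (k - -(s.im * Real.log q / (2 * π))) := fun k => by
    have : k * qPeriod q = ((k * (2 * π / Real.log q) : ℝ) : ℂ) * Complex.I := by
      rw [qPeriod]; push_cast; ring
    have hpi := Real.pi_ne_zero
    have hL0 := hL.ne
    rw [this, Complex.add_im, Complex.im_ofReal_mul, Complex.I_im]
    field_simp
    ring
  set x : ℝ := -(s.im * Real.log q / (2 * π)) with hx
  set δ : ℝ := |(s + (round x : ℤ) * qPeriod q).im| with hδ
  have hδ0 : 0 < δ := abs_pos.2 (hs _)
  have hδk : ∀ k : ℤ, δ ≤ |(s + k * qPeriod q).im| := fun k => by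
    rw [hδ, him, him, abs_mul, abs_mul, abs_sub_comm _ x, abs_sub_comm _ x]
    exact mul_le_mul_of_nonneg_left (round_le x k) (abs_nonneg _)
  have h1 : Real.exp (-(2 * (π * δ))) < 1 := by
    rw [Real.exp_lt_one_iff]
    have := mul_pos Real.pi_pos hδ0
    linarith
  refine ⟨2 / (1 - Real.exp (-(2 * (π * δ)))), div_pos two_pos (by linarith), fun k => ?_⟩
  set y := |(s + k * qPeriod q).im| with hy
  have e : |Real.sinh (π * (s + k * qPeriod q).im)| =
      Real.exp (π * y) * (1 - Real.exp (-(2 * (π * y)))) / 2 := by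
    rw [Real.abs_sinh, abs_mul, abs_of_pos Real.pi_pos, Real.sinh_eq, mul_sub, mul_one,
      ← Real.exp_add, ← hy]
    ring_nf
  have h2 : Real.exp (-(2 * (π * y))) ≤ Real.exp (-(2 * (π * δ))) := by
    rw [Real.exp_le_exp]
    have := mul_le_mul_of_nonneg_left (hδk k) Real.pi_pos.le
    linarith
  rw [e, div_mul_div_comm, le_div_iff₀ (by linarith)]
  have h3 := Real.exp_pos (π * y)
  nlinarith [mul_le_mul_of_nonneg_left h2 h3.le]

/-- Every s_i occurs in n sines of the numerator and n + 1 of the denominator, leaving one sine per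
variable. The bound does not involve a and factorises over i, so it dominates the sum for all a at
once. -/
theorem norm_trigTerm_le (a : Fin (n + 1) → ℝ) (s : Fin (n + 1) → ℂ) {K : Fin (n + 1) → ℝ}
    (hs : ∀ i, (s i).im ≠ 0)
    (hK : ∀ i, Real.exp (π * |(s i).im|) ≤ K i * |Real.sinh (π * (s i).im)|) :
    ‖trigTerm ζ a s‖ ≤ ∏ i, K i ^ (n + 1) * ‖(-ζ) ^ s i / Complex.sin (π * s i)‖ := by
  have him : ∀ x : ℂ, ((π : ℂ) * x).im = π * x.im := fun x => Complex.im_ofReal_mul _ _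
  have hsinh : ∀ i, 0 < |Real.sinh (π * (s i).im)| := fun i =>
    abs_pos.2 (Real.sinh_ne_zero.2 (mul_ne_zero Real.pi_ne_zero (hs i)))
  have hKp : ∀ i, 0 ≤ K i := fun i =>
    nonneg_of_mul_nonneg_left ((Real.exp_pos _).le.trans (hK i)) (hsinh i)
  have h1 : ‖∏ i, ∏ j ∈ Finset.Ioi i, Complex.sin (π * (s j - s i))‖ ≤
      ∏ i, Real.exp (π * |(s i).im|) ^ n := by
    rw [norm_prod, Finset.prod_pow, ← prod_Ioi_mul]
    refine Finset.prod_le_prod (fun _ _ => norm_nonneg _) fun i _ => ?_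
    rw [norm_prod]
    refine Finset.prod_le_prod (fun _ _ => norm_nonneg _) fun j _ => ?_
    refine (norm_sin_le_exp _).trans ?_
    rw [← Real.exp_add, Real.exp_le_exp, him, abs_mul, abs_of_pos Real.pi_pos, Complex.sub_im,
      ← mul_add]
    refine mul_le_mul_of_nonneg_left ?_ Real.pi_pos.le
    linarith [abs_sub (s j).im (s i).im]
  have h2 : (∏ i, |Real.sinh (π * (s i).im)| ^ (n + 1)) ≤
      ‖∏ i, ∏ j, Complex.sin (π * (s i - a j))‖ := by
    rw [norm_prod]
    refine Finset.prod_le_prod (fun _ _ => by positivity) fun i _ => ?_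
    rw [norm_prod, ← Fin.prod_const]
    refine Finset.prod_le_prod (fun _ _ => abs_nonneg _) fun j _ => ?_
    refine le_trans (le_of_eq ?_) (norm_sinh_le_norm_sin _)
    rw [him, Complex.sub_im, Complex.ofReal_im, sub_zero]
  have h3 : 0 < ∏ i, |Real.sinh (π * (s i).im)| ^ (n + 1) :=
    Finset.prod_pos fun i _ => pow_pos (hsinh i) _
  rw [trigTerm, norm_div, norm_mul, norm_prod]
  calc _ ≤ (∏ j, ‖(-ζ) ^ s j‖) * (∏ i, Real.exp (π * |(s i).im|) ^ n) /
        ∏ i, |Real.sinh (π * (s i).im)| ^ (n + 1) := by gcongr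
    _ = ∏ i, ‖(-ζ) ^ s i‖ * Real.exp (π * |(s i).im|) ^ n /
        |Real.sinh (π * (s i).im)| ^ (n + 1) := by
      rw [Finset.prod_div_distrib, Finset.prod_mul_distrib]
    _ ≤ _ := by
      refine Finset.prod_le_prod (fun _ _ => by positivity) fun i _ => ?_
      have h4 : 0 < ‖Complex.sin (π * s i)‖ := norm_pos_iff.2 (sin_ne_zero_of_im_ne_zero (by
        rw [him]; exact mul_ne_zero Real.pi_ne_zero (hs i)))
      have h5 : ‖Complex.sin (π * s i)‖ ≤ Real.exp (π * |(s i).im|) := by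
        refine (norm_sin_le_exp _).trans_eq ?_
        rw [him, abs_mul, abs_of_pos Real.pi_pos]
      rw [norm_div, div_le_iff₀ (pow_pos (hsinh i) _), mul_div_assoc', div_mul_eq_mul_div,
        le_div_iff₀ h4]
      calc ‖(-ζ) ^ s i‖ * Real.exp (π * |(s i).im|) ^ n * ‖Complex.sin (π * s i)‖
          ≤ ‖(-ζ) ^ s i‖ * Real.exp (π * |(s i).im|) ^ n * Real.exp (π * |(s i).im|) := by gcongr
        _ = ‖(-ζ) ^ s i‖ * Real.exp (π * |(s i).im|) ^ (n + 1) := by ring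
        _ ≤ ‖(-ζ) ^ s i‖ * (K i * |Real.sinh (π * (s i).im)|) ^ (n + 1) := by gcongr; exact hK i
        _ = _ := by ring

theorem continuous_trigTerm (s : Fin (n + 1) → ℂ) (hs : ∀ i, (s i).im ≠ 0) :
    Continuous fun a : Fin (n + 1) → ℝ => trigTerm ζ a s := by
  unfold trigTerm
  refine continuous_const.div (by fun_prop) fun a => ?_
  refine Finset.prod_ne_zero_iff.2 fun i _ => Finset.prod_ne_zero_iff.2 fun j _ => ?_
  refine sin_ne_zero_of_im_ne_zero ?_
  simpa [Real.pi_ne_zero] using hs i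

theorem continuous_trigSum (hq0 : 0 < q) (hq1 : q < 1) (hζ : ζ ≠ 0) {s : Fin (n + 1) → ℂ}
    (hs : ∀ i, ∀ k : ℤ, (s i + k * qPeriod q).im ≠ 0) :
    Continuous fun a : Fin (n + 1) → ℝ => trigSum q ζ a s := by
  have hq := ofReal_ne_zero' hq0
  have hp : ∀ s : ℂ, (q : ℂ) ^ s ≠ 0 := fun s => by simp [hq]
  have hc : ∀ s : ℂ, ∀ j, Continuous fun a : Fin (n + 1) → ℝ => (q : ℂ) ^ (a j - s) := fun s j => by
    simp only [ofReal_cpow_eq_exp hq0]; fun_prop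
  have hth : ∀ f : (Fin (n + 1) → ℝ) → ℂ, Continuous f → (∀ a, f a ≠ 0) →
      Continuous fun a => qTheta q (f a) := fun f hf h0 =>
    (continuousOn_qTheta hq0 hq1).comp_continuous hf h0
  have h1 : Continuous fun a : Fin (n + 1) → ℝ => ∏ j, (-ζ) ^ (a j : ℂ) := by
    refine continuous_finsetProd _ fun j _ => ?_
    simp only [Complex.cpow_def_of_ne_zero (neg_ne_zero.2 hζ)]
    fun_prop
  unfold trigSum
  refine h1.mul (Continuous.div ?_ ?_ ?_)
  · refine (continuous_const.mul (hth _ ?_ ?_)).mul ?_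
    · exact continuous_const.mul (continuous_finsetProd _ fun j _ => hc _ _)
    · exact fun a => mul_ne_zero hζ (Finset.prod_ne_zero_iff.2 fun j _ => hp _)
    · refine continuous_finsetProd _ fun i _ => continuous_finsetProd _ fun j _ => ?_
      refine (hc _ _).mul (continuous_const.mul ((continuous_thetaSinRatio q hq0 hq1).comp ?_))
      fun_prop
  · exact continuous_finsetProd _ fun i _ => continuous_finsetProd _ fun j _ =>
      hth _ (hc _ _) fun a => hp _
  · exact fun a => Finset.prod_ne_zero_iff.2 fun i _ => Finset.prod_ne_zero_iff.2 fun j _ =>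
      qTheta_cpow_ne_zero hq0 hq1 (hs i) _

theorem countable_setOf_sin_eq_zero (b : ℝ) {c : ℝ} (hc : c ≠ 0) :
    {τ : ℝ | Complex.sin (π * ((b + τ * c : ℝ) : ℂ)) = 0}.Countable := by
  refine (Set.countable_range fun m : ℤ => (m - b) / c).mono fun τ hτ => ?_
  rw [Set.mem_ofPred_eq, Complex.sin_eq_zero_iff] at hτ
  obtain ⟨k, hk⟩ := hτ
  refine ⟨k, ?_⟩
  have hpi : (π : ℂ) ≠ 0 := by exact_mod_cast Real.pi_ne_zero
  have h1 : ((b + τ * c : ℝ) : ℂ) = ((k : ℝ) : ℂ) :=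
    mul_left_cancel₀ hpi (by rw [hk]; push_cast; ring)
  have h2 := Complex.ofReal_injective h1
  rw [div_eq_iff hc]
  linarith

/-- Extension of the generic case by continuity: both sides are continuous in a, the left one
because its majorant is independent of a. -/
theorem hasSum_trigTerm (hq0 : 0 < q) (hq1 : q < 1) (hζ : -ζ ∈ Complex.slitPlane)
    (hζq : ∀ m : ℤ, (q : ℂ) ^ m * ζ ≠ 1) {s : Fin (n + 1) → ℂ}
    (hs : ∀ i, ∀ k : ℤ, (s i + k * qPeriod q).im ≠ 0) (a : Fin (n + 1) → ℝ) :
    HasSum (fun k : Fin (n + 1) → ℤ => trigTerm ζ a fun i => s i + k i * qPeriod q)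
      (trigSum q ζ a s) := by
  have hζ0 : ζ ≠ 0 := fun h => Complex.slitPlane_ne_zero hζ (by simp [h])
  choose K hK0 hK using fun i => exists_exp_le_mul_sinh hq0 hq1 (hs i)
  set B : (Fin (n + 1) → ℤ) → ℝ := fun k => ∏ i, K i ^ (n + 1) *
    ‖(-ζ) ^ (s i + k i * qPeriod q) / Complex.sin (π * (s i + k i * qPeriod q))‖ with hB
  have hBs : Summable B := by
    have h1 : ∀ i, Summable fun k : ℤ => K i ^ (n + 1) *
        ‖(-ζ) ^ (s i + k * qPeriod q) / Complex.sin (π * (s i + k * qPeriod q))‖ := fun i =>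
      (hasSum_cpow_div_sin hq0 hq1 hζ hζq (hs i)).summable.norm.mul_left _
    exact (hasSum_pi_prod _ _ (fun i => (h1 i).hasSum) fun i => (h1 i).norm).1.summable
  have hle : ∀ a : Fin (n + 1) → ℝ, ∀ k, ‖trigTerm ζ a fun i => s i + k i * qPeriod q‖ ≤ B k :=
    fun a k => norm_trigTerm_le a _ (fun i => hs i (k i)) fun i => hK i (k i)
  have hsum : ∀ a : Fin (n + 1) → ℝ,
      Summable fun k : Fin (n + 1) → ℤ => trigTerm ζ a fun i => s i + k i * qPeriod q := fun a =>
    hBs.of_norm_bounded (hle a)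
  have hcont : Continuous fun a : Fin (n + 1) → ℝ =>
      ∑' k : Fin (n + 1) → ℤ, trigTerm ζ a fun i => s i + k i * qPeriod q :=
    continuous_tsum (fun k => continuous_trigTerm _ fun i => hs i (k i)) hBs fun k a => hle a k
  -- Along this line the differences are a_i - a_j + τ(i - j), which hit an integer for only
  -- countably many τ.
  set b : ℝ → Fin (n + 1) → ℝ := fun τ i => a i + τ * (i : ℕ) with hb
  have hbc : Continuous b := by fun_prop
  set S : Set ℝ := ⋃ i : Fin (n + 1), ⋃ j : Fin (n + 1), ⋃ _ : i < j,
    {τ : ℝ | Complex.sin (π * (((a i - a j) + τ * ((i : ℕ) - (j : ℕ) : ℝ) : ℝ) : ℂ)) = 0} with hS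
  have hSc : S.Countable := by
    refine Set.countable_iUnion fun i => Set.countable_iUnion fun j => Set.countable_iUnion fun h =>
      countable_setOf_sin_eq_zero _ ?_
    rw [sub_ne_zero]
    exact_mod_cast (Fin.lt_def.1 h).ne
  have hd : Dense Sᶜ := hSc.dense_compl ℝ
  have heq : (fun τ => ∑' k : Fin (n + 1) → ℤ, trigTerm ζ (b τ) fun i => s i + k i * qPeriod q) =
      fun τ => trigSum q ζ (b τ) s := by
    refine Continuous.ext_on hd (hcont.comp hbc)
      ((continuous_trigSum hq0 hq1 hζ0 hs).comp hbc) fun τ hτ => ?_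
    refine (hasSum_trigTerm_of_generic hq0 hq1 hζ hζq hs (b τ) fun i j hij h0 => hτ ?_).tsum_eq
    simp only [hS, Set.mem_iUnion]
    refine ⟨i, j, Finset.mem_Ioi.1 hij, ?_⟩
    rw [Set.mem_ofPred_eq, ← h0]
    congr 2
    simp only [hb]
    push_cast
    ring
  have h0 := congrFun heq 0
  have hb0 : b 0 = a := by ext i; simp [hb]
  simp only [hb0] at h0
  exact h0 ▸ (hsum a).hasSum

end TrigSum

/-! ### The periodised integrand in terms of the Laplace kernel. -/

section Periodization

variable {q : ℝ} {n : ℕ} {ζ : ℂ}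

/-- The kernel `(q; q)_∞^N θ(ζ ∏ x_j / z_j) / θ(ζ) ∏_{i,j} 1 / (x_j / z_i; q)_∞`. -/
def laplaceKernel (q : ℝ) (ζ : ℂ) (x z : Fin (n + 1) → ℂ) : ℂ :=
  qPochInf q q ^ (n + 1) * qTheta q (ζ * ∏ j, x j / z j) / qTheta q ζ *
    ∏ i, ∏ j, 1 / qPochInf q (x j / z i)

/-- The `q`-Sklyanin density without its normalisation. -/
def sklyaninProd (q : ℝ) (z : Fin (n + 1) → ℂ) : ℂ :=
  ∏ i, ∏ j ∈ Finset.Ioi i, qPochInf q (z i / z j) * qPochInf q (z j / z i)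

theorem cpow_add_mul_qPeriod (hq0 : 0 < q) (hq1 : q < 1) (s : ℂ) (k : ℤ) :
    (q : ℂ) ^ (s + k * qPeriod q) = (q : ℂ) ^ s := by
  have hL : (Real.log q : ℂ) ≠ 0 := by exact_mod_cast (Real.log_neg hq0 hq1).ne
  rw [ofReal_cpow_eq_exp hq0, ofReal_cpow_eq_exp hq0, Complex.exp_eq_exp_iff_exists_int]
  refine ⟨k, ?_⟩
  rw [qPeriod]
  field_simp

/-- The part of the integrand that is periodic in each `s_j`. -/
def periodicPart (q : ℝ) (a α : Fin (n + 1) → ℝ) (t : ℝ) (ζ : ℂ) (s : Fin (n + 1) → ℂ) : ℂ :=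
  (∏ j, 1 / ((q : ℂ) ^ ((n : ℂ) * a j) * qPochInf q q) * (1 / (-ζ) ^ (a j : ℂ))) *
    (cauchyPi q α t (qPow q s) / cauchyPi q α t (qPow q fun j => (a j : ℂ))) *
    (∏ i, ∏ j, qPochInf q (q / (q : ℂ) ^ (a j - s i))) *
    ∏ i : Fin (n + 1), ∏ j ∈ Finset.Ioi i, ((q : ℂ) ^ s j - (q : ℂ) ^ s i) * pairFactor q (a i) (a j)

theorem nfoldIntegrand_eq (hq0 : 0 < q) (a α : Fin (n + 1) → ℝ) (t : ℝ)
    (s : Fin (n + 1) → ℂ) :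
    nfoldIntegrand q a α t ζ s = periodicPart q a α t ζ s * trigTerm ζ a s := by
  have hq := ofReal_ne_zero' hq0
  have e : ∀ i j, (q : ℂ) ^ (s i - a j + 1) = q / (q : ℂ) ^ (a j - s i) := fun i j => by
    rw [show s i - a j + 1 = 1 - (a j - s i) by ring, Complex.cpow_sub _ _ hq, Complex.cpow_one]
  simp only [nfoldIntegrand, periodicPart, trigTerm, e, Finset.prod_mul_distrib,
    Finset.prod_div_distrib, Finset.prod_const_one]
  ring

theorem periodicPart_periodic (hq0 : 0 < q) (hq1 : q < 1) (a α : Fin (n + 1) → ℝ) (t : ℝ)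
    (s : Fin (n + 1) → ℂ) (k : Fin (n + 1) → ℤ) :
    periodicPart q a α t ζ (fun i => s i + k i * qPeriod q) = periodicPart q a α t ζ s := by
  have e0 : (qPow q fun i => s i + k i * qPeriod q) = qPow q s :=
    funext fun i => cpow_add_mul_qPeriod hq0 hq1 _ _
  simp only [periodicPart, e0, cpow_add_mul_qPeriod hq0 hq1]
  have e : ∀ i j, (q : ℂ) ^ (a j - (s i + k i * qPeriod q)) = (q : ℂ) ^ (a j - s i) := fun i j => by
    have := cpow_add_mul_qPeriod hq0 hq1 (a j - s i) (-k i)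
    rw [← this]; push_cast; ring_nf
  simp only [e]

/-- All auxiliary factors cancel: (q^{1-u};q)_∞/θ(q^u) leaves 1/(q^u;q)_∞ for u = a_j - s_i,
`pairFactor` absorbs `thetaSinRatio`, and the remaining theta functions of s_j - s_i become the
Sklyanin product. -/
theorem periodicPart_mul_trigSum (hq0 : 0 < q) (hq1 : q < 1) (hζ : ζ ≠ 0)
    {s : Fin (n + 1) → ℂ} (hs : ∀ i, ∀ k : ℤ, (s i + k * qPeriod q).im ≠ 0)
    (a α : Fin (n + 1) → ℝ) (t : ℝ) :
    (-(π : ℂ)) ^ (n + 1) * (periodicPart q a α t ζ s * trigSum q ζ a s) =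
      (-(Real.log q : ℂ)) ^ (n + 1) * (cauchyPi q α t (qPow q s) /
        cauchyPi q α t (qPow q fun j => (a j : ℂ))) *
        (laplaceKernel q ζ (qPow q fun j => (a j : ℂ)) (qPow q s) * sklyaninProd q (qPow q s)) := by
  have hq := ofReal_ne_zero' hq0
  have hqq := qPochInf_self_ne_zero hq0 hq1
  have hpi : (π : ℂ) ≠ 0 := by exact_mod_cast Real.pi_ne_zero
  have hp : ∀ s : ℂ, (q : ℂ) ^ s ≠ 0 := fun s => by simp [hq]
  have h1 : ∀ i j, qPochInf q (q / (q : ℂ) ^ (a j - s i)) / qTheta q ((q : ℂ) ^ (a j - s i)) =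
      1 / qPochInf q ((q : ℂ) ^ (a j : ℂ) / (q : ℂ) ^ s i) := fun i j => by
    have h := qTheta_cpow_ne_zero hq0 hq1 (hs i) (a j)
    rw [qTheta] at h ⊢
    have h3 := left_ne_zero_of_mul h
    have h4 := right_ne_zero_of_mul h
    rw [← Complex.cpow_sub _ _ hq]
    field_simp
  have h2 : ∀ i j, ((q : ℂ) ^ s j - (q : ℂ) ^ s i) * pairFactor q (a i) (a j) *
      ((q : ℂ) ^ (a j - s j) * (qTheta q ((q : ℂ) ^ (s j - s i)) *
        thetaSinRatio q ((a i - a j : ℝ) : ℂ))) =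
      ((q : ℂ) ^ (a i : ℂ) * (q : ℂ) ^ (a j : ℂ)) * (qPochInf q ((q : ℂ) ^ s i / (q : ℂ) ^ s j) *
        qPochInf q ((q : ℂ) ^ s j / (q : ℂ) ^ s i)) := fun i j => by
    have hσ := thetaSinRatio_ofReal_ne_zero hq0 hq1 (a i - a j)
    have hi := hp (s i)
    have hj := hp (s j)
    rw [pairFactor_eq hq0 hq1, qTheta, qPochInf_eq hq0 hq1 ((q : ℂ) ^ s i / (q : ℂ) ^ s j),
      Complex.cpow_sub _ _ hq, Complex.cpow_sub _ _ hq,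
      show (q : ℂ) / ((q : ℂ) ^ s j / (q : ℂ) ^ s i) = (q : ℂ) ^ s i / (q : ℂ) ^ s j * q by
        field_simp]
    field_simp
  have h3 : ∀ j, 1 / ((q : ℂ) ^ ((n : ℂ) * a j) * qPochInf q q) * (1 / (-ζ) ^ (a j : ℂ)) *
      (-ζ) ^ (a j : ℂ) = 1 / ((q : ℂ) ^ (a j : ℂ)) ^ n * (1 / qPochInf q q) := fun j => by
    have hA : (-ζ) ^ (a j : ℂ) ≠ 0 := by simp [hζ]
    rw [mul_comm (n : ℂ), Complex.cpow_mul_nat]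
    field_simp
  have hA : (∏ j, (q : ℂ) ^ (a j : ℂ)) ≠ 0 := Finset.prod_ne_zero_iff.2 fun j _ => hp _
  have H1 : (∏ i, ∏ j, qPochInf q (q / (q : ℂ) ^ (a j - s i))) /
      (∏ i, ∏ j, qTheta q ((q : ℂ) ^ (a j - s i))) =
      ∏ i, ∏ j, 1 / qPochInf q ((q : ℂ) ^ (a j : ℂ) / (q : ℂ) ^ s i) := by
    simp only [← Finset.prod_div_distrib, h1]
  -- Each pair contributes q^{a_i} q^{a_j}; by `prod_Ioi_mul` the total is (∏ q^{a_j})^n, which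
  -- cancels the prefactors q^{-n a_j}.
  have H2 : (∏ i : Fin (n + 1), ∏ j ∈ Finset.Ioi i,
      ((q : ℂ) ^ s j - (q : ℂ) ^ s i) * pairFactor q (a i) (a j)) *
      (∏ i, ∏ j ∈ Finset.Ioi i, (q : ℂ) ^ (a j - s j) * (qTheta q ((q : ℂ) ^ (s j - s i)) *
        thetaSinRatio q ((a i - a j : ℝ) : ℂ))) =
      (∏ j, (q : ℂ) ^ (a j : ℂ)) ^ n * sklyaninProd q (qPow q s) := by
    rw [← prod_Ioi_mul, sklyaninProd]
    simp only [← Finset.prod_mul_distrib, h2, qPow]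
  have H3 : (∏ j, 1 / ((q : ℂ) ^ ((n : ℂ) * a j) * qPochInf q q) * (1 / (-ζ) ^ (a j : ℂ))) *
      (∏ j, (-ζ) ^ (a j : ℂ)) =
      1 / (∏ j, (q : ℂ) ^ (a j : ℂ)) ^ n * (1 / qPochInf q q) ^ (n + 1) := by
    rw [← Finset.prod_mul_distrib, Finset.prod_congr rfl fun j _ => h3 j, Finset.prod_mul_distrib,
      Finset.prod_div_distrib, Finset.prod_pow]
    simp
  have H4 : (-(π : ℂ)) ^ (n + 1) * ((1 / qPochInf q q) ^ (n + 1) *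
      ((Real.log q : ℂ) / π * qPochInf q q ^ 2) ^ (n + 1)) =
      (-(Real.log q : ℂ)) ^ (n + 1) * qPochInf q q ^ (n + 1) := by
    rw [← mul_pow, ← mul_pow, ← mul_pow]
    congr 1
    field_simp
  have H5 : ∏ j, (q : ℂ) ^ (a j - s j) =
      ∏ j, qPow q (fun j => (a j : ℂ)) j / qPow q s j := by
    simp only [qPow, Complex.cpow_sub _ _ hq]
  rw [periodicPart, trigSum, laplaceKernel, ← H5]
  simp only [qPow] at H1 H2 ⊢
  rw [← H1]
  generalize (∏ i, ∏ j, qPochInf q (q / (q : ℂ) ^ (a j - s i))) = F3 at *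
  generalize (∏ i, ∏ j, qTheta q ((q : ℂ) ^ (a j - s i))) = F6 at *
  generalize (∏ i : Fin (n + 1), ∏ j ∈ Finset.Ioi i,
      ((q : ℂ) ^ s j - (q : ℂ) ^ s i) * pairFactor q (a i) (a j)) = F4 at *
  generalize (∏ i, ∏ j ∈ Finset.Ioi i, (q : ℂ) ^ (a j - s j) * (qTheta q ((q : ℂ) ^ (s j - s i)) *
        thetaSinRatio q ((a i - a j : ℝ) : ℂ))) = F5 at *
  generalize (∏ j, 1 / ((q : ℂ) ^ ((n : ℂ) * a j) * qPochInf q q) * (1 / (-ζ) ^ (a j : ℂ))) = F1 at *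
  generalize (∏ j, (-ζ) ^ (a j : ℂ)) = F2 at *
  generalize (∏ j, (q : ℂ) ^ (a j : ℂ)) = A at *
  generalize cauchyPi q α t _ / cauchyPi q α t _ = C
  generalize qTheta q (ζ * ∏ j, (q : ℂ) ^ (a j - s j)) = T
  generalize sklyaninProd q _ = Sk at *
  generalize ((Real.log q : ℂ) / π * qPochInf q q ^ 2) ^ (n + 1) = Y at *
  calc _ = (-(π : ℂ)) ^ (n + 1) * Y * (F1 * F2) * C * (F3 / F6) * (F4 * F5) * (T / qTheta q ζ) := by
        ring
    _ = ((-(π : ℂ)) ^ (n + 1) * ((1 / qPochInf q q) ^ (n + 1) * Y)) * (1 / A ^ n * A ^ n) * C *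
        (F3 / F6) * Sk * (T / qTheta q ζ) := by
        rw [H3, H2]; ring
    _ = _ := by
        rw [H4, one_div_mul_cancel (pow_ne_zero _ hA)]; ring

theorem hasSum_nfoldIntegrand (hq0 : 0 < q) (hq1 : q < 1) (hζ : -ζ ∈ Complex.slitPlane)
    (hζq : ∀ m : ℤ, (q : ℂ) ^ m * ζ ≠ 1) {s : Fin (n + 1) → ℂ}
    (hs : ∀ i, ∀ k : ℤ, (s i + k * qPeriod q).im ≠ 0) (a α : Fin (n + 1) → ℝ) (t : ℝ) :
    HasSum (fun k : Fin (n + 1) → ℤ => (-(π : ℂ)) ^ (n + 1) *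
        nfoldIntegrand q a α t ζ fun i => s i + k i * qPeriod q)
      ((-(Real.log q : ℂ)) ^ (n + 1) * (cauchyPi q α t (qPow q s) /
        cauchyPi q α t (qPow q fun j => (a j : ℂ))) *
        (laplaceKernel q ζ (qPow q fun j => (a j : ℂ)) (qPow q s) *
          sklyaninProd q (qPow q s))) := by
  have hζ0 : ζ ≠ 0 := fun h => Complex.slitPlane_ne_zero hζ (by simp [h])
  rw [← periodicPart_mul_trigSum hq0 hq1 hζ0 hs]
  simp only [nfoldIntegrand_eq hq0, periodicPart_periodic hq0 hq1]
  exact ((hasSum_trigTerm hq0 hq1 hζ hζq hs a).mul_left _).mul_left _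

end Periodization

/-! ### Transfer-matrix identities for two-state chains. -/

section Chain

/-- The sequence `f_1, …, f_{n-1}, c`. -/
def nextVal {β : Type*} {n : ℕ} (f : Fin n → β) (c : β) (i : Fin n) : β :=
  (Fin.snoc f c : Fin (n + 1) → β) i.succ

@[simp]
theorem nextVal_castSucc {β : Type*} {n : ℕ} (f : Fin (n + 1) → β) (c : β) (i : Fin n) :
    nextVal f c i.castSucc = f i.succ := by
  rw [nextVal, Fin.succ_castSucc, Fin.snoc_castSucc]

@[simp]
theorem nextVal_last {β : Type*} {n : ℕ} (f : Fin (n + 1) → β) (c : β) :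
    nextVal f c (Fin.last n) = c := by
  rw [nextVal, Fin.succ_last, Fin.snoc_last]

theorem nextVal_snoc_castSucc {β : Type*} {n : ℕ} (f : Fin n → β) (b c : β) (i : Fin n) :
    nextVal (Fin.snoc f b : Fin (n + 1) → β) c i.castSucc = nextVal f b i := by
  rw [nextVal_castSucc, nextVal]

/-- The partition function of a chain of two-state sites with the last state fixed. -/
def chain {n : ℕ} (p : Fin n → Bool → Bool → ℂ) (e : Bool) : ℂ :=
  ∑ ε : Fin n → Bool, ∏ i, p i (ε i) (nextVal ε e i)

theorem sum_bool_snoc {M : Type*} [AddCommMonoid M] {n : ℕ} (f : (Fin (n + 1) → Bool) → M) :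
    ∑ ε, f ε = ∑ b : Bool, ∑ ε : Fin n → Bool, f (Fin.snoc ε b) := by
  rw [← Fintype.sum_prod_type', ← (Fin.snocEquiv fun _ : Fin (n + 1) => Bool).sum_comp]
  rfl

theorem chain_succ {n : ℕ} (p : Fin (n + 1) → Bool → Bool → ℂ) (e : Bool) :
    chain p e = p (Fin.last n) false e * chain (fun i => p i.castSucc) false +
      p (Fin.last n) true e * chain (fun i => p i.castSucc) true := by
  rw [chain, sum_bool_snoc, Fintype.sum_bool, add_comm, chain, chain, Finset.mul_sum,
    Finset.mul_sum]
  congr 1 <;>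
  · refine Finset.sum_congr rfl fun ε _ => ?_
    rw [Fin.prod_univ_castSucc, mul_comm, nextVal_last, Fin.snoc_last]
    congr 1
    refine Finset.prod_congr rfl fun i _ => ?_
    rw [nextVal_snoc_castSucc, Fin.snoc_castSucc]

theorem chain_zero (p : Fin 0 → Bool → Bool → ℂ) (e : Bool) : chain p e = 1 := by
  simp [chain]

/-- The transfer weights of the left side of the Pieri rule. -/
def pieriLeft (w A B : ℂ) : Bool → Bool → ℂ
  | false, false => 1 - A
  | false, true => (1 - A) * (1 - B)
  | true, false => w * (1 - A * B)
  | true, true => w * (1 - B)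

/-- The transfer weights of the right side of the Pieri rule. -/
def pieriRight (w A B A' : ℂ) : Bool → Bool → ℂ
  | false, false => 1 - A
  | false, true => (1 - A) * (1 - B * A')
  | true, _ => w * (1 - B)

/-- The induction needs both values of the final state. The right chain is one site shorter because
the weight of a site on the right involves the A of the next one. -/
theorem chain_pieriLeft_aux {n : ℕ} (w : ℂ) (A B : Fin (n + 1) → ℂ) :
    let V := chain fun i : Fin n => pieriRight w (A i.castSucc) (B i.castSucc) (A i.succ)
    (chain (fun i => pieriLeft w (A i) (B i)) false =
      (1 + w * B (Fin.last n)) * (1 - A (Fin.last n)) * V false + w * (1 - B (Fin.last n)) * V true) ∧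
    (chain (fun i => pieriLeft w (A i) (B i)) true =
      (1 - B (Fin.last n)) * (1 - A (Fin.last n)) * V false +
        w * (1 - B (Fin.last n)) * V true) := by
  intro V
  induction n with
  | zero =>
    simp only [V, chain_succ, chain_zero, pieriLeft]
    constructor <;> ring
  | succ n ih =>
    obtain ⟨h1, h2⟩ := ih (fun i => A i.castSucc) fun i => B i.castSucc
    simp only [V]
    rw [chain_succ, chain_succ (fun i => pieriLeft w (A i) (B i)), h1, h2, chain_succ, chain_succ]
    simp only [pieriLeft, pieriRight, Fin.succ_last, Fin.succ_castSucc]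
    constructor <;> ring

/-- Adding the two formulas of `chain_pieriLeft_aux` with weights 1 and w produces the common factor
1 + w. The value X past the end is immaterial, since the boundary state is `false`. -/
theorem chain_pieri {n : ℕ} (w X : ℂ) (A B : Fin n → ℂ) :
    chain (fun i => pieriLeft w (A i) (B i)) false + w * chain (fun i => pieriLeft w (A i) (B i)) true =
      (1 + w) * chain (fun i => pieriRight w (A i) (B i) (nextVal A X i)) false := by
  cases n with
  | zero => simp only [chain_zero]; ring
  | succ n =>
    obtain ⟨h1, h2⟩ := chain_pieriLeft_aux w A B
    rw [h1, h2, chain_succ]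
    simp only [pieriRight, nextVal_castSucc]
    ring

/-- The transfer weights of the functional equation of the generating function. -/
def tqWeight (C D : ℂ) : Bool → Bool → ℂ
  | false, false => 1 - D
  | false, true => 1 - C * D
  | true, false => -(1 - C) * (1 - D)
  | true, true => -(1 - C)

/-- For either value of the next state the two weights of a site add up to C(1 - D), so summing from
the first site on never remembers the state. -/
theorem chain_tqWeight {n : ℕ} (C D : Fin n → ℂ) (e : Bool) :
    chain (fun i => tqWeight (C i) (D i)) e = ∏ i, C i * (1 - D i) := by
  induction n generalizing e with
  | zero => simp [chain_zero]
  | succ n ih =>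
    rw [chain_succ, ih (fun i => C i.castSucc) fun i => D i.castSucc,
      ih (fun i => C i.castSucc) fun i => D i.castSucc, Fin.prod_univ_castSucc]
    cases e <;> simp only [tqWeight] <;> ring

end Chain

/-! ### Branching and the Pieri rule for q-Whittaker functions. -/

section Branching

variable {q : ℝ} {n : ℕ}

/-- The branching coefficient of the `q`-Whittaker functions. -/
def branchWeight (q : ℝ) (x : ℂ) (lam : Fin (n + 1) → ℤ) (mu : Fin n → ℤ) : ℂ :=
  x ^ ((∑ i, lam i) - ∑ i, mu i) *
    ∏ i : Fin n, qFact q (lam i.castSucc - lam i.succ).toNat *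
      (invQFact q (lam i.castSucc - mu i) * invQFact q (mu i - lam i.succ))

theorem invQFact_eq_zero_or (q : ℝ) (k : ℤ) : invQFact q k = 0 ∨ 0 ≤ k := by
  rcases lt_or_ge k 0 with h | h
  · exact Or.inl (invQFact_of_neg h)
  · exact Or.inr h

theorem invQFact_of_nonneg {k : ℤ} (hk : 0 ≤ k) : invQFact q k = 1 / qFact q k.toNat := by
  lift k to ℕ using hk
  rw [invQFact_natCast, Int.toNat_natCast]

theorem mem_interlacing {lam : Fin (n + 1) → ℤ} {mu : Fin n → ℤ} :
    mu ∈ interlacing lam ↔ ∀ i, lam i.succ ≤ mu i ∧ mu i ≤ lam i.castSucc := by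
  simp [interlacing, Fintype.mem_piFinset]

theorem branchWeight_eq_zero (x : ℂ) {lam : Fin (n + 1) → ℤ} {mu : Fin n → ℤ}
    (h : mu ∉ interlacing lam) : branchWeight q x lam mu = 0 := by
  rw [mem_interlacing] at h
  push Not at h
  obtain ⟨i, hi⟩ := h
  refine mul_eq_zero_of_right _ (Finset.prod_eq_zero (Finset.mem_univ i) (mul_eq_zero_of_right _ ?_))
  by_cases h1 : lam i.succ ≤ mu i
  · rw [invQFact_of_neg (by have := hi h1; omega), zero_mul]
  · rw [invQFact_of_neg (k := mu i - lam i.succ) (by omega), mul_zero]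

theorem whittakerP_succ (x : Fin (n + 1) → ℂ) (lam : Fin (n + 1) → ℤ) :
    whittakerP q (n + 1) x lam = ∑ mu ∈ interlacing lam,
      branchWeight q (x (Fin.last n)) lam mu * whittakerP q n (fun i => x i.castSucc) mu := by
  rw [whittakerP]
  refine Finset.sum_congr rfl fun mu hmu => ?_
  rw [branchWeight]
  congr 2
  refine Finset.prod_congr rfl fun i _ => ?_
  obtain ⟨h1, h2⟩ := mem_interlacing.1 hmu i
  rw [invQFact_of_nonneg (by omega), invQFact_of_nonneg (by omega)]
  ring

/-- The branching sum is extended to all of ℤ^n, the weight vanishing off interlacing rows; the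
summation variable can then be shifted freely. -/
theorem hasSum_whittakerP (x : Fin (n + 1) → ℂ) (lam : Fin (n + 1) → ℤ) :
    HasSum (fun mu => branchWeight q (x (Fin.last n)) lam mu *
      whittakerP q n (fun i => x i.castSucc) mu) (whittakerP q (n + 1) x lam) := by
  rw [whittakerP_succ]
  exact hasSum_sum_of_ne_finset_zero fun mu hmu => by rw [branchWeight_eq_zero _ hmu, zero_mul]

theorem antitone_of_mem_interlacing {lam : Fin (n + 1) → ℤ} {mu : Fin n → ℤ}
    (h : mu ∈ interlacing lam) : Antitone lam ∧ Antitone mu := by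
  rw [mem_interlacing] at h
  constructor
  · exact Fin.antitone_iff_succ_le.2 fun i => (h i).1.trans (h i).2
  · cases n with
    | zero => exact fun i => i.elim0
    | succ n =>
      refine Fin.antitone_iff_succ_le.2 fun i => (h i.succ).2.trans ?_
      rw [← Fin.succ_castSucc]
      exact (h i.castSucc).1

theorem whittakerP_eq_zero (x : Fin n → ℂ) {lam : Fin n → ℤ} (h : ¬ Antitone lam) :
    whittakerP q n x lam = 0 := by
  cases n with
  | zero => exact absurd (fun i => i.elim0) h
  | succ n =>
    rw [whittakerP_succ]
    exact Finset.sum_eq_zero fun mu hmu => absurd (antitone_of_mem_interlacing hmu).1 h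

/-- The factor of a descent in the Pieri coefficient. -/
def pieriFactor (q : ℝ) (d : ℤ) : Bool → Bool → ℂ
  | false, true => 1 - (q : ℂ) ^ d
  | _, _ => 1

/-- The Pieri coefficient. -/
def pieriCoeff (q : ℝ) (lam : Fin n → ℤ) (ε : Fin n → Bool) : ℂ :=
  ∏ i, pieriFactor q (lam i - nextVal lam 0 i) (ε i) (nextVal ε false i)

/-- Add a vertical strip. -/
def addBits (lam : Fin n → ℤ) (ε : Fin n → Bool) : Fin n → ℤ := fun i => lam i + (ε i).toInt

theorem pieriFactor_false (d : ℤ) (e : Bool) : pieriFactor q d e false = 1 := by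
  cases e <;> rfl

theorem pieriCoeff_succ (lam : Fin (n + 1) → ℤ) (ε : Fin (n + 1) → Bool) :
    pieriCoeff q lam ε =
      ∏ i : Fin n, pieriFactor q (lam i.castSucc - lam i.succ) (ε i.castSucc) (ε i.succ) := by
  rw [pieriCoeff, Fin.prod_univ_castSucc]
  simp only [nextVal_castSucc, nextVal_last, pieriFactor_false, mul_one]

/-- For a + b = 0 the truncation in `Int.toNat` would spoil the recurrence, but then a < 0 or b - 1
< 0 and both sides vanish. -/
theorem one_sub_zpow_mul_qFact {a b : ℤ} (h : 0 ≤ a + b) :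
    (1 - (q : ℂ) ^ (a + b)) * qFact q (a + b - 1).toNat * (invQFact q a * invQFact q (b - 1)) =
      qFact q (a + b).toNat * (invQFact q a * invQFact q (b - 1)) := by
  rcases h.eq_or_lt with h0 | h0
  · rcases invQFact_eq_zero_or q a with h1 | h1
    · simp [h1]
    · rw [invQFact_of_neg (k := b - 1) (by omega)]; simp
  · congr 1
    obtain ⟨k, hk⟩ : ∃ k : ℕ, a + b = k + 1 := ⟨(a + b - 1).toNat, by omega⟩
    rw [hk, show ((k : ℤ) + 1 - 1).toNat = k by omega, show ((k : ℤ) + 1).toNat = k + 1 by omega,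
      qFact_succ, mul_comm]
    norm_cast

theorem qFact_toNat_add_one {d : ℤ} (h : 0 ≤ d) :
    qFact q (d + 1).toNat = (1 - (q : ℂ) ^ (d + 1)) * qFact q d.toNat := by
  lift d to ℕ using h
  rw [show ((d : ℤ) + 1).toNat = d + 1 by omega, Int.toNat_natCast, qFact_succ, mul_comm]
  norm_cast

/-- Used with a = λ_i - μ_i and b = μ_i - λ_{i+1}. Factoring out 1/((q;q)_{a+1}(q;q)_b), with the
largest indices that occur, leaves polynomial local weights. -/
theorem pieriFactor_mul_branch (hq0 : 0 < q) (hq1 : q < 1) {a b : ℤ} (h : 0 ≤ a + b) (w : ℂ)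
    (e e' : Bool) :
    (if e then w else 1) * (pieriFactor q (a + b) e e' *
      (qFact q (a + b + e.toInt - e'.toInt).toNat *
      (invQFact q (a + e.toInt) * invQFact q (b - e'.toInt)))) =
      (qFact q (a + b).toNat * (invQFact q (a + 1) * invQFact q b)) *
        pieriLeft w ((q : ℂ) ^ (a + 1)) ((q : ℂ) ^ b) e e' := by
  have hq := ofReal_ne_zero' hq0
  have ga : invQFact q a = (1 - (q : ℂ) ^ (a + 1)) * invQFact q (a + 1) := by
    rw [← invQFact_sub_one hq0 hq1, add_sub_cancel_right]
  have gb : invQFact q (b - 1) = (1 - (q : ℂ) ^ b) * invQFact q b := invQFact_sub_one hq0 hq1 b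
  cases e <;> cases e' <;>
    simp only [pieriFactor, pieriLeft, Bool.toInt_true, Bool.toInt_false, add_zero, sub_zero,
      if_true, Bool.false_eq_true, if_false, add_sub_cancel_right]
  · rw [ga]; ring
  · have := one_sub_zpow_mul_qFact (q := q) h
    rw [ga, gb] at this
    rw [ga, gb]
    linear_combination this
  · rw [qFact_toNat_add_one h, ← zpow_add₀ hq, show a + 1 + b = a + b + 1 by ring]; ring
  · rw [gb]; ring

theorem pieriFactor_mul_branch' (hq0 : 0 < q) (hq1 : q < 1) (a b a' : ℤ) (K w : ℂ)
    (e e' : Bool) :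
    (if e then w else 1) * (pieriFactor q (b + a' - e.toInt + e'.toInt) e e' *
      (K * (invQFact q (a + e.toInt) * invQFact q (b - e.toInt)))) =
      (K * (invQFact q (a + 1) * invQFact q b)) *
        pieriRight w ((q : ℂ) ^ (a + 1)) ((q : ℂ) ^ b) ((q : ℂ) ^ (a' + 1)) e e' := by
  have hq := ofReal_ne_zero' hq0
  have ga : invQFact q a = (1 - (q : ℂ) ^ (a + 1)) * invQFact q (a + 1) := by
    rw [← invQFact_sub_one hq0 hq1, add_sub_cancel_right]
  have gb : invQFact q (b - 1) = (1 - (q : ℂ) ^ b) * invQFact q b := invQFact_sub_one hq0 hq1 b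
  cases e <;> cases e' <;>
    simp only [pieriFactor, pieriRight, Bool.toInt_true, Bool.toInt_false, add_zero, sub_zero,
      if_true, Bool.false_eq_true, if_false]
  · rw [ga]; ring
  · rw [ga, ← zpow_add₀ hq, show b + (a' + 1) = b + a' + 1 by ring]; ring
  · rw [gb]; ring
  · rw [gb]; ring

theorem sum_addBits (lam : Fin n → ℤ) (ε : Fin n → Bool) :
    ∑ i, addBits lam ε i = (∑ i, lam i) + ∑ i, (ε i).toInt := Finset.sum_add_distrib

theorem zpow_sum_toInt {x : ℂ} (hx : x ≠ 0) (ε : Fin n → Bool) :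
    x ^ (∑ i, (ε i).toInt) = ∏ i, if ε i then x else 1 := by
  induction n with
  | zero => simp
  | succ n ih =>
    rw [Fin.sum_univ_succ, Fin.prod_univ_succ, zpow_add₀ hx, ih fun i => ε i.succ]
    cases ε 0 <;> simp

/-- Adding a vertical strip commutes with branching up to the factor 1 + xu. Both sides share the
constant K; what remains are partition functions of two-state chains with w = xu, compared by
`chain_pieri`. -/
theorem sum_pieriCoeff_branchWeight (hq0 : 0 < q) (hq1 : q < 1) {lam : Fin (n + 1) → ℤ}
    (hlam : Antitone lam) (mu : Fin n → ℤ) {x : ℂ} (hx : x ≠ 0) (u : ℂ) :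
    ∑ ε, (∏ i, if ε i then u else 1) * pieriCoeff q lam ε * branchWeight q x (addBits lam ε) mu =
      (1 + x * u) * ∑ δ, (∏ i, if δ i then u else 1) *
        pieriCoeff q (fun i => mu i - (δ i).toInt) δ *
        branchWeight q x lam fun i => mu i - (δ i).toInt := by
  set A : Fin n → ℂ := fun i => (q : ℂ) ^ (lam i.castSucc - mu i + 1) with hA
  set B : Fin n → ℂ := fun i => (q : ℂ) ^ (mu i - lam i.succ) with hB
  set K : ℂ := x ^ ((∑ i, lam i) - ∑ i, mu i) *
    ∏ i : Fin n, qFact q (lam i.castSucc - lam i.succ).toNat *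
      (invQFact q (lam i.castSucc - mu i + 1) * invQFact q (mu i - lam i.succ)) with hK
  -- An arbitrary boundary value, written as a power of q only to have the same shape as the A i.
  set X : ℂ := (q : ℂ) ^ (lam (Fin.last n) - 0 + 1) with hX
  have hL : ∀ ε : Fin (n + 1) → Bool,
      (∏ i, if ε i then u else 1) * pieriCoeff q lam ε * branchWeight q x (addBits lam ε) mu =
      K * ((if ε (Fin.last n) then x * u else 1) *
        ∏ i : Fin n, pieriLeft (x * u) (A i) (B i) (ε i.castSucc) (ε i.succ)) := fun ε => by
    have e1 : (∏ i, if ε i then u else 1) * x ^ ((∑ i, addBits lam ε i) - ∑ i, mu i) =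
        x ^ ((∑ i, lam i) - ∑ i, mu i) * ∏ i, if ε i then x * u else 1 := by
      rw [sum_addBits, add_sub_right_comm, zpow_add₀ hx, zpow_sum_toInt hx, mul_left_comm,
        ← Finset.prod_mul_distrib]
      congr 2
      ext i
      cases ε i <;> simp [mul_comm]
    have e2 : (∏ i : Fin n, if ε i.castSucc then x * u else 1) * (pieriCoeff q lam ε *
        ∏ i : Fin n, qFact q (addBits lam ε i.castSucc - addBits lam ε i.succ).toNat *
          (invQFact q (addBits lam ε i.castSucc - mu i) *
            invQFact q (mu i - addBits lam ε i.succ))) =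
        (∏ i : Fin n, qFact q (lam i.castSucc - lam i.succ).toNat *
          (invQFact q (lam i.castSucc - mu i + 1) * invQFact q (mu i - lam i.succ))) *
        ∏ i : Fin n, pieriLeft (x * u) (A i) (B i) (ε i.castSucc) (ε i.succ) := by
      rw [pieriCoeff_succ, ← Finset.prod_mul_distrib, ← Finset.prod_mul_distrib,
        ← Finset.prod_mul_distrib]
      refine Finset.prod_congr rfl fun i _ => ?_
      -- Here λ must be weakly decreasing, so that `Int.toNat` does not truncate the gap.
      have hd : 0 ≤ (lam i.castSucc - mu i) + (mu i - lam i.succ) := by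
        have := hlam (Fin.castSucc_lt_succ (i := i)).le
        omega
      have h := pieriFactor_mul_branch hq0 hq1 hd (x * u) (ε i.castSucc) (ε i.succ)
      rw [sub_add_sub_cancel] at h
      rw [← h, addBits, addBits]
      congr 3
      · congr 2; ring
      · congr 2 <;> ring
    rw [branchWeight, mul_comm (∏ i, if ε i then u else 1), mul_assoc, ← mul_assoc (∏ i, _) (x ^ _),
      e1, Fin.prod_univ_castSucc, hK]
    linear_combination (x ^ ((∑ i, lam i) - ∑ i, mu i) * if ε (Fin.last n) then x * u else 1) * e2
  have hR : ∀ δ : Fin n → Bool, (∏ i, if δ i then u else 1) *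
        pieriCoeff q (fun i => mu i - (δ i).toInt) δ *
        branchWeight q x lam (fun i => mu i - (δ i).toInt) =
      K * ∏ i : Fin n, pieriRight (x * u) (A i) (B i) (nextVal A X i) (δ i) (nextVal δ false i) :=
      fun δ => by
    have e1 : (∏ i, if δ i then u else 1) * x ^ ((∑ i, lam i) - ∑ i, (mu i - (δ i).toInt)) =
        x ^ ((∑ i, lam i) - ∑ i, mu i) * ∏ i, if δ i then x * u else 1 := by
      rw [Finset.sum_sub_distrib, ← sub_add, zpow_add₀ hx, zpow_sum_toInt hx, mul_left_comm,
        ← Finset.prod_mul_distrib]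
      congr 2
      ext i
      cases δ i <;> simp [mul_comm]
    have e2 : (∏ i : Fin n, if δ i then x * u else 1) *
        (pieriCoeff q (fun i => mu i - (δ i).toInt) δ *
        ∏ i : Fin n, qFact q (lam i.castSucc - lam i.succ).toNat *
          (invQFact q (lam i.castSucc - (mu i - (δ i).toInt)) *
            invQFact q ((mu i - (δ i).toInt) - lam i.succ))) =
        (∏ i : Fin n, qFact q (lam i.castSucc - lam i.succ).toNat *
          (invQFact q (lam i.castSucc - mu i + 1) * invQFact q (mu i - lam i.succ))) *
        ∏ i : Fin n, pieriRight (x * u) (A i) (B i) (nextVal A X i) (δ i) (nextVal δ false i) := by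
      rw [pieriCoeff, ← Finset.prod_mul_distrib, ← Finset.prod_mul_distrib,
        ← Finset.prod_mul_distrib]
      refine Finset.prod_congr rfl fun i _ => ?_
      obtain ⟨a', h1, h2⟩ : ∃ a' : ℤ, nextVal A X i = (q : ℂ) ^ (a' + 1) ∧
          pieriFactor q (mu i - (δ i).toInt - nextVal (fun i => mu i - (δ i).toInt) 0 i) (δ i)
            (nextVal δ false i) = pieriFactor q (mu i - lam i.succ + a' - (δ i).toInt +
              (nextVal δ false i).toInt) (δ i) (nextVal δ false i) := by
        cases n with
        | zero => exact i.elim0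
        | succ n =>
          induction i using Fin.lastCases with
          | last => exact ⟨_, nextVal_last _ _, by simp only [nextVal_last, pieriFactor_false]⟩
          | cast i =>
            refine ⟨_, nextVal_castSucc _ _ _, ?_⟩
            simp only [nextVal_castSucc, Fin.succ_castSucc]
            congr 1
            ring
      have h := pieriFactor_mul_branch' hq0 hq1 (lam i.castSucc - mu i) (mu i - lam i.succ) a'
        (qFact q (lam i.castSucc - lam i.succ).toNat) (x * u) (δ i) (nextVal δ false i)
      rw [h1, h2, ← h]
      congr 4
      · congr 1; ring
      · congr 1; ring
    rw [branchWeight, mul_comm (∏ i, if δ i then u else 1), mul_assoc, ← mul_assoc (∏ i, _) (x ^ _),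
      e1, hK]
    linear_combination (x ^ ((∑ i, lam i) - ∑ i, mu i)) * e2
  simp only [hL, hR, ← Finset.mul_sum]
  have h := chain_pieri (x * u) X A B
  rw [sum_bool_snoc, Fintype.sum_bool, mul_left_comm]
  congr 1
  rw [chain, chain, chain] at h
  rw [← h, add_comm, Finset.mul_sum]
  have e : ∀ (ε : Fin n → Bool) (b : Bool), ∏ i : Fin n, pieriLeft (x * u) (A i) (B i)
      ((Fin.snoc ε b : Fin (n + 1) → Bool) i.castSucc) ((Fin.snoc ε b : Fin (n + 1) → Bool) i.succ) =
      ∏ i : Fin n, pieriLeft (x * u) (A i) (B i) (ε i) (nextVal ε b i) := fun ε b =>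
    Finset.prod_congr rfl fun i _ => by rw [Fin.snoc_castSucc, nextVal]
  simp only [e, Fin.snoc_last, if_true, Bool.false_eq_true, if_false, one_mul]

/-- Generating-function form of multiplication by the elementary symmetric polynomials. Branch on
the last variable, commute the strip past the branching by `sum_pieriCoeff_branchWeight`, and apply
induction to the shorter row. -/
theorem pieri (hq0 : 0 < q) (hq1 : q < 1) {lam : Fin n → ℤ} (hlam : Antitone lam)
    {x : Fin n → ℂ} (hx : ∀ i, x i ≠ 0) (u : ℂ) :
    ∑ ε, (∏ i, if ε i then u else 1) * pieriCoeff q lam ε * whittakerP q n x (addBits lam ε) =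
      (∏ i, (1 + x i * u)) * whittakerP q n x lam := by
  induction n with
  | zero => simp [whittakerP, pieriCoeff]
  | succ n ih =>
    have h1 : HasSum (fun mu => ∑ ε, (∏ i, if ε i then u else 1) * pieriCoeff q lam ε *
        (branchWeight q (x (Fin.last n)) (addBits lam ε) mu *
          whittakerP q n (fun i => x i.castSucc) mu))
        (∑ ε, (∏ i, if ε i then u else 1) * pieriCoeff q lam ε *
          whittakerP q (n + 1) x (addBits lam ε)) :=
      hasSum_sum fun ε _ => (hasSum_whittakerP x (addBits lam ε)).mul_left _
    have h2 : ∀ δ : Fin n → Bool, HasSum (fun mu : Fin n → ℤ => (∏ i, if δ i then u else 1) *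
        pieriCoeff q (fun i => mu i - (δ i).toInt) δ *
        branchWeight q (x (Fin.last n)) lam (fun i => mu i - (δ i).toInt) *
        whittakerP q n (fun i => x i.castSucc) mu)
        (∑ mu ∈ interlacing lam, (∏ i, if δ i then u else 1) *
        pieriCoeff q mu δ * branchWeight q (x (Fin.last n)) lam mu *
        whittakerP q n (fun i => x i.castSucc) (addBits mu δ)) := fun δ => by
      have h3 : HasSum (fun mu => (∏ i, if δ i then u else 1) *
        pieriCoeff q mu δ * branchWeight q (x (Fin.last n)) lam mu *
        whittakerP q n (fun i => x i.castSucc) (addBits mu δ)) _ :=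
        hasSum_sum_of_ne_finset_zero (s := interlacing lam) fun mu hmu => by
          rw [branchWeight_eq_zero _ hmu, mul_zero, zero_mul]
      -- The shift μ ↦ μ - δ turns the right side of the commutation relation into a vertical strip
      -- added to the inner row.
      have h4 := (Equiv.hasSum_iff (Equiv.subRight fun i => (δ i).toInt)).2 h3
      refine h4.congr_fun fun mu => ?_
      have : addBits (fun i => mu i - (δ i).toInt) δ = mu := by
        ext i; simp [addBits]
      simp only [Function.comp_apply, Equiv.subRight_apply]
      rw [show (mu - fun i => (δ i).toInt) = fun i => mu i - (δ i).toInt from rfl, this]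
    have h5 := (hasSum_sum fun δ (_ : δ ∈ Finset.univ) => h2 δ).mul_left (1 + x (Fin.last n) * u)
    refine (h1.unique (h5.congr_fun fun mu => ?_)).trans ?_
    · have := sum_pieriCoeff_branchWeight hq0 hq1 hlam mu (hx (Fin.last n)) u
      simp only [← mul_assoc, ← Finset.sum_mul]
      rw [this, mul_assoc]
    · rw [Finset.sum_comm, whittakerP_succ, Fin.prod_univ_castSucc, Finset.mul_sum, Finset.mul_sum]
      refine Finset.sum_congr rfl fun mu hmu => ?_
      have := ih (antitone_of_mem_interlacing hmu).2 fun i => hx i.castSucc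
      calc _ = (1 + x (Fin.last n) * u) * branchWeight q (x (Fin.last n)) lam mu *
            ∑ δ, (∏ i, if δ i then u else 1) * pieriCoeff q mu δ *
              whittakerP q n (fun i => x i.castSucc) (addBits mu δ) := by
            rw [Finset.mul_sum, Finset.mul_sum]
            refine Finset.sum_congr rfl fun δ _ => ?_
            ring
        _ = _ := by rw [this]; ring

end Branching

/-! ### Growth of q-Whittaker functions. -/

section Bounds

variable {q : ℝ} {n : ℕ}

/-- The geometric sequence `s^k`, extended by zero to negative `k`. -/
def geomInt (s : ℝ) (k : ℤ) : ℝ := if 0 ≤ k then s ^ k else 0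

theorem geomInt_nonneg {s : ℝ} (hs : 0 ≤ s) (k : ℤ) : 0 ≤ geomInt s k := by
  rw [geomInt]; split_ifs
  · exact zpow_nonneg hs k
  · exact le_rfl

theorem summable_geomInt {s : ℝ} (hs : 0 ≤ s) (hs1 : s < 1) : Summable (geomInt s) := by
  refine (Function.Injective.summable_iff Nat.cast_injective (g := ((↑) : ℕ → ℤ)) ?_).1 ?_
  · intro k hk
    rw [geomInt, if_neg]
    intro h
    exact hk ⟨k.toNat, Int.toNat_of_nonneg h⟩
  · refine (summable_geometric_of_lt_one hs hs1).congr fun k => ?_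
    simp [geomInt]

theorem summable_prod_geomInt {s : ℝ} (hs : 0 ≤ s) (hs1 : s < 1) (nu : Fin n → ℤ) :
    Summable fun lam : Fin n → ℤ => ∏ i, geomInt s (lam i - nu i) := by
  have h : ∀ i, Summable fun k : ℤ => geomInt s (k - nu i) := fun i => by
    have := (Equiv.summable_iff (Equiv.subRight (nu i))).2 (summable_geomInt hs hs1)
    exact this
  exact (hasSum_pi_prod _ _ (fun i => (h i).hasSum) fun i => (h i).norm).1.summable

theorem norm_zpow_le_zpow {x : ℂ} {r : ℝ} (h : ‖x‖ ≤ r) {k : ℤ} (hk : 0 ≤ k) : ‖x ^ k‖ ≤ r ^ k := by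
  lift k to ℕ using hk
  rw [zpow_natCast, zpow_natCast, norm_pow]
  exact pow_le_pow_left₀ (norm_nonneg _) h k

theorem zpow_sum {r : ℝ} (hr : r ≠ 0) (f : Fin n → ℤ) : r ^ (∑ i, f i) = ∏ i, r ^ f i := by
  induction n with
  | zero => simp
  | succ n ih => rw [Fin.sum_univ_succ, Fin.prod_univ_succ, zpow_add₀ hr, ih]

theorem prod_geomInt_of_nonneg {s : ℝ} (hs : s ≠ 0) {f : Fin n → ℤ} (hf : ∀ i, 0 ≤ f i) :
    ∏ i, geomInt s (f i) = s ^ (∑ i, f i) := by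
  rw [zpow_sum hs]
  exact Finset.prod_congr rfl fun i _ => if_pos (hf i)

/-- A bound of the inverse `q`-factorials. -/
def invQFactBound (q : ℝ) (hq0 : 0 < q) (hq1 : q < 1) : ℝ :=
  (exists_norm_invQFact_le hq0 hq1).choose

theorem one_le_invQFactBound (hq0 : 0 < q) (hq1 : q < 1) : 1 ≤ invQFactBound q hq0 hq1 :=
  (exists_norm_invQFact_le hq0 hq1).choose_spec.1

theorem norm_invQFact_le (hq0 : 0 < q) (hq1 : q < 1) (k : ℤ) :
    ‖invQFact q k‖ ≤ invQFactBound q hq0 hq1 :=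
  (exists_norm_invQFact_le hq0 hq1).choose_spec.2 k

theorem norm_branch_factor_le (hq0 : 0 < q) (hq1 : q < 1) (m : ℕ) (a b : ℤ) :
    ‖qFact q m * (invQFact q a * invQFact q b)‖ ≤ invQFactBound q hq0 hq1 ^ 2 := by
  rw [norm_mul, norm_mul, sq]
  have h1 := norm_qFact_le_one hq0 hq1 m
  have h2 := norm_invQFact_le hq0 hq1 a
  have h3 := norm_invQFact_le hq0 hq1 b
  have h4 := one_le_invQFactBound hq0 hq1
  calc _ ≤ 1 * (invQFactBound q hq0 hq1 * invQFactBound q hq0 hq1) := by gcongr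
    _ = _ := one_mul _

theorem norm_branchWeight_le (hq0 : 0 < q) (hq1 : q < 1) (x : ℂ) (lam : Fin (n + 1) → ℤ)
    (mu : Fin n → ℤ) : ‖branchWeight q x lam mu‖ ≤
      (invQFactBound q hq0 hq1 ^ 2) ^ n * ‖x ^ ((∑ i, lam i) - ∑ i, mu i)‖ := by
  rw [branchWeight, norm_mul, mul_comm]
  refine mul_le_mul_of_nonneg_right ?_ (norm_nonneg _)
  rw [norm_prod, ← Fin.prod_const]
  exact Finset.prod_le_prod (fun _ _ => norm_nonneg _) fun i _ => norm_branch_factor_le hq0 hq1 _ _ _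

theorem sum_sub_sum_eq (lam : Fin (n + 1) → ℤ) (mu : Fin n → ℤ) :
    (∑ i, lam i) - ∑ i, mu i = (∑ i : Fin n, (lam i.castSucc - mu i)) + lam (Fin.last n) := by
  rw [Fin.sum_univ_castSucc, Finset.sum_sub_distrib]; ring

/-- The slack between r and ρ gives a factor (r/ρ)^{λ_i-μ_i} per entry, and these geometric series
pay for the sum over interlacing rows. Uniformity in x serves the dominated convergence on the
torus. -/
theorem exists_norm_whittakerP_le (hq0 : 0 < q) (hq1 : q < 1) (n : ℕ) {r ρ : ℝ} (hr : 0 < r)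
    (hρ : r < ρ) : ∃ C, 0 ≤ C ∧ ∀ x : Fin n → ℂ, (∀ i, ‖x i‖ ≤ r) → ∀ lam : Fin n → ℤ,
      (∀ i, 0 ≤ lam i) → ‖whittakerP q n x lam‖ ≤ C * ρ ^ (∑ i, lam i) := by
  have hρ0 : 0 < ρ := hr.trans hρ
  have hs0 : 0 < r / ρ := div_pos hr hρ0
  have hs1 : r / ρ < 1 := (div_lt_one hρ0).2 hρ
  induction n with
  | zero => exact ⟨1, zero_le_one, fun x _ lam _ => by simp [whittakerP]⟩
  | succ n ih =>
    obtain ⟨C, hC, h⟩ := ih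
    set S := ∑' k, geomInt (r / ρ) k with hS
    have hS0 : 0 ≤ S := tsum_nonneg (geomInt_nonneg hs0.le)
    refine ⟨(invQFactBound q hq0 hq1 ^ 2) ^ n * C * S ^ n, by
      have := one_le_invQFactBound hq0 hq1
      positivity, fun x hx lam hlam => ?_⟩
    rw [whittakerP_succ]
    calc _ ≤ ∑ mu ∈ interlacing lam, (invQFactBound q hq0 hq1 ^ 2) ^ n * C * ρ ^ (∑ i, lam i) *
          ∏ i : Fin n, geomInt (r / ρ) (lam i.castSucc - mu i) := by
          refine norm_sum_le_of_le _ fun mu hmu => ?_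
          rw [mem_interlacing] at hmu
          have hmu0 : ∀ i, 0 ≤ mu i := fun i => (hlam _).trans (hmu i).1
          have hk : ∀ i : Fin n, 0 ≤ lam i.castSucc - mu i := fun i => sub_nonneg.2 (hmu i).2
          have hk0 : 0 ≤ (∑ i, lam i) - ∑ i, mu i := by
            rw [sum_sub_sum_eq]
            exact add_nonneg (Finset.sum_nonneg fun i _ => hk i) (hlam _)
          rw [norm_mul]
          have h1 := norm_branchWeight_le hq0 hq1 (x (Fin.last n)) lam mu
          have h2 := h (fun i => x i.castSucc) (fun i => hx _) mu hmu0
          have h3 := norm_zpow_le_zpow (hx (Fin.last n)) hk0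
          have h4 := one_le_invQFactBound hq0 hq1
          rw [prod_geomInt_of_nonneg hs0.ne' hk]
          -- The surplus factor (r/ρ)^{λ_N} is at most 1 because λ_N ≥ 0.
          have h5 : r ^ ((∑ i, lam i) - ∑ i, mu i) * ρ ^ (∑ i, mu i) ≤
              ρ ^ (∑ i, lam i) * (r / ρ) ^ (∑ i : Fin n, (lam i.castSucc - mu i)) := by
            have e : r ^ ((∑ i, lam i) - ∑ i, mu i) * ρ ^ (∑ i, mu i) =
                ρ ^ (∑ i, lam i) * (r / ρ) ^ ((∑ i, lam i) - ∑ i, mu i) := by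
              rw [div_zpow, zpow_sub₀ hρ0.ne']
              have := (zpow_pos hρ0 (∑ i, mu i)).ne'
              have := (zpow_pos hρ0 (∑ i, lam i)).ne'
              field_simp
            rw [e, sum_sub_sum_eq]
            refine mul_le_mul_of_nonneg_left ?_ (zpow_pos hρ0 _).le
            rw [zpow_add₀ hs0.ne']
            refine mul_le_of_le_one_right (zpow_pos hs0 _).le ?_
            obtain ⟨k, hk⟩ := Int.eq_ofNat_of_zero_le (hlam (Fin.last n))
            rw [hk, zpow_natCast]
            exact pow_le_one₀ hs0.le hs1.le
          calc _ ≤ ((invQFactBound q hq0 hq1 ^ 2) ^ n * r ^ ((∑ i, lam i) - ∑ i, mu i)) *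
                (C * ρ ^ (∑ i, mu i)) := by
                refine mul_le_mul (h1.trans ?_) h2 (norm_nonneg _) (by positivity)
                gcongr
            _ = (invQFactBound q hq0 hq1 ^ 2) ^ n * C *
                (r ^ ((∑ i, lam i) - ∑ i, mu i) * ρ ^ (∑ i, mu i)) := by ring
            _ ≤ (invQFactBound q hq0 hq1 ^ 2) ^ n * C * (ρ ^ (∑ i, lam i) *
                (r / ρ) ^ (∑ i : Fin n, (lam i.castSucc - mu i))) := by gcongr
            _ = _ := by ring
      _ = (invQFactBound q hq0 hq1 ^ 2) ^ n * C * ρ ^ (∑ i, lam i) * ∏ i : Fin n,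
          ∑ k ∈ Finset.Icc (lam i.succ) (lam i.castSucc), geomInt (r / ρ) (lam i.castSucc - k) := by
          rw [← Finset.mul_sum, Finset.prod_univ_sum]; rfl
      _ ≤ (invQFactBound q hq0 hq1 ^ 2) ^ n * C * ρ ^ (∑ i, lam i) * S ^ n := by
          have h4 := one_le_invQFactBound hq0 hq1
          refine mul_le_mul_of_nonneg_left ?_ (by positivity)
          rw [← Fin.prod_const]
          refine Finset.prod_le_prod (fun i _ => Finset.sum_nonneg fun k _ =>
            geomInt_nonneg hs0.le _) fun i _ => ?_
          have := (Equiv.hasSum_iff (Equiv.subLeft (lam i.castSucc))).2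
            (summable_geomInt hs0.le hs1).hasSum
          exact sum_le_hasSum _ (fun k _ => geomInt_nonneg hs0.le _) this
      _ = _ := by ring

end Bounds

/-! ### The one-variable Cauchy weights. -/

section GeneratingFunction

variable {q : ℝ} {n : ℕ}

/-- The coefficient of the one-variable Cauchy kernel. -/
def cauchyWeight (q : ℝ) (y : ℂ) (lam nu : Fin n → ℤ) : ℂ :=
  y ^ ((∑ i, lam i) - ∑ i, nu i) * ∏ i, qFact q (nu i - nextVal nu 0 i).toNat *
    (invQFact q (lam i - nu i) * invQFact q (nu i - nextVal lam 0 i))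

theorem cauchyWeight_ne_zero {y : ℂ} {lam nu : Fin n → ℤ} (h : cauchyWeight q y lam nu ≠ 0)
    (i : Fin n) : nu i ≤ lam i ∧ nextVal lam 0 i ≤ nu i := by
  have h1 := Finset.prod_ne_zero_iff.1 (right_ne_zero_of_mul h) i (Finset.mem_univ i)
  have h2 := right_ne_zero_of_mul h1
  constructor
  · have := (invQFact_eq_zero_or q (lam i - nu i)).resolve_left (left_ne_zero_of_mul h2)
    omega
  · have := (invQFact_eq_zero_or q (nu i - nextVal lam 0 i)).resolve_left (right_ne_zero_of_mul h2)
    omega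

theorem antitone_of_nextVal_le {lam nu : Fin n → ℤ} (h1 : ∀ i, nu i ≤ lam i)
    (h2 : ∀ i, nextVal lam 0 i ≤ nu i) :
    Antitone lam ∧ (∀ i, 0 ≤ lam i) ∧ ∀ i, 0 ≤ nu i := by
  cases n with
  | zero => exact ⟨fun i => i.elim0, fun i => i.elim0, fun i => i.elim0⟩
  | succ n =>
    have ha : Antitone lam := Fin.antitone_iff_succ_le.2 fun i => by
      have := h2 i.castSucc
      rw [nextVal_castSucc] at this
      exact this.trans (h1 _)
    have h0 : 0 ≤ nu (Fin.last n) := by simpa using h2 (Fin.last n)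
    refine ⟨ha, fun i => (h0.trans (h1 _)).trans (ha (Fin.le_last i)), fun i => ?_⟩
    induction i using Fin.lastCases with
    | last => exact h0
    | cast i =>
      have := h2 i.castSucc
      rw [nextVal_castSucc] at this
      exact ((h0.trans (h1 _)).trans (ha (Fin.le_last _))).trans this

theorem norm_cauchyWeight_mul_le (hq0 : 0 < q) (hq1 : q < 1) {F : (Fin n → ℤ) → ℂ} {C ρ s : ℝ}
    (hC : 0 ≤ C) (hρ : 0 < ρ) (hs : 0 < s)
    (hF : ∀ lam, Antitone lam → (∀ i, 0 ≤ lam i) → ‖F lam‖ ≤ C * ρ ^ (∑ i, lam i))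
    {y : ℂ} (hy : ‖y‖ ≤ s) (lam nu : Fin n → ℤ) :
    ‖cauchyWeight q y lam nu * F lam‖ ≤ (invQFactBound q hq0 hq1 ^ 2) ^ n * C * ρ ^ (∑ i, nu i) *
      ∏ i, geomInt (s * ρ) (lam i - nu i) := by
  have hB := one_le_invQFactBound hq0 hq1
  by_cases h : cauchyWeight q y lam nu = 0
  · rw [h, zero_mul, norm_zero]
    refine mul_nonneg (by positivity) (Finset.prod_nonneg fun i _ => geomInt_nonneg (by positivity) _)
  have h1 := fun i => (cauchyWeight_ne_zero h i).1
  obtain ⟨ha, h0, -⟩ := antitone_of_nextVal_le h1 fun i => (cauchyWeight_ne_zero h i).2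
  rw [prod_geomInt_of_nonneg (by positivity) fun i => sub_nonneg.2 (h1 i), norm_mul]
  have hk : 0 ≤ ∑ i, (lam i - nu i) := Finset.sum_nonneg fun i _ => sub_nonneg.2 (h1 i)
  have h3 : ‖cauchyWeight q y lam nu‖ ≤
      s ^ (∑ i, (lam i - nu i)) * (invQFactBound q hq0 hq1 ^ 2) ^ n := by
    rw [cauchyWeight, norm_mul, ← Finset.sum_sub_distrib]
    refine mul_le_mul (norm_zpow_le_zpow hy hk) ?_ (norm_nonneg _) (by positivity)
    rw [norm_prod, ← Fin.prod_const]
    exact Finset.prod_le_prod (fun _ _ => norm_nonneg _) fun i _ =>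
      norm_branch_factor_le hq0 hq1 _ _ _
  calc _ ≤ (s ^ (∑ i, (lam i - nu i)) * (invQFactBound q hq0 hq1 ^ 2) ^ n) *
        (C * ρ ^ (∑ i, lam i)) := mul_le_mul h3 (hF lam ha h0) (norm_nonneg _) (by positivity)
    _ = _ := by
      have e : ∑ i, lam i = ∑ i, nu i + ∑ i, (lam i - nu i) := by
        rw [Finset.sum_sub_distrib]; ring
      rw [mul_zpow, e, zpow_add₀ hρ.ne']
      ring

theorem nextVal_sub_toInt (rho : Fin n → ℤ) (ε : Fin n → Bool) (i : Fin n) :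
    nextVal (fun i => rho i - (ε i).toInt) 0 i = nextVal rho 0 i - (nextVal ε false i).toInt := by
  cases n with
  | zero => exact i.elim0
  | succ n =>
    induction i using Fin.lastCases with
    | last => simp
    | cast i => simp

theorem pieriFactor_mul_tq (hq0 : 0 < q) (hq1 : q < 1) (a b : ℤ) (K : ℂ) (e e' : Bool) :
    (if e then -1 else 1) * (pieriFactor q (a + b - e.toInt + e'.toInt) e e' *
      (K * (invQFact q (a - e.toInt) * invQFact q (b + e'.toInt)))) =
      (K * (invQFact q a * invQFact q (b + 1))) * tqWeight ((q : ℂ) ^ a) ((q : ℂ) ^ (b + 1)) e e' := by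
  have hq := ofReal_ne_zero' hq0
  have ga : invQFact q (a - 1) = (1 - (q : ℂ) ^ a) * invQFact q a := invQFact_sub_one hq0 hq1 a
  have gb : invQFact q b = (1 - (q : ℂ) ^ (b + 1)) * invQFact q (b + 1) := by
    rw [← invQFact_sub_one hq0 hq1, add_sub_cancel_right]
  cases e <;> cases e' <;>
    simp only [pieriFactor, tqWeight, Bool.toInt_true, Bool.toInt_false, add_zero, sub_zero,
      if_true, Bool.false_eq_true, if_false]
  · rw [gb]; ring
  · rw [← zpow_add₀ hq, show a + (b + 1) = a + b + 1 by ring]; ring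
  · rw [ga, gb]; ring
  · rw [ga]; ring

/-- The strip sum reduces to the chain of `chain_tqWeight`, with value ∏ C_i(1 - D_i). Here ∏ C_i =
q^{|ρ|-|ν|} changes y into qy, and 1 - D_i restores the factorials. -/
theorem sum_pieriCoeff_cauchyWeight (hq0 : 0 < q) (hq1 : q < 1) (rho nu : Fin n → ℤ) {y : ℂ}
    (hy : y ≠ 0) :
    ∑ ε, (∏ i, if ε i then -y else 1) * pieriCoeff q (fun i => rho i - (ε i).toInt) ε *
      cauchyWeight q y (fun i => rho i - (ε i).toInt) nu = cauchyWeight q (q * y) rho nu := by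
  have hq := ofReal_ne_zero' hq0
  set C : Fin n → ℂ := fun i => (q : ℂ) ^ (rho i - nu i) with hC
  set D : Fin n → ℂ := fun i => (q : ℂ) ^ (nu i - nextVal rho 0 i + 1) with hD
  set K : ℂ := ∏ i : Fin n, qFact q (nu i - nextVal nu 0 i).toNat *
      (invQFact q (rho i - nu i) * invQFact q (nu i - nextVal rho 0 i + 1)) with hK
  have h1 : ∀ ε : Fin n → Bool, (∏ i, if ε i then -y else 1) *
      pieriCoeff q (fun i => rho i - (ε i).toInt) ε *
      cauchyWeight q y (fun i => rho i - (ε i).toInt) nu =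
      y ^ ((∑ i, rho i) - ∑ i, nu i) * K *
        ∏ i, tqWeight (C i) (D i) (ε i) (nextVal ε false i) := fun ε => by
    have e1 : (∏ i, if ε i then -y else 1) * y ^ ((∑ i, (rho i - (ε i).toInt)) - ∑ i, nu i) =
        y ^ ((∑ i, rho i) - ∑ i, nu i) * ∏ i, if ε i then -1 else 1 := by
      have : (∑ i, (rho i - (ε i).toInt)) - ∑ i, nu i =
          ((∑ i, rho i) - ∑ i, nu i) - ∑ i, (ε i).toInt := by
        rw [Finset.sum_sub_distrib]; ring
      rw [this, zpow_sub₀ hy, zpow_sum_toInt hy, mul_div_left_comm, ← Finset.prod_div_distrib]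
      congr 2
      ext i
      cases ε i <;> simp [hy]
    have e2 : (∏ i, if ε i then (-1 : ℂ) else 1) *
        (pieriCoeff q (fun i => rho i - (ε i).toInt) ε *
        ∏ i, qFact q (nu i - nextVal nu 0 i).toNat * (invQFact q (rho i - (ε i).toInt - nu i) *
          invQFact q (nu i - nextVal (fun i => rho i - (ε i).toInt) 0 i))) =
        K * ∏ i, tqWeight (C i) (D i) (ε i) (nextVal ε false i) := by
      rw [pieriCoeff, hK, ← Finset.prod_mul_distrib, ← Finset.prod_mul_distrib,
        ← Finset.prod_mul_distrib]
      refine Finset.prod_congr rfl fun i _ => ?_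
      rw [← pieriFactor_mul_tq hq0 hq1, nextVal_sub_toInt]
      congr 3
      · ring
      · congr 2 <;> ring
    rw [cauchyWeight, mul_comm (∏ i, if ε i then -y else 1), mul_assoc,
      ← mul_assoc (∏ i, _) (y ^ _), e1]
    linear_combination (y ^ ((∑ i, rho i) - ∑ i, nu i)) * e2
  simp only [h1, ← Finset.mul_sum]
  have h2 := chain_tqWeight C D false
  rw [chain] at h2
  have h3 : (q : ℂ) ^ ((∑ i, rho i) - ∑ i, nu i) = ∏ i, C i := by
    rw [← Finset.sum_sub_distrib, hC]
    have : ∀ {m : ℕ} (f : Fin m → ℤ), (q : ℂ) ^ (∑ i, f i) = ∏ i, (q : ℂ) ^ f i := fun {m} f => by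
      induction m with
      | zero => simp
      | succ m ih => rw [Fin.sum_univ_succ, Fin.prod_univ_succ, zpow_add₀ hq, ih]
    exact this _
  rw [h2, cauchyWeight, mul_zpow, h3, hK, mul_assoc, mul_comm (∏ i, C i), mul_assoc,
    ← Finset.prod_mul_distrib, ← Finset.prod_mul_distrib]
  congr 1
  refine Finset.prod_congr rfl fun i _ => ?_
  have gb : invQFact q (nu i - nextVal rho 0 i) =
      (1 - D i) * invQFact q (nu i - nextVal rho 0 i + 1) := by
    rw [hD, ← invQFact_sub_one hq0 hq1, add_sub_cancel_right]
  rw [gb]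
  ring

end GeneratingFunction

/-! ### The one-variable Cauchy identity. -/

section OneVariableCauchy

variable {q : ℝ} {n : ℕ}

theorem norm_pieriCoeff_le_one (hq0 : 0 < q) (hq1 : q < 1) {lam : Fin n → ℤ} (hlam : Antitone lam)
    (ε : Fin n → Bool) : ‖pieriCoeff q lam ε‖ ≤ 1 := by
  cases n with
  | zero => simp [pieriCoeff]
  | succ n =>
    rw [pieriCoeff_succ, norm_prod]
    refine Finset.prod_le_one (fun _ _ => norm_nonneg _) fun i _ => ?_
    obtain ⟨k, hk⟩ := Int.eq_ofNat_of_zero_le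
      (sub_nonneg.2 (hlam (Fin.castSucc_lt_succ (i := i)).le))
    rw [hk]
    cases ε i.castSucc <;> cases ε i.succ <;> simp only [pieriFactor, norm_one, le_refl]
    rw [zpow_natCast, ← Complex.ofReal_pow, ← Complex.ofReal_one, ← Complex.ofReal_sub,
      Complex.norm_real, Real.norm_eq_abs, abs_of_nonneg]
    · linarith [pow_pos hq0 k]
    · linarith [pow_le_one₀ hq0.le hq1.le (n := k)]

theorem summable_cauchyWeight_mul (hq0 : 0 < q) (hq1 : q < 1) {F : (Fin n → ℤ) → ℂ} {C ρ : ℝ}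
    (hC : 0 ≤ C) (hρ : 0 < ρ)
    (hF : ∀ lam, Antitone lam → (∀ i, 0 ≤ lam i) → ‖F lam‖ ≤ C * ρ ^ (∑ i, lam i))
    {y : ℂ} (hy0 : y ≠ 0) (hy : ‖y‖ * ρ < 1) (nu : Fin n → ℤ) :
    Summable fun lam => cauchyWeight q y lam nu * F lam :=
  ((summable_prod_geomInt (by positivity) hy nu).mul_left _).of_norm_bounded fun lam =>
    norm_cauchyWeight_mul_le hq0 hq1 hC hρ (norm_pos_iff.2 hy0) hF le_rfl lam nu

/-- The q-difference equation F(qy) = ∏(1 - x_i y) F(y) of the generating function. Expand ∏(1 - x_i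
y) P_λ by `pieri` with u = -y, sum over the enlarged row ρ = λ + ε, and apply
`sum_pieriCoeff_cauchyWeight`. -/
theorem hasSum_cauchyWeight_q_mul (hq0 : 0 < q) (hq1 : q < 1) {x : Fin n → ℂ}
    (hx : ∀ i, x i ≠ 0) {r : ℝ} (hr : 0 < r) (hxr : ∀ i, ‖x i‖ ≤ r) {y : ℂ} (hy0 : y ≠ 0)
    (hy : ‖y‖ * r < 1) (nu : Fin n → ℤ) :
    HasSum (fun lam => cauchyWeight q (q * y) lam nu * whittakerP q n x lam)
      ((∏ i, (1 - x i * y)) * ∑' lam, cauchyWeight q y lam nu * whittakerP q n x lam) := by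
  have hyn := norm_pos_iff.2 hy0
  obtain ⟨ρ, hρ, hρ1⟩ := exists_between ((lt_div_iff₀' hyn).2 hy)
  rw [lt_div_iff₀' hyn] at hρ1
  have hρ0 := hr.trans hρ
  obtain ⟨C, hC, hP⟩ := exists_norm_whittakerP_le hq0 hq1 n hr hρ
  have hF : ∀ ε : Fin n → Bool, ∀ lam : Fin n → ℤ, Antitone lam → (∀ i, 0 ≤ lam i) →
      ‖pieriCoeff q lam ε * whittakerP q n x (addBits lam ε)‖ ≤
        (C * ρ ^ (∑ i, (ε i).toInt)) * ρ ^ (∑ i, lam i) := fun ε lam ha h0 => by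
    rw [norm_mul]
    have h1 : ∀ i, 0 ≤ addBits lam ε i := fun i => by
      have := h0 i
      rw [addBits]
      cases ε i <;> simp <;> omega
    calc _ ≤ 1 * (C * ρ ^ (∑ i, addBits lam ε i)) :=
          mul_le_mul (norm_pieriCoeff_le_one hq0 hq1 ha ε) (hP x hxr _ h1) (norm_nonneg _) zero_le_one
      _ = _ := by rw [sum_addBits, zpow_add₀ hρ0.ne']; ring
  have hs : ∀ ε : Fin n → Bool, Summable fun lam => cauchyWeight q y lam nu *
      (pieriCoeff q lam ε * whittakerP q n x (addBits lam ε)) := fun ε =>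
    summable_cauchyWeight_mul hq0 hq1 (by positivity) hρ0 (hF ε) hy0 hρ1 nu
  have hs0 : Summable fun lam => cauchyWeight q y lam nu * whittakerP q n x lam :=
    summable_cauchyWeight_mul hq0 hq1 hC hρ0 (fun lam _ h0 => hP x hxr lam h0) hy0 hρ1 nu
  have h1 : ∀ lam, ∑ ε, (∏ i, if ε i then -y else 1) * (cauchyWeight q y lam nu *
      (pieriCoeff q lam ε * whittakerP q n x (addBits lam ε))) =
      (∏ i, (1 - x i * y)) * (cauchyWeight q y lam nu * whittakerP q n x lam) := fun lam => by
    by_cases h : cauchyWeight q y lam nu = 0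
    · simp [h]
    have ha := (antitone_of_nextVal_le (fun i => (cauchyWeight_ne_zero h i).1)
      fun i => (cauchyWeight_ne_zero h i).2).1
    have := pieri hq0 hq1 ha hx (-y)
    simp only [mul_neg, ← sub_eq_add_neg] at this
    rw [mul_left_comm, ← this, Finset.mul_sum]
    exact Finset.sum_congr rfl fun ε _ => by ring
  have h2 : HasSum (fun lam => (∏ i, (1 - x i * y)) *
      (cauchyWeight q y lam nu * whittakerP q n x lam))
      (∑ ε : Fin n → Bool, (∏ i, if ε i then -y else 1) * ∑' lam, cauchyWeight q y lam nu *
      (pieriCoeff q lam ε * whittakerP q n x (addBits lam ε))) := by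
    simp only [← h1]
    exact hasSum_sum fun ε _ => (hs ε).hasSum.mul_left _
  rw [(hs0.hasSum.mul_left (∏ i, (1 - x i * y))).unique h2]
  have h3 : ∀ ε : Fin n → Bool, HasSum (fun rho : Fin n → ℤ => cauchyWeight q y
      (fun i => rho i - (ε i).toInt) nu * (pieriCoeff q (fun i => rho i - (ε i).toInt) ε *
        whittakerP q n x rho)) (∑' lam, cauchyWeight q y lam nu *
      (pieriCoeff q lam ε * whittakerP q n x (addBits lam ε))) := fun ε => by
    have h4 := (Equiv.hasSum_iff (Equiv.subRight fun i => (ε i).toInt)).2 (hs ε).hasSum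
    refine h4.congr_fun fun rho => ?_
    have e : addBits (fun i => rho i - (ε i).toInt) ε = rho := by
      ext i; simp [addBits]
    simp only [Function.comp_apply, Equiv.subRight_apply]
    rw [show (rho - fun i => (ε i).toInt) = fun i => rho i - (ε i).toInt from rfl, e]
  have h5 := hasSum_sum fun ε (_ : ε ∈ Finset.univ) =>
    (h3 ε).mul_left (∏ i, if ε i then -y else 1)
  refine h5.congr_fun fun rho => ?_
  rw [← sum_pieriCoeff_cauchyWeight hq0 hq1 rho nu hy0, Finset.sum_mul]
  exact Finset.sum_congr rfl fun ε _ => by ring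

theorem cauchyWeight_self (hq0 : 0 < q) (hq1 : q < 1) (y : ℂ) {nu : Fin n → ℤ}
    (ha : Antitone nu) (h0 : ∀ i, 0 ≤ nu i) : cauchyWeight q y nu nu = 1 := by
  rw [cauchyWeight, sub_self, zpow_zero, one_mul]
  refine Finset.prod_eq_one fun i _ => ?_
  have hk : 0 ≤ nu i - nextVal nu 0 i := by
    cases n with
    | zero => exact i.elim0
    | succ n =>
      induction i using Fin.lastCases with
      | last => simpa using h0 _
      | cast i => simpa using ha (Fin.castSucc_lt_succ (i := i)).le
  rw [sub_self, invQFact_zero, one_mul, invQFact_of_nonneg hk, mul_one_div_cancel]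
  exact qFact_ne_zero hq0 hq1 _

theorem tendsto_cauchyWeight (hq0 : 0 < q) (hq1 : q < 1) (y : ℂ) (lam nu : Fin n → ℤ)
    (hne : lam ≠ nu) :
    Tendsto (fun k : ℕ => cauchyWeight q ((q : ℂ) ^ k * y) lam nu) atTop (𝓝 0) := by
  by_cases h : ∃ i, lam i < nu i
  · obtain ⟨i, hi⟩ := h
    refine tendsto_const_nhds.congr fun k => ?_
    by_contra h0
    exact absurd (cauchyWeight_ne_zero (Ne.symm h0) i).1 (by omega)
  push Not at h
  have hpos : 0 < (∑ i, lam i) - ∑ i, nu i := by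
    rw [← Finset.sum_sub_distrib]
    obtain ⟨i, hi⟩ := Function.ne_iff.1 hne
    exact Finset.sum_pos' (fun j _ => sub_nonneg.2 (h j)) ⟨i, Finset.mem_univ i, by
      have := h i; omega⟩
  obtain ⟨m, hm⟩ := Int.eq_ofNat_of_zero_le hpos.le
  have hm0 : m ≠ 0 := by rintro rfl; omega
  simp only [cauchyWeight, hm, zpow_natCast]
  have h1 := ((tendsto_ofReal_pow_zero hq0 hq1).mul_const y).pow m
  rw [zero_mul, zero_pow hm0] at h1
  simpa using h1.mul_const _

/-- Iterating the q-difference equation drives y to 0, where only λ = ν survives. This pins down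
F(y) = P_ν(x)/∏(x_i y;q)_∞. -/
theorem hasSum_cauchyWeight_mul_whittakerP (hq0 : 0 < q) (hq1 : q < 1) {x : Fin n → ℂ}
    (hx : ∀ i, x i ≠ 0) {r : ℝ} (hr : 0 < r) (hxr : ∀ i, ‖x i‖ ≤ r) {y : ℂ} (hy0 : y ≠ 0)
    (hy : ‖y‖ * r < 1) {nu : Fin n → ℤ} (hnu : ∀ i, 0 ≤ nu i) :
    HasSum (fun lam => cauchyWeight q y lam nu * whittakerP q n x lam)
      (whittakerP q n x nu * ∏ i, 1 / qPochInf q (x i * y)) := by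
  have hq := ofReal_ne_zero' hq0
  have hyn := norm_pos_iff.2 hy0
  obtain ⟨ρ, hρ, hρ1⟩ := exists_between ((lt_div_iff₀' hyn).2 hy)
  rw [lt_div_iff₀' hyn] at hρ1
  have hρ0 := hr.trans hρ
  obtain ⟨C, hC, hP⟩ := exists_norm_whittakerP_le hq0 hq1 n hr hρ
  have hqn : ∀ k : ℕ, ‖(q : ℂ) ^ k * y‖ ≤ ‖y‖ := fun k => by
    rw [norm_mul, norm_pow, Complex.norm_real, Real.norm_eq_abs, abs_of_pos hq0]
    exact mul_le_of_le_one_left (norm_nonneg _) (pow_le_one₀ hq0.le hq1.le)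
  set G : ℂ → ℂ := fun y => ∑' lam, cauchyWeight q y lam nu * whittakerP q n x lam with hG
  have hs0 : Summable fun lam => cauchyWeight q y lam nu * whittakerP q n x lam :=
    summable_cauchyWeight_mul hq0 hq1 hC hρ0 (fun lam _ h0 => hP x hxr lam h0) hy0 hρ1 nu
  have hiter : ∀ k : ℕ, G ((q : ℂ) ^ k * y) =
      (∏ i, ∏ m ∈ Finset.range k, (1 - x i * y * (q : ℂ) ^ m)) * G y := fun k => by
    induction k with
    | zero => simp
    | succ k ih =>
      have h1 := (hasSum_cauchyWeight_q_mul hq0 hq1 hx hr hxr (y := (q : ℂ) ^ k * y)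
        (mul_ne_zero (pow_ne_zero _ hq) hy0)
        ((mul_le_mul_of_nonneg_right (hqn k) hr.le).trans_lt hy) nu).tsum_eq
      have e : (q : ℂ) ^ (k + 1) * y = q * ((q : ℂ) ^ k * y) := by ring
      rw [e]
      change (∑' lam, _) = _
      rw [h1]
      change _ * G _ = _
      rw [ih, ← mul_assoc, ← Finset.prod_mul_distrib]
      congr 1
      refine Finset.prod_congr rfl fun i _ => ?_
      rw [Finset.prod_range_succ]
      ring
  have hlim1 : Tendsto (fun k : ℕ => G ((q : ℂ) ^ k * y)) atTop
      (𝓝 ((∏ i, qPochInf q (x i * y)) * G y)) := by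
    simp only [hiter]
    exact (tendsto_finsetProd _ fun i _ => tendsto_prod_qPochInf hq0 hq1 _).mul_const _
  -- Dominated convergence: the geometric bound for y also bounds the terms at q^k y.
  have hlim2 : Tendsto (fun k : ℕ => G ((q : ℂ) ^ k * y)) atTop
      (𝓝 (∑' lam, if lam = nu then whittakerP q n x nu else 0)) := by
    refine tendsto_tsum_of_dominated_convergence
      ((summable_prod_geomInt (by positivity) hρ1 nu).mul_left
        ((invQFactBound q hq0 hq1 ^ 2) ^ n * C * ρ ^ (∑ i, nu i))) (fun lam => ?_)
      (Eventually.of_forall fun k lam => norm_cauchyWeight_mul_le hq0 hq1 hC hρ0 hyn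
        (fun lam _ h0 => hP x hxr lam h0) (hqn k) lam nu)
    split_ifs with h
    · subst h
      by_cases ha : Antitone lam
      · simp only [cauchyWeight_self hq0 hq1 _ ha hnu, one_mul, tendsto_const_nhds]
      · simp only [whittakerP_eq_zero x ha, mul_zero, tendsto_const_nhds]
    · have := (tendsto_cauchyWeight hq0 hq1 y lam nu h).mul_const (whittakerP q n x lam)
      rwa [zero_mul] at this
  have h := tendsto_nhds_unique hlim1 hlim2
  rw [tsum_ite_eq] at h
  have hne : (∏ i, qPochInf q (x i * y)) ≠ 0 := Finset.prod_ne_zero_iff.2 fun i _ =>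
    qPochInf_ne_zero_of_norm_lt_one hq0 hq1 (by
      rw [norm_mul, mul_comm]
      exact (mul_le_mul_of_nonneg_left (hxr i) (norm_nonneg _)).trans_lt hy)
  have : whittakerP q n x nu * ∏ i, 1 / qPochInf q (x i * y) = G y := by
    rw [← h, Finset.prod_div_distrib, Finset.prod_const_one, mul_one_div, mul_div_right_comm,
      div_self hne, one_mul]
  rw [this]
  exact hs0.hasSum

end OneVariableCauchy

/-! ### Exchange of branching and Cauchy weights. -/

section Cauchy

variable {q : ℝ} {n : ℕ}

/-- The coefficient `1 / ((q; q)_{λ_N} ∏ (q; q)_{λ_i - λ_{i+1}})`. -/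
def cauchyCoeff (q : ℝ) (lam : Fin n → ℤ) : ℂ := ∏ i, invQFact q (lam i - nextVal lam 0 i)

theorem cauchyCoeff_ne_zero {lam : Fin n → ℤ} (h : cauchyCoeff q lam ≠ 0) :
    Antitone lam ∧ ∀ i, 0 ≤ lam i := by
  have h1 : ∀ i, nextVal lam 0 i ≤ lam i := fun i => by
    have := (invQFact_eq_zero_or q (lam i - nextVal lam 0 i)).resolve_left
      (Finset.prod_ne_zero_iff.1 h i (Finset.mem_univ i))
    omega
  have := antitone_of_nextVal_le (fun i => le_refl (lam i)) h1
  exact ⟨this.1, this.2.1⟩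

theorem norm_cauchyCoeff_le (hq0 : 0 < q) (hq1 : q < 1) (lam : Fin n → ℤ) :
    ‖cauchyCoeff q lam‖ ≤ invQFactBound q hq0 hq1 ^ n := by
  rw [cauchyCoeff, norm_prod, ← Fin.prod_const]
  exact Finset.prod_le_prod (fun _ _ => norm_nonneg _) fun i _ => norm_invQFact_le hq0 hq1 _

theorem invQFact_mul_qFact (hq0 : 0 < q) (hq1 : q < 1) {k : ℤ} (hk : 0 ≤ k) :
    invQFact q k * qFact q k.toNat = 1 := by
  rw [invQFact_of_nonneg hk, one_div_mul_cancel (qFact_ne_zero hq0 hq1 _)]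

theorem nextVal_le_succ {lam : Fin (n + 1) → ℤ} {nu : Fin n → ℤ} (h : nu ∈ interlacing lam)
    (h0 : 0 ≤ lam (Fin.last n)) (i : Fin n) : nextVal nu 0 i ≤ lam i.succ := by
  rw [mem_interlacing] at h
  cases n with
  | zero => exact i.elim0
  | succ n =>
    induction i using Fin.lastCases with
    | last => simpa using h0
    | cast i => simpa using (h i.succ).2

/-- The two skew weights differ only in which row supplies the gap factorials (q;q); moving the
coefficient from λ to ν exchanges them. The row ν is padded by a zero to the length of λ. -/
theorem cauchyCoeff_mul_branchWeight (hq0 : 0 < q) (hq1 : q < 1) (y : ℂ) (lam : Fin (n + 1) → ℤ)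
    (nu : Fin n → ℤ) : cauchyCoeff q lam * branchWeight q y lam nu =
      cauchyWeight q y lam (Fin.snoc nu 0 : Fin (n + 1) → ℤ) * cauchyCoeff q nu := by
  rw [cauchyWeight, Fin.prod_univ_castSucc, cauchyCoeff, Fin.prod_univ_castSucc, Fin.sum_univ_castSucc
    (fun i => (Fin.snoc nu 0 : Fin (n + 1) → ℤ) i)]
  have hsn : ∀ i : Fin n, (Fin.snoc nu 0 : Fin (n + 1) → ℤ) i.succ = nextVal nu 0 i := fun _ => rfl
  simp only [nextVal_castSucc, nextVal_last, Fin.snoc_last, Fin.snoc_castSucc, sub_zero,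
    hsn, add_zero, Int.toNat_zero, qFact_zero, invQFact_zero, mul_one, one_mul]
  by_cases h0 : 0 ≤ lam (Fin.last n)
  swap
  · rw [invQFact_of_neg (not_le.1 h0)]; ring
  by_cases h : nu ∈ interlacing lam
  · rw [branchWeight, cauchyCoeff]
    have e : ∀ i : Fin n, invQFact q (lam i.castSucc - lam i.succ) *
        (qFact q (lam i.castSucc - lam i.succ).toNat * (invQFact q (lam i.castSucc - nu i) *
          invQFact q (nu i - lam i.succ))) = qFact q (nu i - nextVal nu 0 i).toNat *
        (invQFact q (lam i.castSucc - nu i) * invQFact q (nu i - lam i.succ)) *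
        invQFact q (nu i - nextVal nu 0 i) := fun i => by
      have h1 := mem_interlacing.1 h i
      have h2 := nextVal_le_succ h h0 i
      have h3 := invQFact_mul_qFact hq0 hq1 (k := lam i.castSucc - lam i.succ) (by omega)
      have h4 := invQFact_mul_qFact hq0 hq1 (k := nu i - nextVal nu 0 i) (by omega)
      linear_combination (invQFact q (lam i.castSucc - nu i) * invQFact q (nu i - lam i.succ)) *
        (h3 - h4)
    have E := Finset.prod_congr (rfl : (Finset.univ : Finset (Fin n)) = _) fun i _ => e i
    rw [Finset.prod_mul_distrib, Finset.prod_mul_distrib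
      (f := fun i : Fin n => qFact q (nu i - nextVal nu 0 i).toNat *
        (invQFact q (lam i.castSucc - nu i) * invQFact q (nu i - lam i.succ)))] at E
    linear_combination (invQFact q (lam (Fin.last n)) * y ^ ((∑ i, lam i) - ∑ i, nu i)) * E
  · rw [branchWeight_eq_zero _ h, mul_zero]
    have : ∏ i : Fin n, qFact q (nu i - nextVal nu 0 i).toNat *
        (invQFact q (lam i.castSucc - nu i) * invQFact q (nu i - lam i.succ)) = 0 := by
      rw [mem_interlacing] at h
      push Not at h
      obtain ⟨i, hi⟩ := h
      refine Finset.prod_eq_zero (Finset.mem_univ i) (mul_eq_zero_of_right _ ?_)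
      by_cases h1 : lam i.succ ≤ nu i
      · rw [invQFact_of_neg (by have := hi h1; omega), zero_mul]
      · rw [invQFact_of_neg (k := nu i - lam i.succ) (by omega), mul_zero]
    rw [this]; ring

theorem nextVal_mono {kap nu : Fin n → ℤ} (h : ∀ i, kap i ≤ nu i) (i : Fin n) :
    nextVal kap 0 i ≤ nextVal nu 0 i := by
  cases n with
  | zero => exact i.elim0
  | succ n =>
    induction i using Fin.lastCases with
    | last => simp
    | cast i => simpa using h i.succ

/-- The same exchange when the upper row ends in 0, which lowers the number of variables on the x
side. -/
theorem cauchyCoeff_mul_branchWeight_snoc (hq0 : 0 < q) (hq1 : q < 1) (x : ℂ) (nu kap : Fin n → ℤ) :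
    cauchyCoeff q nu * branchWeight q x (Fin.snoc nu 0 : Fin (n + 1) → ℤ) kap =
      cauchyCoeff q kap * cauchyWeight q x nu kap := by
  rw [branchWeight, cauchyWeight, Fin.sum_univ_castSucc]
  simp only [Fin.snoc_last, Fin.snoc_castSucc, add_zero]
  change _ * (_ * ∏ i, qFact q (nu i - nextVal nu 0 i).toNat *
    (invQFact q (nu i - kap i) * invQFact q (kap i - nextVal nu 0 i))) = _
  rw [cauchyCoeff, cauchyCoeff, mul_left_comm, mul_left_comm (∏ i, _) (x ^ _),
    ← Finset.prod_mul_distrib, ← Finset.prod_mul_distrib]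
  by_cases h : ∀ i, nextVal nu 0 i ≤ kap i ∧ kap i ≤ nu i
  · congr 1
    refine Finset.prod_congr rfl fun i _ => ?_
    have h1 := h i
    have h2 := nextVal_mono (fun i => (h i).2) i
    have h3 := invQFact_mul_qFact hq0 hq1 (k := nu i - nextVal nu 0 i) (by omega)
    have h4 := invQFact_mul_qFact hq0 hq1 (k := kap i - nextVal kap 0 i) (by omega)
    linear_combination (invQFact q (nu i - kap i) * invQFact q (kap i - nextVal nu 0 i)) * (h3 - h4)
  · push Not at h
    obtain ⟨i, hi⟩ := h
    have h0 : invQFact q (nu i - kap i) * invQFact q (kap i - nextVal nu 0 i) = 0 := by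
      by_cases h1 : nextVal nu 0 i ≤ kap i
      · rw [invQFact_of_neg (by have := hi h1; omega), zero_mul]
      · rw [invQFact_of_neg (k := kap i - nextVal nu 0 i) (by omega), mul_zero]
    rw [Finset.prod_eq_zero (Finset.mem_univ i) (by rw [h0, mul_zero, mul_zero]),
      Finset.prod_eq_zero (Finset.mem_univ i) (by rw [h0, mul_zero, mul_zero])]

end Cauchy

/-! ### The Cauchy identity for q-Whittaker functions. -/

section CauchyIdentity

variable {q : ℝ} {n : ℕ}

/-- As |p.2| ≤ |p.1|, one splits τ = √τ · √τ and spends one factor on each index. -/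
theorem summable_of_interlaced_bound {m k : ℕ} {S : (Fin m → ℤ) × (Fin k → ℤ) → ℂ} {K τ : ℝ}
    (hK : 0 ≤ K) (hτ : 0 < τ) (hτ1 : τ < 1) (h : ∀ p, S p ≠ 0 → (∀ i, 0 ≤ p.1 i) ∧ (∀ i, 0 ≤ p.2 i) ∧
      ∑ i, p.2 i ≤ ∑ i, p.1 i ∧ ‖S p‖ ≤ K * τ ^ (∑ i, p.1 i)) : Summable S := by
  have hθ : 0 < √τ := Real.sqrt_pos.2 hτ
  have hθ1 : √τ < 1 := by rw [Real.sqrt_lt' one_pos]; simpa using hτ1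
  have h0 : ∀ {j : ℕ}, Summable fun lam : Fin j → ℤ => ∏ i, geomInt (√τ) (lam i) := fun {j} => by
    simpa using summable_prod_geomInt hθ.le hθ1 (0 : Fin j → ℤ)
  have hn : ∀ {j : ℕ} (lam : Fin j → ℤ), 0 ≤ ∏ i, geomInt (√τ) (lam i) := fun lam =>
    Finset.prod_nonneg fun i _ => geomInt_nonneg hθ.le _
  refine (((h0 (j := m)).mul_of_nonneg (h0 (j := k)) (fun lam => hn lam)
    fun lam => hn lam).mul_left K).of_norm_bounded fun p => ?_
  by_cases hp : S p = 0
  · rw [hp, norm_zero]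
    exact mul_nonneg hK (mul_nonneg (hn _) (hn _))
  obtain ⟨h1, h2, h3, h4⟩ := h p hp
  rw [prod_geomInt_of_nonneg hθ.ne' h1, prod_geomInt_of_nonneg hθ.ne' h2]
  refine h4.trans (mul_le_mul_of_nonneg_left ?_ hK)
  have e : τ ^ (∑ i, p.1 i) = √τ ^ (∑ i, p.1 i) * √τ ^ (∑ i, p.1 i) := by
    rw [← mul_zpow, Real.mul_self_sqrt hτ.le]
  rw [e]
  exact mul_le_mul_of_nonneg_left (zpow_le_zpow_right_of_le_one₀ hθ hθ1.le h3) (by positivity)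

theorem exists_gt_mul_lt_one {r s : ℝ} (hr : 0 < r) (hs : 0 < s) (h : r * s < 1) :
    ∃ ρ σ, r < ρ ∧ s < σ ∧ ρ * σ < 1 := by
  obtain ⟨ρ, h1, h2⟩ := exists_between ((lt_div_iff₀ hs).2 h)
  rw [lt_div_iff₀ hs] at h2
  obtain ⟨σ, h3, h4⟩ := exists_between ((lt_div_iff₀' (hr.trans h1)).2 h2)
  exact ⟨ρ, σ, h1, h3, (lt_div_iff₀' (hr.trans h1)).1 h4⟩

-- Induction on the number of variables. Branching off the last y and summing over λ with the
-- one-variable identity gives ∏ 1/(x_i y_N;q)_∞ and leaves P_{(ν,0)}(x). Branching off the last x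
-- and summing over ν gives the factors with x_N, and the identity in n variables remains.
set_option maxHeartbeats 1000000 in
theorem hasSum_cauchy (hq0 : 0 < q) (hq1 : q < 1) {r s : ℝ} (hr : 0 < r) (hs : 0 < s)
    (hrs : r * s < 1) {x y : Fin n → ℂ} (hx : ∀ i, x i ≠ 0) (hxr : ∀ i, ‖x i‖ ≤ r)
    (hy : ∀ i, y i ≠ 0) (hys : ∀ i, ‖y i‖ ≤ s) :
    HasSum (fun lam => cauchyCoeff q lam * whittakerP q n x lam * whittakerP q n y lam)
      (∏ i, ∏ j, 1 / qPochInf q (x i * y j)) := by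
  induction n with
  | zero =>
    simp [cauchyCoeff, whittakerP]
  | succ n ih =>
    obtain ⟨ρ, σ, hρ, hσ, hρσ⟩ := exists_gt_mul_lt_one hr hs hrs
    have hρ0 := hr.trans hρ
    have hσ0 := hs.trans hσ
    obtain ⟨C₁, hC₁, hP₁⟩ := exists_norm_whittakerP_le hq0 hq1 (n + 1) hr hρ
    obtain ⟨C₂, hC₂, hP₂⟩ := exists_norm_whittakerP_le hq0 hq1 n hs hσ
    obtain ⟨C₃, hC₃, hP₃⟩ := exists_norm_whittakerP_le hq0 hq1 n hr hρ
    have hB := one_le_invQFactBound hq0 hq1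
    set B := invQFactBound q hq0 hq1 with hBd
    set x' : Fin n → ℂ := fun i => x i.castSucc with hx'
    set y' : Fin n → ℂ := fun i => y i.castSucc with hy'
    set xl := x (Fin.last n) with hxl
    set yl := y (Fin.last n) with hyl
    -- S and T are the double families of the two stages. Their absolute summability permits summing
    -- in either order.
    set S : (Fin (n + 1) → ℤ) × (Fin n → ℤ) → ℂ := fun p =>
      cauchyCoeff q p.1 * whittakerP q (n + 1) x p.1 *
        (branchWeight q yl p.1 p.2 * whittakerP q n y' p.2) with hS
    set T : (Fin n → ℤ) × (Fin n → ℤ) → ℂ := fun p =>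
      whittakerP q n y' p.1 * (cauchyCoeff q p.2 * cauchyWeight q xl p.1 p.2 *
        whittakerP q n x' p.2) with hT
    have hSs : Summable S := by
      refine summable_of_interlaced_bound (K := B ^ (n + 1) * C₁ * ((B ^ 2) ^ n * C₂))
        (by positivity) (by positivity) hρσ fun p hp => ?_
      have h1 := (cauchyCoeff_ne_zero (left_ne_zero_of_mul (left_ne_zero_of_mul hp))).2
      have h2 : p.2 ∈ interlacing p.1 := by
        by_contra h
        exact left_ne_zero_of_mul (right_ne_zero_of_mul hp) (branchWeight_eq_zero _ h)
      have h3 := mem_interlacing.1 h2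
      have h4 : ∀ i, 0 ≤ p.2 i := fun i => (h1 _).trans (h3 i).1
      have h5 : 0 ≤ (∑ i, p.1 i) - ∑ i, p.2 i := by
        rw [sum_sub_sum_eq]
        exact add_nonneg (Finset.sum_nonneg fun i _ => sub_nonneg.2 (h3 i).2) (h1 _)
      refine ⟨h1, h4, sub_nonneg.1 h5, ?_⟩
      have e : (ρ * σ) ^ (∑ i, p.1 i) = ρ ^ (∑ i, p.1 i) *
          (σ ^ ((∑ i, p.1 i) - ∑ i, p.2 i) * σ ^ (∑ i, p.2 i)) := by
        rw [← zpow_add₀ hσ0.ne', sub_add_cancel, mul_zpow]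
      rw [hS, norm_mul, norm_mul, norm_mul, e]
      calc _ ≤ (B ^ (n + 1) * (C₁ * ρ ^ (∑ i, p.1 i))) * (((B ^ 2) ^ n *
            σ ^ ((∑ i, p.1 i) - ∑ i, p.2 i)) * (C₂ * σ ^ (∑ i, p.2 i))) := by
            refine mul_le_mul (mul_le_mul (norm_cauchyCoeff_le hq0 hq1 _) (hP₁ x hxr _ h1)
              (norm_nonneg _) (by positivity)) (mul_le_mul
              ((norm_branchWeight_le hq0 hq1 _ _ _).trans ?_)
              (hP₂ y' (fun i => hys _) _ h4) (norm_nonneg _) (by positivity))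
              (by positivity) (by positivity)
            exact mul_le_mul_of_nonneg_left (norm_zpow_le_zpow ((hys _).trans hσ.le) h5)
              (by positivity)
        _ = _ := by ring
    have hTs : Summable T := by
      refine summable_of_interlaced_bound (K := C₂ * (B ^ n * (B ^ 2) ^ n * C₃))
        (by positivity) (by positivity) hρσ fun p hp => ?_
      have hp2 := left_ne_zero_of_mul (right_ne_zero_of_mul hp)
      have h1 := (cauchyCoeff_ne_zero (left_ne_zero_of_mul hp2)).2
      have h3 := fun i => (cauchyWeight_ne_zero (right_ne_zero_of_mul hp2) i).1
      have h4 : ∀ i, 0 ≤ p.1 i := fun i => (h1 i).trans (h3 i)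
      have h5 : ∑ i, p.2 i ≤ ∑ i, p.1 i := Finset.sum_le_sum fun i _ => h3 i
      refine ⟨h4, h1, h5, ?_⟩
      have e : (ρ * σ) ^ (∑ i, p.1 i) = σ ^ (∑ i, p.1 i) *
          (ρ ^ ((∑ i, p.1 i) - ∑ i, p.2 i) * ρ ^ (∑ i, p.2 i)) := by
        rw [← zpow_add₀ hρ0.ne', sub_add_cancel, mul_zpow, mul_comm]
      have hw : ‖cauchyWeight q xl p.1 p.2‖ ≤
          ρ ^ ((∑ i, p.1 i) - ∑ i, p.2 i) * (B ^ 2) ^ n := by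
        rw [cauchyWeight, norm_mul]
        refine mul_le_mul (norm_zpow_le_zpow ((hxr _).trans hρ.le) (sub_nonneg.2 h5)) ?_
          (norm_nonneg _) (by positivity)
        rw [norm_prod, ← Fin.prod_const]
        exact Finset.prod_le_prod (fun _ _ => norm_nonneg _) fun i _ =>
          norm_branch_factor_le hq0 hq1 _ _ _
      rw [hT, norm_mul, norm_mul, norm_mul, e]
      calc _ ≤ (C₂ * σ ^ (∑ i, p.1 i)) * ((B ^ n * (ρ ^ ((∑ i, p.1 i) - ∑ i, p.2 i) *
            (B ^ 2) ^ n)) * (C₃ * ρ ^ (∑ i, p.2 i))) := by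
            refine mul_le_mul (hP₂ y' (fun i => hys _) _ h4) (mul_le_mul (mul_le_mul
              (norm_cauchyCoeff_le hq0 hq1 _) hw (norm_nonneg _) (by positivity))
              (hP₃ x' (fun i => hxr _) _ h1) (norm_nonneg _) (by positivity)) (by positivity)
              (by positivity)
        _ = _ := by ring
    have hyl0 : ‖yl‖ * r < 1 := by
      rw [mul_comm]; exact (mul_le_mul_of_nonneg_left (hys _) hr.le).trans_lt hrs
    have hxl0 : ‖xl‖ * s < 1 := (mul_le_mul_of_nonneg_right (hxr _) hs.le).trans_lt hrs
    have hS1 : HasSum (fun lam => cauchyCoeff q lam * whittakerP q (n + 1) x lam *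
        whittakerP q (n + 1) y lam) (∑' p, S p) :=
      hSs.hasSum.prod_fiberwise fun lam => ((hasSum_whittakerP (q := q) y lam).mul_left
        (cauchyCoeff q lam * whittakerP q (n + 1) x lam)).congr_fun fun nu => by simp only [hS, hyl, hy']
    have hS2 : HasSum (fun nu => cauchyCoeff q nu * whittakerP q n y' nu *
        (whittakerP q (n + 1) x (Fin.snoc nu 0 : Fin (n + 1) → ℤ) *
          ∏ i, 1 / qPochInf q (x i * yl))) (∑' p, S p) := by
      have hsw : HasSum (fun p : (Fin n → ℤ) × (Fin (n + 1) → ℤ) => S (p.2, p.1)) (∑' p, S p) :=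
        (Equiv.hasSum_iff (Equiv.prodComm (Fin n → ℤ) (Fin (n + 1) → ℤ))).2 hSs.hasSum
      refine hsw.prod_fiberwise fun nu => ?_
      -- The one-variable identity needs a nonnegative row; for any other ν the coefficient
      -- vanishes.
      by_cases hnu : cauchyCoeff q nu = 0
      · simp only [hnu, zero_mul]
        refine hasSum_zero.congr_fun fun lam => ?_
        simp only [hS]
        have := cauchyCoeff_mul_branchWeight hq0 hq1 yl lam nu
        rw [hnu, mul_zero] at this
        linear_combination (whittakerP q (n + 1) x lam * whittakerP q n y' nu) * this
      have hnu0 : ∀ i, 0 ≤ (Fin.snoc nu 0 : Fin (n + 1) → ℤ) i := fun i => by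
        induction i using Fin.lastCases with
        | last => simp
        | cast i => simpa using (cauchyCoeff_ne_zero hnu).2 i
      have h1 := (hasSum_cauchyWeight_mul_whittakerP hq0 hq1 hx hr hxr (hy (Fin.last n)) hyl0
        hnu0).mul_left (cauchyCoeff q nu * whittakerP q n y' nu)
      refine h1.congr_fun fun lam => ?_
      simp only [hS]
      have := cauchyCoeff_mul_branchWeight hq0 hq1 yl lam nu
      linear_combination (whittakerP q (n + 1) x lam * whittakerP q n y' nu) * this
    have hT1 : HasSum (fun nu => cauchyCoeff q nu * whittakerP q n y' nu *
        whittakerP q (n + 1) x (Fin.snoc nu 0 : Fin (n + 1) → ℤ)) (∑' p, T p) := by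
      refine hTs.hasSum.prod_fiberwise fun nu => ?_
      refine ((hasSum_whittakerP x (Fin.snoc nu 0 : Fin (n + 1) → ℤ)).mul_left
        (cauchyCoeff q nu * whittakerP q n y' nu)).congr_fun fun kap => ?_
      have := cauchyCoeff_mul_branchWeight_snoc hq0 hq1 xl nu kap
      simp only [hT]
      linear_combination (-whittakerP q n y' nu * whittakerP q n x' kap) * this
    have hT2 : HasSum (fun kap => cauchyCoeff q kap * whittakerP q n x' kap *
        (whittakerP q n y' kap * ∏ j, 1 / qPochInf q (y' j * xl))) (∑' p, T p) := by
      have hsw : HasSum (fun p : (Fin n → ℤ) × (Fin n → ℤ) => T (p.2, p.1)) (∑' p, T p) :=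
        (Equiv.hasSum_iff (Equiv.prodComm (Fin n → ℤ) (Fin n → ℤ))).2 hTs.hasSum
      refine hsw.prod_fiberwise fun kap => ?_
      by_cases hk : cauchyCoeff q kap = 0
      · simp only [hk, zero_mul]
        refine hasSum_zero.congr_fun fun nu => ?_
        simp [hT, hk]
      have h1 := (hasSum_cauchyWeight_mul_whittakerP hq0 hq1 (fun i => hy i.castSucc) hs
        (fun i => hys i.castSucc) (hx (Fin.last n)) hxl0 (cauchyCoeff_ne_zero hk).2).mul_left
        (cauchyCoeff q kap * whittakerP q n x' kap)
      refine h1.congr_fun fun nu => ?_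
      simp only [hT]
      ring
    have hIH := (ih (x := x') (y := y') (fun i => hx _) (fun i => hxr _) (fun i => hy _)
      fun i => hys _).mul_right (∏ j, 1 / qPochInf q (y' j * xl))
    have hTv : ∑' p, T p = (∏ i, ∏ j, 1 / qPochInf q (x' i * y' j)) *
        ∏ j, 1 / qPochInf q (y' j * xl) := by
      refine hT2.unique ?_
      simp only [← mul_assoc]
      exact hIH
    have hSv : ∑' p, S p = (∑' p, T p) * ∏ i, 1 / qPochInf q (x i * yl) := by
      have h := hT1.mul_right (∏ i, 1 / qPochInf q (x i * yl))
      refine hS2.unique ?_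
      simp only [← mul_assoc]
      exact h
    rw [hSv, hTv] at hS1
    have hfin : (∏ i, ∏ j, 1 / qPochInf q (x i * y j)) =
        (∏ i, ∏ j, 1 / qPochInf q (x' i * y' j)) * (∏ j, 1 / qPochInf q (y' j * xl)) *
          ∏ i, 1 / qPochInf q (x i * yl) := by
      have e : ∀ i, ∏ j, 1 / qPochInf q (x i * y j) =
          (∏ j : Fin n, 1 / qPochInf q (x i * y' j)) * (1 / qPochInf q (x i * yl)) := fun i =>
        Fin.prod_univ_castSucc _
      simp only [e]
      rw [Finset.prod_mul_distrib, Fin.prod_univ_castSucc]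
      simp only [mul_comm _ xl]
      rfl
    rw [hfin]
    exact hS1

end CauchyIdentity

/-! ### Splitting a signature into a partition and a shift. -/

section Laplace

variable {q : ℝ} {n : ℕ}

theorem branchWeight_add_const {x : ℂ} (hx : x ≠ 0) (lam : Fin (n + 1) → ℤ) (mu : Fin n → ℤ)
    (m : ℤ) : branchWeight q x (fun i => lam i + m) (fun i => mu i + m) =
      x ^ m * branchWeight q x lam mu := by
  rw [branchWeight, branchWeight, ← mul_assoc, ← zpow_add₀ hx, Finset.sum_add_distrib,
    Finset.sum_add_distrib]
  simp only [Finset.sum_const, Finset.card_univ, Fintype.card_fin, add_sub_add_right_eq_sub,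
    nsmul_eq_mul]
  congr 2
  push_cast
  ring

theorem whittakerP_add_const {x : Fin n → ℂ} (hx : ∀ i, x i ≠ 0) (lam : Fin n → ℤ) (m : ℤ) :
    whittakerP q n x (fun i => lam i + m) = (∏ i, x i) ^ m * whittakerP q n x lam := by
  induction n with
  | zero => simp [whittakerP]
  | succ n ih =>
    have h1 := (Equiv.hasSum_iff (Equiv.addRight fun _ : Fin n => m)).2
      (hasSum_whittakerP (q := q) x fun i => lam i + m)
    have h2 := (hasSum_whittakerP (q := q) x lam).mul_left ((∏ i, x i) ^ m)
    refine h1.unique (h2.congr_fun fun mu => ?_)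
    simp only [Function.comp_apply]
    rw [show (Equiv.addRight fun _ : Fin n => m) mu = fun i => mu i + m from rfl, ih fun i => hx _,
      branchWeight_add_const (hx _), Fin.prod_univ_castSucc, mul_zpow]
    ring

/-- A signature as a partition with last part zero and a shift. -/
def shiftEquiv (n : ℕ) : (Fin n → ℤ) × ℤ ≃ (Fin (n + 1) → ℤ) where
  toFun p i := (Fin.snoc p.1 0 : Fin (n + 1) → ℤ) i + p.2
  invFun lam := (fun i => lam i.castSucc - lam (Fin.last n), lam (Fin.last n))
  left_inv p := by ext <;> simp
  right_inv lam := by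
    ext i
    induction i using Fin.lastCases with
    | last => simp
    | cast i => simp

/-- The coefficient `1 / ∏ (q; q)_{λ_i - λ_{i+1}}`. -/
def gapCoeff (q : ℝ) (lam : Fin (n + 1) → ℤ) : ℂ :=
  ∏ i : Fin n, invQFact q (lam i.castSucc - lam i.succ)

theorem gapCoeff_shift (p : (Fin n → ℤ) × ℤ) :
    gapCoeff q (shiftEquiv n p) = cauchyCoeff q p.1 := by
  refine Finset.prod_congr rfl fun i _ => ?_
  simp [shiftEquiv, nextVal]

/-- The gaps do not see the shift m; it enters only through 1/(q;q)_m. -/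
theorem cauchyCoeff_shift (p : (Fin n → ℤ) × ℤ) :
    cauchyCoeff q (shiftEquiv n p) = cauchyCoeff q p.1 * invQFact q p.2 := by
  rw [← gapCoeff_shift, cauchyCoeff, Fin.prod_univ_castSucc, gapCoeff]
  simp [shiftEquiv]

theorem whittakerP_shift {x : Fin (n + 1) → ℂ} (hx : ∀ i, x i ≠ 0) (p : (Fin n → ℤ) × ℤ) :
    whittakerP q (n + 1) x (shiftEquiv n p) =
      (∏ i, x i) ^ p.2 * whittakerP q (n + 1) x (Fin.snoc p.1 0 : Fin (n + 1) → ℤ) :=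
  whittakerP_add_const hx _ _

theorem exists_norm_reduced_le (hq0 : 0 < q) (hq1 : q < 1) {r s : ℝ} (hr : 0 < r) (hs : 0 < s)
    (hrs : r * s < 1) : ∃ B : (Fin n → ℤ) → ℝ, Summable B ∧ (∀ k, 0 ≤ B k) ∧
      ∀ x y : Fin (n + 1) → ℂ, (∀ i, ‖x i‖ ≤ r) → (∀ i, ‖y i‖ ≤ s) → ∀ kap : Fin n → ℤ,
        ‖cauchyCoeff q kap * whittakerP q (n + 1) x (Fin.snoc kap 0 : Fin (n + 1) → ℤ) *
          whittakerP q (n + 1) y (Fin.snoc kap 0 : Fin (n + 1) → ℤ)‖ ≤ B kap := by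
  obtain ⟨ρ, σ, hρ, hσ, hρσ⟩ := exists_gt_mul_lt_one hr hs hrs
  have hρ0 := hr.trans hρ
  have hσ0 := hs.trans hσ
  obtain ⟨C₁, hC₁, hP₁⟩ := exists_norm_whittakerP_le hq0 hq1 (n + 1) hr hρ
  obtain ⟨C₂, hC₂, hP₂⟩ := exists_norm_whittakerP_le hq0 hq1 (n + 1) hs hσ
  have hB := one_le_invQFactBound hq0 hq1
  set b := invQFactBound q hq0 hq1
  have hs0 : Summable fun lam : Fin n → ℤ => ∏ i, geomInt (ρ * σ) (lam i) := by
    simpa using summable_prod_geomInt (by positivity) hρσ (0 : Fin n → ℤ)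
  have hn : ∀ lam : Fin n → ℤ, 0 ≤ ∏ i, geomInt (ρ * σ) (lam i) := fun lam =>
    Finset.prod_nonneg fun i _ => geomInt_nonneg (by positivity) _
  refine ⟨fun kap => (b ^ n * C₁ * C₂) * ∏ i, geomInt (ρ * σ) (kap i), hs0.mul_left _,
    fun kap => mul_nonneg (by positivity) (hn _), fun x y hx hy kap => ?_⟩
  by_cases h : cauchyCoeff q kap = 0
  · rw [h, zero_mul, zero_mul, norm_zero]
    exact mul_nonneg (by positivity) (hn _)
  have h0 := (cauchyCoeff_ne_zero h).2
  have h0' : ∀ i, 0 ≤ (Fin.snoc kap 0 : Fin (n + 1) → ℤ) i := fun i => by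
    induction i using Fin.lastCases with
    | last => simp
    | cast i => simpa using h0 i
  have hsum : ∑ i, (Fin.snoc kap 0 : Fin (n + 1) → ℤ) i = ∑ i, kap i := by
    rw [Fin.sum_univ_castSucc]; simp
  have h1 := hP₁ x hx _ h0'
  have h2 := hP₂ y hy _ h0'
  rw [hsum] at h1 h2
  beta_reduce
  rw [prod_geomInt_of_nonneg (by positivity) h0, norm_mul, norm_mul]
  calc _ ≤ (b ^ n * (C₁ * ρ ^ (∑ i, kap i))) * (C₂ * σ ^ (∑ i, kap i)) :=
        mul_le_mul (mul_le_mul (norm_cauchyCoeff_le hq0 hq1 _) h1 (norm_nonneg _) (by positivity))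
          h2 (norm_nonneg _) (by positivity)
    _ = _ := by rw [mul_zpow]; ring

/-- Euler's series as a bilateral sum: the Cauchy-identity counterpart of Ramanujan's sum over the
shift. -/
theorem hasSum_int_inv_qPochInf (hq0 : 0 < q) (hq1 : q < 1) {X : ℂ} (hX : ‖X‖ < 1) :
    HasSum (fun m : ℤ => X ^ m * invQFact q m) (1 / qPochInf q X) := by
  refine (Function.Injective.hasSum_iff Nat.cast_injective (g := ((↑) : ℕ → ℤ)) fun k hk => ?_).1 ?_
  · rw [invQFact_of_neg, mul_zero]
    by_contra h
    exact hk ⟨k.toNat, Int.toNat_of_nonneg (not_lt.1 h)⟩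
  · refine (hasSum_inv_qPochInf hq0 hq1 hX).congr_fun fun k => ?_
    simp [mul_comm]

end Laplace

/-! ### The q-Laplace transform of the Cauchy kernel. -/

section LaplaceSum

variable {q : ℝ} {n : ℕ} {ζ : ℂ}

/-- The summand of the `q`-Laplace transform of the kernel `∑_λ P_λ(x) P_λ(y) / ∏ (q; q)`. -/
def laplaceTerm (q : ℝ) (ζ : ℂ) (x y : Fin (n + 1) → ℂ) (lam : Fin (n + 1) → ℤ) : ℂ :=
  gapCoeff q lam * whittakerP q (n + 1) x lam * whittakerP q (n + 1) y lam *
    (1 / qPochInf q (ζ * (q : ℂ) ^ lam (Fin.last n)))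

theorem laplaceTerm_shift {x y : Fin (n + 1) → ℂ} (hx : ∀ i, x i ≠ 0) (hy : ∀ i, y i ≠ 0)
    (p : (Fin n → ℤ) × ℤ) : laplaceTerm q ζ x y (shiftEquiv n p) =
      (cauchyCoeff q p.1 * whittakerP q (n + 1) x (Fin.snoc p.1 0 : Fin (n + 1) → ℤ) *
        whittakerP q (n + 1) y (Fin.snoc p.1 0 : Fin (n + 1) → ℤ)) *
      (((∏ i, x i) * ∏ i, y i) ^ p.2 * (1 / qPochInf q (ζ * (q : ℂ) ^ p.2))) := by
  have e : shiftEquiv n p (Fin.last n) = p.2 := by simp [shiftEquiv]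
  rw [laplaceTerm, gapCoeff_shift, whittakerP_shift hx, whittakerP_shift hy, e, mul_zpow]
  ring

theorem norm_prod_mul_prod_lt_one {r s : ℝ} (hr : 0 < r) (hrs : r * s < 1)
    {x y : Fin (n + 1) → ℂ} (hx : ∀ i, ‖x i‖ ≤ r) (hy : ∀ i, ‖y i‖ ≤ s) :
    ‖(∏ i, x i) * ∏ i, y i‖ < 1 := by
  have hs : 0 ≤ s := (norm_nonneg _).trans (hy 0)
  rw [← Finset.prod_mul_distrib, norm_prod]
  calc _ ≤ ∏ _i : Fin (n + 1), r * s := Finset.prod_le_prod (fun _ _ => norm_nonneg _) fun i _ => by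
        rw [norm_mul]; exact mul_le_mul (hx i) (hy i) (norm_nonneg _) hr.le
    _ = (r * s) ^ (n + 1) := Fin.prod_const _ _
    _ < 1 := pow_lt_one₀ (by positivity) hrs (by omega)

/-- For any weight h on the last part, the sum over λ is (Σ_κ A κ)(Σ_m X^m h(m)). With h(m) =
1/(q;q)_m the Cauchy identity yields Σ A = (X;q)_∞ ∏ 1/(x_i y_j;q)_∞; with h(m) = 1/(ζq^m;q)_∞
Ramanujan's sum finishes. -/
theorem hasSum_laplaceTerm (hq0 : 0 < q) (hq1 : q < 1) (hζ0 : ζ ≠ 0)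
    (hζq : ∀ m : ℤ, (q : ℂ) ^ m * ζ ≠ 1) {r s : ℝ} (hr : 0 < r) (hs : 0 < s) (hrs : r * s < 1)
    {x y : Fin (n + 1) → ℂ} (hx : ∀ i, x i ≠ 0) (hxr : ∀ i, ‖x i‖ ≤ r)
    (hy : ∀ i, y i ≠ 0) (hys : ∀ i, ‖y i‖ ≤ s) :
    HasSum (laplaceTerm q ζ x y) (qPochInf q q * qTheta q (ζ * ((∏ i, x i) * ∏ i, y i)) / qTheta q ζ *
      ∏ i, ∏ j, 1 / qPochInf q (x i * y j)) := by
  set X := (∏ i, x i) * ∏ i, y i with hX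
  have hX1 : ‖X‖ < 1 := norm_prod_mul_prod_lt_one hr hrs hxr hys
  have hX0 : X ≠ 0 := mul_ne_zero (Finset.prod_ne_zero_iff.2 fun i _ => hx i)
    (Finset.prod_ne_zero_iff.2 fun i _ => hy i)
  obtain ⟨B, hB, hB0, hBle⟩ := exists_norm_reduced_le (n := n) hq0 hq1 hr hs hrs
  set A : (Fin n → ℤ) → ℂ := fun kap => cauchyCoeff q kap *
    whittakerP q (n + 1) x (Fin.snoc kap 0 : Fin (n + 1) → ℤ) *
    whittakerP q (n + 1) y (Fin.snoc kap 0 : Fin (n + 1) → ℤ) with hA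
  have hAn : Summable fun kap => ‖A kap‖ :=
    Summable.of_nonneg_of_le (fun _ => norm_nonneg _) (fun kap => hBle x y hxr hys kap) hB
  have hAs : HasSum A (∑' kap, A kap) := hAn.of_norm.hasSum
  have key : ∀ (h : ℤ → ℂ) (c : ℂ), HasSum h c →
      HasSum (fun p : (Fin n → ℤ) × ℤ => A p.1 * h p.2) ((∑' kap, A kap) * c) := fun h c hh =>
    hAs.mul hh (summable_mul_of_summable_norm hAn hh.summable.norm)
  have hC := hasSum_cauchy hq0 hq1 hr hs hrs hx hxr hy hys
  have h1 := key _ _ (hasSum_int_inv_qPochInf hq0 hq1 hX1)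
  have h2 := ((Equiv.hasSum_iff (shiftEquiv n)).2 hC).unique (h1.congr_fun fun p => by
    simp only [Function.comp_apply]
    rw [cauchyCoeff_shift, whittakerP_shift hx, whittakerP_shift hy, hX, mul_zpow]
    ring)
  have hXq : qPochInf q X ≠ 0 := qPochInf_ne_zero_of_norm_lt_one hq0 hq1 hX1
  have h3 := key _ _ (hasSum_ramanujan hq0 hq1 hζ0 hζq hX0 hX1)
  refine (Equiv.hasSum_iff (shiftEquiv n)).1 ?_
  have e : qPochInf q q * qTheta q (ζ * X) / qTheta q ζ * ∏ i, ∏ j, 1 / qPochInf q (x i * y j) =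
      (∑' kap, A kap) * (qPochInf q q * qTheta q (ζ * X) / (qTheta q ζ * qPochInf q X)) := by
    rw [h2, ← div_div]
    ring
  rw [e]
  exact h3.congr_fun fun p => laplaceTerm_shift hx hy p

/-- On a torus |X| is a constant ξ, so Ramanujan's series at ξ is a majorant for the shift,
uniformly in x and y. -/
theorem exists_norm_laplaceTerm_le (hq0 : 0 < q) (hq1 : q < 1) (hζ0 : ζ ≠ 0)
    (hζq : ∀ m : ℤ, (q : ℂ) ^ m * ζ ≠ 1) {r s ξ : ℝ} (hr : 0 < r) (hs : 0 < s) (hrs : r * s < 1)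
    (hξ0 : 0 < ξ) (hξ : ξ < 1) : ∃ B : (Fin (n + 1) → ℤ) → ℝ, Summable B ∧
      ∀ x y : Fin (n + 1) → ℂ, (∀ i, x i ≠ 0) → (∀ i, ‖x i‖ ≤ r) → (∀ i, y i ≠ 0) →
        (∀ i, ‖y i‖ ≤ s) → ‖(∏ i, x i) * ∏ i, y i‖ = ξ → ∀ lam, ‖laplaceTerm q ζ x y lam‖ ≤ B lam := by
  obtain ⟨B, hB, hB0, hBle⟩ := exists_norm_reduced_le (n := n) hq0 hq1 hr hs hrs
  have hR := (hasSum_ramanujan hq0 hq1 hζ0 hζq (X := (ξ : ℂ)) (by exact_mod_cast hξ0.ne')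
    (by rw [Complex.norm_real, Real.norm_eq_abs, abs_of_pos hξ0]; exact hξ)).summable.norm
  have h1 := hB.mul_of_nonneg hR (fun k => hB0 k) fun _ => norm_nonneg _
  refine ⟨_, (Equiv.summable_iff (shiftEquiv n).symm).2 h1, fun x y hx hxr hy hys hX lam => ?_⟩
  obtain ⟨p, rfl⟩ := (shiftEquiv n).surjective lam
  rw [laplaceTerm_shift hx hy, norm_mul]
  simp only [Function.comp_apply, Equiv.symm_apply_apply]
  refine mul_le_mul (hBle x y hxr hys _) (le_of_eq ?_) (norm_nonneg _) (hB0 _)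
  rw [norm_mul, norm_mul, norm_zpow, norm_zpow, hX, Complex.norm_real, Real.norm_eq_abs,
    abs_of_pos hξ0]

theorem hasSum_laplaceTerm_inv (hq0 : 0 < q) (hq1 : q < 1) (hζ0 : ζ ≠ 0)
    (hζq : ∀ m : ℤ, (q : ℂ) ^ m * ζ ≠ 1) {r s : ℝ} (hr : 0 < r) (hs : 0 < s) (hrs : r * s < 1)
    {x z : Fin (n + 1) → ℂ} (hx : ∀ i, x i ≠ 0) (hxr : ∀ i, ‖x i‖ ≤ r)
    (hz : ∀ i, z i ≠ 0) (hzs : ∀ i, ‖1 / z i‖ ≤ s) :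
    HasSum (fun lam => qPochInf q q ^ n * laplaceTerm q ζ x (fun i => 1 / z i) lam)
      (laplaceKernel q ζ x z) := by
  have h := (hasSum_laplaceTerm hq0 hq1 hζ0 hζq hr hs hrs hx hxr
    (fun i => one_div_ne_zero (hz i)) hzs).mul_left (qPochInf q q ^ n)
  convert h using 1
  · rfl
  rw [laplaceKernel, Finset.prod_comm, ← Finset.prod_mul_distrib]
  simp only [mul_one_div]
  ring

theorem prefactor_eq (hq0 : 0 < q) (hq1 : q < 1) (lam : Fin (n + 1) → ℤ) :
    ∏ i : Fin n, qPochInf q ((q : ℂ) ^ (lam i.castSucc - lam i.succ + 1)) =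
      qPochInf q q ^ n * gapCoeff q lam := by
  simp only [qPochInf_zpow_add_one hq0 hq1, Finset.prod_mul_distrib, gapCoeff, Fin.prod_const]

end LaplaceSum

/-! ### Torus integrals and change of radius. -/

section Torus

variable {n : ℕ}

/-- The torus integral with the integral over a chosen circle innermost. -/
theorem torusIntegral_succAbove_symm {f : (Fin (n + 1) → ℂ) → ℂ} {c : Fin (n + 1) → ℂ}
    {R : Fin (n + 1) → ℝ} (hf : TorusIntegrable f c R) (i : Fin (n + 1)) :
    torusIntegral f c R = torusIntegral (fun y => circleIntegral (fun x => f (i.insertNth x y)) (c i)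
      (R i)) (c ∘ i.succAbove) (R ∘ i.succAbove) := by
  set e : ℝ × (Fin n → ℝ) ≃ᵐ (Fin (n + 1) → ℝ) :=
    (MeasurableEquiv.piFinSuccAbove (fun _ => ℝ) i).symm
  have hem : MeasurePreserving e :=
    (volume_preserving_piFinSuccAbove (fun _ : Fin (n + 1) => ℝ) i).symm _
  have heπ : (e ⁻¹' Set.Icc 0 fun _ => 2 * π) =
      Set.Icc 0 (2 * π) ×ˢ Set.Icc (0 : Fin n → ℝ) fun _ => 2 * π :=
    ((Fin.insertNthOrderIso (fun _ => ℝ) i).preimage_Icc _ _).trans (Set.Icc_prod_eq _ _)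
  have hint := hf.function_integrable
  rw [← hem.integrableOn_comp_preimage e.measurableEmbedding, heπ] at hint
  rw [torusIntegral, ← hem.map_eq, setIntegral_map_equiv, heπ, Measure.volume_eq_prod,
    ← setIntegral_prod_swap, setIntegral_prod, torusIntegral]
  · refine setIntegral_congr_fun measurableSet_Icc fun Θ _ => ?_
    simp +unfoldPartialApp only [e, circleIntegral_def_Icc, ← integral_smul,
      deriv_circleMap, i.prod_univ_succAbove _, smul_smul, torusMap, circleMap_zero]
    refine setIntegral_congr_fun measurableSet_Icc fun θ _ => ?_
    simp only [MeasurableEquiv.piFinSuccAbove_symm_apply, i.insertNth_apply_same,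
      i.insertNth_apply_succAbove, (· ∘ ·), Fin.insertNthEquiv, Equiv.coe_fn_mk, Prod.swap]
    rw [mul_comm]
    congr 2
    simp only [funext_iff, i.forall_iff_succAbove, circleMap, Fin.insertNth_apply_same,
      Fin.insertNth_apply_succAbove, imp_true_iff, and_self_iff]
  · exact hint.swap

/-- The closed polyannulus. -/
def polyannulus (n : ℕ) (r R : ℝ) : Set (Fin n → ℂ) := {z | ∀ i, r ≤ ‖z i‖ ∧ ‖z i‖ ≤ R}

theorem norm_torusMap_zero {ρ : Fin n → ℝ} (hρ : ∀ i, 0 ≤ ρ i) (θ : Fin n → ℝ) (i : Fin n) :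
    ‖torusMap 0 ρ θ i‖ = ρ i := by
  rw [torusMap, Pi.zero_apply, zero_add, norm_mul, Complex.norm_exp_ofReal_mul_I, mul_one,
    Complex.norm_real, Real.norm_eq_abs, abs_of_nonneg (hρ i)]

theorem continuous_torusMap (c : Fin n → ℂ) (ρ : Fin n → ℝ) : Continuous (torusMap c ρ) := by
  unfold torusMap; fun_prop

theorem torusIntegrable_of_continuousOn {f : (Fin n → ℂ) → ℂ} {r R : ℝ} (hr : 0 ≤ r)
    (hc : ContinuousOn f (polyannulus n r R)) {ρ : Fin n → ℝ} (hρ : ∀ i, r ≤ ρ i ∧ ρ i ≤ R) :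
    TorusIntegrable f 0 ρ := by
  refine ContinuousOn.integrableOn_compact isCompact_Icc ?_
  refine hc.comp (continuous_torusMap 0 ρ).continuousOn fun θ _ i => ?_
  rw [norm_torusMap_zero fun i => hr.trans (hρ i).1]
  exact hρ i

/-- Integrate over the i-th circle innermost; the integrand is holomorphic in that variable on the
annulus, so Cauchy's theorem applies. -/
theorem torusIntegral_update_radius {f : (Fin n → ℂ) → ℂ} {r R : ℝ} (hr : 0 < r) (hrR : r ≤ R)
    (hc : ContinuousOn f (polyannulus n r R))
    (hd : ∀ z ∈ polyannulus n r R, ∀ i, DifferentiableAt ℂ (fun w => f (Function.update z i w)) (z i))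
    {ρ : Fin n → ℝ} (hρ : ∀ i, r ≤ ρ i ∧ ρ i ≤ R) (i : Fin n) :
    torusIntegral f 0 (Function.update ρ i R) = torusIntegral f 0 (Function.update ρ i r) := by
  cases n with
  | zero => exact i.elim0
  | succ n =>
    have hu : ∀ a, r ≤ a → a ≤ R → ∀ j, r ≤ Function.update ρ i a j ∧ Function.update ρ i a j ≤ R :=
      fun a h1 h2 j => by
        rcases eq_or_ne j i with rfl | h
        · simp [h1, h2]
        · simpa [h] using hρ j
    have hcomp : ∀ a, Function.update ρ i a ∘ i.succAbove = ρ ∘ i.succAbove := fun a => by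
      ext j; simp
    rw [torusIntegral_succAbove_symm (torusIntegrable_of_continuousOn hr.le hc (hu R hrR le_rfl)) i,
      torusIntegral_succAbove_symm (torusIntegrable_of_continuousOn hr.le hc (hu r le_rfl hrR)) i,
      hcomp, hcomp, Function.update_self, Function.update_self]
    refine setIntegral_congr_fun measurableSet_Icc fun θ _ => ?_
    simp only
    congr 1
    set y := torusMap ((0 : Fin (n + 1) → ℂ) ∘ i.succAbove) (ρ ∘ i.succAbove) θ with hy
    have hyn : ∀ j, ‖y j‖ = ρ (i.succAbove j) := fun j =>
      norm_torusMap_zero (fun j => hr.le.trans (hρ _).1) θ j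
    have hmem : ∀ x : ℂ, r ≤ ‖x‖ → ‖x‖ ≤ R →
        (i.insertNth x y : Fin (n + 1) → ℂ) ∈ polyannulus (n + 1) r R := fun x h1 h2 j => by
      induction j using i.succAboveCases with
      | x => simpa using ⟨h1, h2⟩
      | p j => rw [Fin.insertNth_apply_succAbove, hyn]; exact hρ _
    refine Complex.circleIntegral_eq_of_differentiable_on_annulus_off_countable hr hrR
      Set.countable_empty ?_ ?_
    · refine hc.comp (Continuous.continuousOn (by fun_prop)) fun x hx => ?_
      simp only [Set.mem_sdiff, Metric.mem_closedBall, Metric.mem_ball, Pi.zero_apply,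
        dist_zero_right, not_lt] at hx
      exact hmem x hx.2 hx.1
    · intro x hx
      simp only [Set.mem_sdiff, Metric.mem_closedBall, Metric.mem_ball, Pi.zero_apply,
        dist_zero_right, not_le] at hx
      have := hd _ (hmem x hx.1.2.le hx.1.1.le) i
      simpa using this

theorem torusIntegral_radius_eq {f : (Fin n → ℂ) → ℂ} {r R : ℝ} (hr : 0 < r) (hrR : r ≤ R)
    (hc : ContinuousOn f (polyannulus n r R))
    (hd : ∀ z ∈ polyannulus n r R, ∀ i,
      DifferentiableAt ℂ (fun w => f (Function.update z i w)) (z i)) :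
    torusIntegral f 0 (fun _ => R) = torusIntegral f 0 fun _ => r := by
  -- The radii are changed one coordinate at a time, S being the set of those already moved.
  have h : ∀ S : Finset (Fin n), torusIntegral f 0 (fun i => if i ∈ S then R else r) =
      torusIntegral f 0 fun _ => r := fun S => by
    induction S using Finset.induction_on with
    | empty => simp
    | insert i S hi ih =>
      rw [← ih]
      have h1 := torusIntegral_update_radius hr hrR hc hd
        (ρ := fun i => if i ∈ S then R else r) (fun j => by
          split_ifs
          · exact ⟨hrR, le_rfl⟩
          · exact ⟨le_rfl, hrR⟩) i
      convert h1 using 2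
      · ext j
        rcases eq_or_ne j i with rfl | hj
        · simp
        · simp [hj]
      · ext j
        rcases eq_or_ne j i with rfl | hj
        · simp [hi]
        · simp [hj]
  simpa using h Finset.univ

end Torus

/-! ### Interchange of the sum over signatures and the torus integral. -/

section TorusSum

variable {q : ℝ} {n : ℕ} {ζ : ℂ}

theorem hasSum_torusIntegral {ι : Type*} [Countable ι] {F : ι → (Fin n → ℂ) → ℂ}
    {G : (Fin n → ℂ) → ℂ} {ρ : Fin n → ℝ} {B : ι → ℝ} (hB : Summable B)
    (hF : ∀ k, Continuous fun θ => F k (torusMap 0 ρ θ))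
    (hle : ∀ k, ∀ θ ∈ Set.Icc (0 : Fin n → ℝ) (fun _ => 2 * π), ‖F k (torusMap 0 ρ θ)‖ ≤ B k)
    (hs : ∀ θ, HasSum (fun k => F k (torusMap 0 ρ θ)) (G (torusMap 0 ρ θ))) :
    HasSum (fun k => torusIntegral (F k) 0 ρ) (torusIntegral G 0 ρ) := by
  unfold torusIntegral
  have : IsFiniteMeasure (volume.restrict (Set.Icc (0 : Fin n → ℝ) fun _ => 2 * π)) :=
    ⟨by rw [Measure.restrict_apply_univ]; exact isCompact_Icc.measure_lt_top⟩
  refine hasSum_integral_of_dominated_convergence (fun k _ => (∏ i, |ρ i|) * B k) (fun k => ?_)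
    (fun k => ?_) (ae_of_all _ fun θ => hB.mul_left _) (integrable_const _)
    (ae_of_all _ fun θ => (hs θ).const_smul _)
  · have h1 : Continuous fun θ : Fin n → ℝ =>
        ∏ i, (ρ i : ℂ) * Complex.exp (θ i * Complex.I) * Complex.I := by fun_prop
    exact (h1.smul (hF k)).aestronglyMeasurable
  · filter_upwards [ae_restrict_mem measurableSet_Icc] with θ hθ
    rw [norm_smul]
    have e : ‖∏ i, (ρ i : ℂ) * Complex.exp (θ i * Complex.I) * Complex.I‖ = ∏ i, |ρ i| := by
      simp [norm_prod]
    rw [e]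
    exact mul_le_mul_of_nonneg_left (hle k θ hθ) (Finset.prod_nonneg fun _ _ => abs_nonneg _)

theorem differentiableAt_finsetProd {ι E : Type*} [NormedAddCommGroup E] [NormedSpace ℂ E]
    {s : Finset ι} {f : ι → E → ℂ} {w : E} (h : ∀ i ∈ s, DifferentiableAt ℂ (f i) w) :
    DifferentiableAt ℂ (fun v => ∏ i ∈ s, f i v) w := by
  classical
  induction s using Finset.induction_on with
  | empty => simp
  | insert i s hi ih =>
    simp only [Finset.prod_insert hi]
    exact (h i (Finset.mem_insert_self i s)).mul
      (ih fun j hj => h j (Finset.mem_insert_of_mem hj))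

theorem differentiableAt_fun_div {E : Type*} [NormedAddCommGroup E] [NormedSpace ℂ E]
    {f g : E → ℂ} {w : E} (hf : DifferentiableAt ℂ f w) (hg : DifferentiableAt ℂ g w)
    (h : g w ≠ 0) : DifferentiableAt ℂ (fun v => f v / g v) w := by
  simp only [div_eq_mul_inv]
  exact hf.fun_mul (hg.fun_inv h)

theorem differentiableAt_const_div_apply (c : ℂ) {z : Fin n → ℂ} {i : Fin n} (h : z i ≠ 0) :
    DifferentiableAt ℂ (fun v : Fin n → ℂ => c / v i) z :=
  differentiableAt_fun_div (differentiableAt_const c) (differentiableAt_apply i z) h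

theorem differentiableAt_whittakerP {E : Type*} [NormedAddCommGroup E] [NormedSpace ℂ E]
    {g : E → Fin n → ℂ} {w : E} (hg : ∀ i, DifferentiableAt ℂ (fun v => g v i) w)
    (h0 : ∀ i, g w i ≠ 0) (lam : Fin n → ℤ) :
    DifferentiableAt ℂ (fun v => whittakerP q n (g v) lam) w := by
  induction n with
  | zero => exact differentiableAt_const _
  | succ n ih =>
    simp only [whittakerP]
    refine DifferentiableAt.fun_sum fun mu _ => ?_
    refine DifferentiableAt.mul (DifferentiableAt.mul_const ?_ _)
      (ih (fun i => hg _) (fun i => h0 _) mu)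
    exact (hg _).zpow (Or.inl (h0 _))

theorem norm_cpow_real (hq0 : 0 < q) (a : ℝ) : ‖(q : ℂ) ^ (a : ℂ)‖ = q ^ a := by
  rw [Complex.norm_cpow_eq_rpow_re_of_pos hq0, Complex.ofReal_re]

theorem cauchyPi_factor_ne_zero (hq0 : 0 < q) (hq1 : q < 1) {a : ℝ} (ha : 0 < a) {z : ℂ}
    (hz : 1 ≤ ‖z‖) : qPochInf q ((q : ℂ) ^ (a : ℂ) / z) ≠ 0 := by
  refine qPochInf_ne_zero_of_norm_lt_one hq0 hq1 ?_
  rw [norm_div, norm_cpow_real hq0]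
  exact (div_le_self (Real.rpow_pos_of_pos hq0 _).le hz).trans_lt
    (Real.rpow_lt_one hq0.le hq1 ha)

theorem differentiableAt_cauchyPi (hq0 : 0 < q) (hq1 : q < 1) {α : Fin n → ℝ} (hα : ∀ i, 0 < α i)
    (t : ℝ) {z : Fin n → ℂ} (hz : ∀ i, 1 ≤ ‖z i‖) : DifferentiableAt ℂ (cauchyPi q α t) z := by
  have h0 : ∀ j, z j ≠ 0 := fun j => norm_pos_iff.1 (one_pos.trans_le (hz j))
  unfold cauchyPi
  refine DifferentiableAt.mul ?_ ?_
  · refine differentiableAt_finsetProd fun i _ => differentiableAt_finsetProd fun j _ => ?_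
    refine differentiableAt_fun_div (differentiableAt_const _) ?_ (cauchyPi_factor_ne_zero hq0 hq1 (hα i) (hz j))
    refine ((differentiable_qPochInf hq0 hq1) _).comp z ?_
    exact differentiableAt_const_div_apply _ (h0 j)
  · refine differentiableAt_finsetProd fun j _ => ?_
    fun_prop

theorem differentiableAt_sklyanin (hq0 : 0 < q) (hq1 : q < 1) {z : Fin n → ℂ}
    (h0 : ∀ i, z i ≠ 0) : DifferentiableAt ℂ (sklyanin q) z := by
  unfold sklyanin
  refine (differentiableAt_const _).mul ?_
  refine differentiableAt_finsetProd fun i _ => differentiableAt_finsetProd fun j _ => ?_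
  have h : ∀ i j, DifferentiableAt ℂ (fun z : Fin n → ℂ => qPochInf q (z i / z j)) z := fun i j =>
    ((differentiable_qPochInf hq0 hq1) _).comp z (differentiableAt_fun_div
      (differentiableAt_apply i z) (differentiableAt_apply j z) (h0 j))
  exact (h i j).mul (h j i)

/-- The weight of the torus integral. -/
def torusWeight (q : ℝ) (α : Fin n → ℝ) (t : ℝ) (z : Fin n → ℂ) : ℂ :=
  (∏ i, 1 / z i) * cauchyPi q α t z * sklyanin q z

theorem differentiableAt_torusWeight (hq0 : 0 < q) (hq1 : q < 1) {α : Fin n → ℝ}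
    (hα : ∀ i, 0 < α i) (t : ℝ) {z : Fin n → ℂ} (hz : ∀ i, 1 ≤ ‖z i‖) :
    DifferentiableAt ℂ (torusWeight q α t) z := by
  have h0 : ∀ j, z j ≠ 0 := fun j => norm_pos_iff.1 (one_pos.trans_le (hz j))
  refine (DifferentiableAt.mul ?_ (differentiableAt_cauchyPi hq0 hq1 hα t hz)).mul
    (differentiableAt_sklyanin hq0 hq1 h0)
  refine differentiableAt_finsetProd fun i _ => ?_
  exact differentiableAt_const_div_apply _ (h0 i)

/-- Since α_i > 0, |q^{α_i}/z_j| < 1 for |z_j| ≥ 1 and the integrand has no poles there. Moving to R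
> 1 is what makes |q^{a_j}/z_i| < 1 even when a_j = 0. -/
theorem whittakerQ_eq (hq0 : 0 < q) (hq1 : q < 1) {α : Fin (n + 1) → ℝ} (hα : ∀ i, 0 < α i)
    (t : ℝ) (lam : Fin (n + 1) → ℤ) {R : ℝ} (hR : 1 ≤ R) :
    whittakerQ q α t lam = qPochInf q q ^ n * gapCoeff q lam * torusIntegral (fun z =>
      whittakerP q (n + 1) (fun i => 1 / z i) lam * torusWeight q α t z) 0 fun _ => R := by
  have hd : ∀ z ∈ polyannulus (n + 1) 1 R, DifferentiableAt ℂ (fun z : Fin (n + 1) → ℂ =>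
      whittakerP q (n + 1) (fun i => 1 / z i) lam * torusWeight q α t z) z := fun z hz => by
    have h0 : ∀ j, z j ≠ 0 := fun j => norm_pos_iff.1 (one_pos.trans_le (hz j).1)
    refine (differentiableAt_whittakerP (fun i => ?_) (fun i => one_div_ne_zero (h0 i)) lam).mul
      (differentiableAt_torusWeight hq0 hq1 hα t fun i => (hz i).1)
    exact differentiableAt_const_div_apply _ (h0 i)
  rw [torusIntegral_radius_eq one_pos hR (fun z hz => (hd z hz).continuousAt.continuousWithinAt),
    whittakerQ, prefactor_eq hq0 hq1]
  · congr 1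
    congr 1
    ext z
    rw [torusWeight]
    ring
  · intro z hz i
    have h1 : DifferentiableAt ℂ (fun w : ℂ => Function.update z i w) (z i) :=
      (hasFDerivAt_update z (z i)).differentiableAt
    refine DifferentiableAt.comp (z i) (g := fun z : Fin (n + 1) → ℂ =>
      whittakerP q (n + 1) (fun i => 1 / z i) lam * torusWeight q α t z) ?_ h1
    rw [Function.update_eq_self]
    exact hd z hz

theorem hasSum_whittakerW (hq0 : 0 < q) (hq1 : q < 1) (hζ0 : ζ ≠ 0)
    (hζq : ∀ m : ℤ, (q : ℂ) ^ m * ζ ≠ 1) {a α : Fin (n + 1) → ℝ} (ha : ∀ i, 0 ≤ a i)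
    (hα : ∀ i, 0 < α i) (t : ℝ) {R : ℝ} (hR : 1 < R) :
    HasSum (fun lam : Fin (n + 1) → ℤ => whittakerW q a α t lam *
        (1 / qPochInf q (ζ * (q : ℂ) ^ lam (Fin.last n))))
      (torusIntegral (fun z => laplaceKernel q ζ (qPow q fun j => (a j : ℂ)) z *
        torusWeight q α t z) 0 (fun _ => R) / cauchyPi q α t (qPow q fun j => (a j : ℂ))) := by
  have hq := ofReal_ne_zero' hq0
  have hR0 : 0 < R := one_pos.trans hR
  set x : Fin (n + 1) → ℂ := qPow q fun j => (a j : ℂ) with hx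
  have hx0 : ∀ i, x i ≠ 0 := fun i => by simp [hx, qPow, hq]
  have hxn : ∀ i, ‖x i‖ = q ^ a i := fun i => norm_cpow_real hq0 _
  have hx1 : ∀ i, ‖x i‖ ≤ 1 := fun i => by
    rw [hxn]; exact Real.rpow_le_one hq0.le hq1.le (ha i)
  have hs0 : 0 < 1 / R := by positivity
  have hs1 : 1 * (1 / R) < 1 := by rw [one_mul, div_lt_one hR0]; exact hR
  set T : (Fin (n + 1) → ℝ) → Fin (n + 1) → ℂ := torusMap 0 fun _ => R with hT
  have hTn : ∀ θ i, ‖T θ i‖ = R := fun θ i => norm_torusMap_zero (fun _ => hR0.le) θ i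
  have hT0 : ∀ θ i, T θ i ≠ 0 := fun θ i => norm_pos_iff.1 (by rw [hTn]; exact hR0)
  have hTi : ∀ θ i, ‖1 / T θ i‖ ≤ 1 / R := fun θ i => by rw [norm_div, hTn, norm_one]
  have hTc : Continuous T := continuous_torusMap _ _
  -- The constant modulus of ∏ x_j/z_j on the torus, needed for the uniform majorant.
  set ξ : ℝ := (∏ i, q ^ a i) * ∏ _i : Fin (n + 1), 1 / R with hξ
  have hξT : ∀ θ, ‖(∏ i, x i) * ∏ i, 1 / T θ i‖ = ξ := fun θ => by
    rw [norm_mul, norm_prod, norm_prod]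
    simp only [hxn, norm_div, norm_one, hTn, hξ]
  have hξ0 : 0 < ξ := mul_pos (Finset.prod_pos fun i _ => Real.rpow_pos_of_pos hq0 _)
    (Finset.prod_pos fun i _ => hs0)
  have hξ1 : ξ < 1 := by
    rw [← hξT 0]
    exact norm_prod_mul_prod_lt_one one_pos hs1 hx1 (hTi 0)
  obtain ⟨B, hB, hBle⟩ := exists_norm_laplaceTerm_le (n := n) hq0 hq1 hζ0 hζq one_pos hs0 hs1 hξ0 hξ1
  have hw : Continuous fun θ => torusWeight q α t (T θ) := by
    refine continuous_iff_continuousAt.2 fun θ => ?_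
    exact ContinuousAt.comp (differentiableAt_torusWeight hq0 hq1 hα t
      fun i => by rw [hTn]; exact hR.le).continuousAt hTc.continuousAt
  obtain ⟨M, hM⟩ := isCompact_Icc.exists_bound_of_continuousOn
    (s := Set.Icc (0 : Fin (n + 1) → ℝ) fun _ => 2 * π) hw.continuousOn
  have key : HasSum (fun lam : Fin (n + 1) → ℤ => torusIntegral (fun z =>
      qPochInf q q ^ n * laplaceTerm q ζ x (fun i => 1 / z i) lam * torusWeight q α t z) 0 fun _ => R)
      (torusIntegral (fun z => laplaceKernel q ζ x z * torusWeight q α t z) 0 fun _ => R) := by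
    refine hasSum_torusIntegral (B := fun lam => ‖qPochInf q q ^ n‖ * B lam * M)
      ((hB.mul_left _).mul_right _) (fun lam => ?_) (fun lam θ hθ => ?_) fun θ => ?_
    · refine Continuous.mul (continuous_const.mul ?_) hw
      unfold laplaceTerm
      refine Continuous.mul (continuous_const.mul ?_) continuous_const
      refine continuous_iff_continuousAt.2 fun θ => ?_
      refine ContinuousAt.comp (f := T) (g := fun z : Fin (n + 1) → ℂ =>
        whittakerP q (n + 1) (fun i => 1 / z i) lam) ?_ hTc.continuousAt
      refine (differentiableAt_whittakerP (fun i => ?_) (fun i => one_div_ne_zero (hT0 θ i))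
        lam).continuousAt
      exact differentiableAt_const_div_apply _ (hT0 θ i)
    · have hB0 : 0 ≤ B lam := (norm_nonneg _).trans
        (hBle x _ hx0 hx1 (fun i => one_div_ne_zero (hT0 θ i)) (hTi θ) (hξT θ) lam)
      rw [norm_mul, norm_mul]
      exact mul_le_mul (mul_le_mul_of_nonneg_left (hBle x _ hx0 hx1
        (fun i => one_div_ne_zero (hT0 θ i)) (hTi θ) (hξT θ) lam) (norm_nonneg _)) (hM θ hθ)
        (norm_nonneg _) (by positivity)
    · exact (hasSum_laplaceTerm_inv hq0 hq1 hζ0 hζq one_pos hs0 hs1 hx0 hx1 (hT0 θ)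
        (hTi θ)).mul_right _
  refine (key.div_const (cauchyPi q α t x)).congr_fun fun lam => ?_
  have e : ∀ z : Fin (n + 1) → ℂ, qPochInf q q ^ n * laplaceTerm q ζ x (fun i => 1 / z i) lam *
      torusWeight q α t z = (qPochInf q q ^ n * gapCoeff q lam * whittakerP q (n + 1) x lam *
        (1 / qPochInf q (ζ * (q : ℂ) ^ lam (Fin.last n)))) *
        (whittakerP q (n + 1) (fun i => 1 / z i) lam * torusWeight q α t z) := fun z => by
    rw [laplaceTerm]; ring
  simp only [e]
  rw [torusIntegral_const_mul, whittakerW, whittakerQ_eq hq0 hq1 hα t lam hR.le]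
  ring

end TorusSum

/-! ### Decay of the integrand along the vertical lines. -/

section Decay

variable {q : ℝ} {n : ℕ} {ζ : ℂ}

/-- Dividing `qTheta_cpow_eq_sin_mul` at -w by both the sine and (q^{-w};q)_∞ removes the sine from
the denominator. The bound is continuous on Re w < 0, also across zeros of sin πw. -/
theorem norm_qPochInf_div_sin_le (hq0 : 0 < q) (hq1 : q < 1) {w : ℂ} (hw : w.re < 0) :
    ‖qPochInf q ((q : ℂ) ^ (w + 1)) / Complex.sin (π * w)‖ ≤
      ‖thetaSinRatio q (-w) / qPochInf q ((q : ℂ) ^ (-w))‖ := by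
  have hq := ofReal_ne_zero' hq0
  have hne : qPochInf q ((q : ℂ) ^ (-w)) ≠ 0 := qPochInf_ne_zero_of_norm_lt_one hq0 hq1 (by
    rw [Complex.norm_cpow_eq_rpow_re_of_pos hq0]
    exact Real.rpow_lt_one hq0.le hq1 (by simpa using hw))
  -- At a zero of the sine, division by zero gives 0, so the bound holds trivially.
  by_cases hs : Complex.sin (π * w) = 0
  · rw [hs, div_zero, norm_zero]; exact norm_nonneg _
  have h1 := qTheta_cpow_eq_sin_mul hq0 hq1 (-w)
  rw [qTheta, mul_neg, Complex.sin_neg, show (q : ℂ) / (q : ℂ) ^ (-w) = (q : ℂ) ^ (w + 1) by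
    rw [Complex.cpow_add _ _ hq, Complex.cpow_neg, Complex.cpow_one, div_inv_eq_mul, mul_comm]] at h1
  have h2 : qPochInf q ((q : ℂ) ^ (w + 1)) / Complex.sin (π * w) =
      -(thetaSinRatio q (-w) / qPochInf q ((q : ℂ) ^ (-w))) := by
    rw [← neg_div, div_eq_div_iff hs hne]
    linear_combination h1
  rw [h2, norm_neg]

/-- For |y| ≤ 1 the regularised quotient is bounded by compactness. For |y| > 1 the numerator stays
bounded on the circle traced by q^{w+1}, and |sin| grows like e^{π|y|}. -/
theorem exists_norm_qPochInf_div_sin_le (hq0 : 0 < q) (hq1 : q < 1) {c : ℝ} (hc : c < 0) :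
    ∃ C, 0 ≤ C ∧ ∀ y : ℝ, ‖qPochInf q ((q : ℂ) ^ ((c : ℂ) + Complex.I * y + 1)) /
      Complex.sin (π * ((c : ℂ) + Complex.I * y))‖ ≤ C * Real.exp (-(π * |y|)) := by
  have hq := ofReal_ne_zero' hq0
  have hre : ∀ y : ℝ, ((c : ℂ) + Complex.I * y).re = c := fun y => by simp
  have him : ∀ y : ℝ, ((c : ℂ) + Complex.I * y).im = y := fun y => by simp
  have hcont : Continuous fun y : ℝ => thetaSinRatio q (-((c : ℂ) + Complex.I * y)) /
      qPochInf q ((q : ℂ) ^ (-((c : ℂ) + Complex.I * y))) := by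
    refine ((continuous_thetaSinRatio q hq0 hq1).comp (by fun_prop)).div
      ((continuous_qPochInf hq0 hq1).comp ?_) fun y => ?_
    · simp only [ofReal_cpow_eq_exp hq0]; fun_prop
    · refine qPochInf_ne_zero_of_norm_lt_one hq0 hq1 ?_
      rw [Complex.norm_cpow_eq_rpow_re_of_pos hq0, Complex.neg_re, hre]
      exact Real.rpow_lt_one hq0.le hq1 (by linarith)
  obtain ⟨M₁, hM₁⟩ := (isCompact_Icc (a := (-1 : ℝ)) (b := 1)).exists_bound_of_continuousOn
    hcont.continuousOn
  obtain ⟨M₂, hM₂⟩ := (isCompact_closedBall (0 : ℂ) (q ^ (c + 1))).exists_bound_of_continuousOn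
    (continuous_qPochInf hq0 hq1).continuousOn
  have hM₁0 : 0 ≤ M₁ := (norm_nonneg _).trans (hM₁ 0 (by simp))
  have hM₂0 : 0 ≤ M₂ := (norm_nonneg _).trans (hM₂ 0 (by
    simpa using (Real.rpow_pos_of_pos hq0 _).le))
  have hE : Real.exp (-(2 * π)) < 1 := by
    rw [Real.exp_lt_one_iff]; linarith [Real.pi_pos]
  have hE' : 0 < 1 - Real.exp (-(2 * π)) := by linarith
  refine ⟨max (M₁ * Real.exp π) (2 * M₂ / (1 - Real.exp (-(2 * π)))),
    le_max_of_le_left (by positivity), fun y => ?_⟩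
  have hpi := Real.pi_pos
  rcases le_or_gt |y| 1 with hy | hy
  · calc _ ≤ M₁ := (norm_qPochInf_div_sin_le hq0 hq1 (by rw [hre]; exact hc)).trans
          (hM₁ y (abs_le.1 hy))
      _ ≤ M₁ * Real.exp π * Real.exp (-(π * |y|)) := by
        rw [mul_assoc, ← Real.exp_add]
        refine le_mul_of_one_le_right hM₁0 (Real.one_le_exp ?_)
        nlinarith
      _ ≤ _ := mul_le_mul_of_nonneg_right (le_max_left _ _) (Real.exp_pos _).le
  · have h1 : ‖qPochInf q ((q : ℂ) ^ ((c : ℂ) + Complex.I * y + 1))‖ ≤ M₂ := by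
      refine hM₂ _ ?_
      rw [mem_closedBall_zero_iff, Complex.norm_cpow_eq_rpow_re_of_pos hq0, Complex.add_re, hre,
        Complex.one_re]
    have h2 : Real.exp (π * |y|) * (1 - Real.exp (-(2 * π))) / 2 ≤
        ‖Complex.sin (π * ((c : ℂ) + Complex.I * y))‖ := by
      refine le_trans ?_ (norm_sinh_le_norm_sin _)
      rw [Complex.im_ofReal_mul, him, Real.abs_sinh, abs_mul, abs_of_pos hpi, Real.sinh_eq]
      have h3 : Real.exp (-(π * |y|)) ≤ Real.exp (π * |y|) * Real.exp (-(2 * π)) := by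
        rw [← Real.exp_add, Real.exp_le_exp]
        nlinarith
      linarith
    have h3 : 0 < Real.exp (π * |y|) * (1 - Real.exp (-(2 * π))) / 2 := by positivity
    rw [norm_div]
    calc _ ≤ M₂ / (Real.exp (π * |y|) * (1 - Real.exp (-(2 * π))) / 2) := by gcongr
      _ = 2 * M₂ / (1 - Real.exp (-(2 * π))) * Real.exp (-(π * |y|)) := by
        rw [Real.exp_neg (π * |y|)]
        field_simp
      _ ≤ _ := mul_le_mul_of_nonneg_right (le_max_right _ _) (Real.exp_pos _).le

theorem integrable_exp_neg_mul_abs {δ : ℝ} (hδ : 0 < δ) :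
    Integrable fun y : ℝ => Real.exp (-(δ * |y|)) := by
  rw [← integrableOn_univ, ← Set.Iic_union_Ioi (a := (0 : ℝ))]
  refine IntegrableOn.union ?_ ?_
  · refine (integrableOn_exp_mul_Iic hδ 0).congr_fun (fun y hy => ?_) measurableSet_Iic
    simp only
    rw [abs_of_nonpos hy]; ring_nf
  · refine (integrableOn_exp_mul_Ioi (neg_neg_of_pos hδ) 0).congr_fun (fun y hy => ?_)
      measurableSet_Ioi
    simp only
    rw [abs_of_pos hy]; ring_nf

theorem qPow_linePoint (hq0 : 0 < q) (ε : ℝ) (y : Fin n → ℝ) :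
    qPow q (linePoint ε y) = torusMap 0 (fun _ => q ^ (-ε)) fun j => Real.log q * y j := by
  ext j
  rw [qPow, linePoint, torusMap, ofReal_cpow_eq_exp hq0, Pi.zero_apply, zero_add,
    Real.rpow_def_of_pos hq0, Complex.ofReal_exp, ← Complex.exp_add]
  congr 1
  push_cast
  ring

theorem exists_norm_cauchyPi_le (hq0 : 0 < q) (hq1 : q < 1) {α : Fin n → ℝ}
    (hα : ∀ i, 0 < α i) (t : ℝ) {R : ℝ} (hR : 1 ≤ R) :
    ∃ M, 0 ≤ M ∧ ∀ z : Fin n → ℂ, (∀ i, ‖z i‖ = R) → ‖cauchyPi q α t z‖ ≤ M := by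
  have hcpt : IsCompact (Set.univ.pi fun _ : Fin n => Metric.sphere (0 : ℂ) R) :=
    isCompact_univ_pi fun _ => isCompact_sphere _ _
  obtain ⟨M, hM⟩ := hcpt.exists_bound_of_continuousOn (f := cauchyPi q α t) fun z hz =>
    (differentiableAt_cauchyPi hq0 hq1 hα t fun i => by
      have := hz i (Set.mem_univ i)
      rw [mem_sphere_zero_iff_norm] at this
      rw [this]; exact hR).continuousAt.continuousWithinAt
  exact ⟨max M 0, le_max_right _ _, fun z hz => (hM z fun i _ => by
    rw [mem_sphere_zero_iff_norm]; exact hz i).trans (le_max_left _ _)⟩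

theorem measurable_nfoldIntegrand (hq0 : 0 < q) (hq1 : q < 1)
    (a α : Fin (n + 1) → ℝ) (t ε : ℝ) (ζ : ℂ) :
    Measurable fun y : Fin (n + 1) → ℝ => nfoldIntegrand q a α t ζ (linePoint ε y) := by
  have hP : Measurable (qPochInf q) := (continuous_qPochInf hq0 hq1).measurable
  have hl : ∀ j, Measurable fun y : Fin (n + 1) → ℝ => linePoint ε y j := fun j => by
    unfold linePoint; fun_prop
  have hc : ∀ (c : ℂ) {f : (Fin (n + 1) → ℝ) → ℂ}, Measurable f → Measurable fun y => c ^ f y :=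
    fun c f hf => measurable_const.pow hf
  have hs : ∀ {f : (Fin (n + 1) → ℝ) → ℂ}, Measurable f → Measurable fun y => Complex.sin (f y) :=
    fun hf => Complex.continuous_sin.measurable.comp hf
  unfold nfoldIntegrand
  refine Measurable.mul (Measurable.mul (Measurable.mul ?_ ?_) ?_) ?_
  · exact Finset.measurable_fun_prod _ fun j _ => measurable_const.mul ((hc _ (hl j)).div_const _)
  · refine Measurable.div_const ?_ _
    unfold cauchyPi qPow
    refine Measurable.mul (Finset.measurable_fun_prod _ fun i _ =>
      Finset.measurable_fun_prod _ fun j _ => ?_) (Finset.measurable_fun_prod _ fun j _ => ?_)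
    · exact measurable_const.div (hP.comp (measurable_const.div (hc _ (hl j))))
    · exact Complex.continuous_exp.measurable.comp ((hc _ (hl j)).mul_const _)
  · refine Finset.measurable_fun_prod _ fun i _ => Finset.measurable_fun_prod _ fun j _ => ?_
    exact (hP.comp (hc _ (((hl i).sub_const _).add_const _))).div
      (hs (((hl i).sub_const _).const_mul _))
  · refine Finset.measurable_fun_prod _ fun i _ => Finset.measurable_fun_prod _ fun j _ => ?_
    exact ((hs (((hl j).sub (hl i)).const_mul _)).mul ((hc _ (hl j)).sub (hc _ (hl i)))).mul_const _

/-- Exponents of |y_i|: -(n + 1)π from the quotients by sin π(s_i - a_j), +nπ from the sines of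
pairs, and at most |arg(-ζ)| from (-ζ)^{s_i}. The total -(π - |arg(-ζ)|) is negative because -ζ is
off the cut. -/
theorem integrable_nfoldIntegrand (hq0 : 0 < q) (hq1 : q < 1) (hζ : -ζ ∈ Complex.slitPlane)
    {a α : Fin (n + 1) → ℝ} (ha : ∀ i, 0 ≤ a i) (hα : ∀ i, 0 < α i) (t : ℝ) {ε : ℝ} (hε : 0 < ε) :
    Integrable fun y : Fin (n + 1) → ℝ => nfoldIntegrand q a α t ζ (linePoint ε y) := by
  have hpi := Real.pi_pos
  have hζ' : -ζ ≠ 0 := Complex.slitPlane_ne_zero hζ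
  have harg : |Complex.arg (-ζ)| < π := by
    rw [abs_lt]
    exact ⟨Complex.neg_pi_lt_arg _, lt_of_le_of_ne (Complex.arg_le_pi _)
      (Complex.slitPlane_arg_ne_pi hζ)⟩
  set δ : ℝ := π - |Complex.arg (-ζ)| with hδ
  have hδ0 : 0 < δ := by linarith
  set R : ℝ := q ^ (-ε) with hR
  have hR1 : 1 ≤ R := Real.one_le_rpow_of_pos_of_le_one_of_nonpos hq0 hq1.le (by linarith)
  obtain ⟨M, hM0, hM⟩ := exists_norm_cauchyPi_le hq0 hq1 hα t hR1
  have hzn : ∀ (y : Fin (n + 1) → ℝ) i, ‖qPow q (linePoint ε y) i‖ = R := fun y i => by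
    rw [qPow_linePoint hq0, norm_torusMap_zero fun _ => by positivity]
  choose C hC0 hC using fun j : Fin (n + 1) =>
    exists_norm_qPochInf_div_sin_le hq0 hq1 (c := -ε - a j) (by linarith [ha j])
  set K₁ : ℝ := ∏ j, ‖1 / ((q : ℂ) ^ ((n : ℂ) * a j) * qPochInf q q)‖ *
    (‖-ζ‖ ^ (-ε) / ‖(-ζ) ^ (a j : ℂ)‖) with hK₁
  set K₂ : ℝ := M / ‖cauchyPi q α t (qPow q fun j => (a j : ℂ))‖ with hK₂
  set K₃ : ℝ := ∏ _i : Fin (n + 1), ∏ j, C j with hK₃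
  set K₄ : ℝ := ∏ i : Fin (n + 1), ∏ j ∈ Finset.Ioi i, (R + R) * ‖pairFactor q (a i) (a j)‖ with hK₄
  have h1 : ∀ y : Fin (n + 1) → ℝ, ‖∏ j, 1 / ((q : ℂ) ^ ((n : ℂ) * a j) * qPochInf q q) *
      ((-ζ) ^ linePoint ε y j / (-ζ) ^ (a j : ℂ))‖ ≤
      K₁ * ∏ j, Real.exp (|Complex.arg (-ζ)| * |y j|) := fun y => by
    rw [norm_prod, hK₁, ← Finset.prod_mul_distrib]
    refine Finset.prod_le_prod (fun _ _ => norm_nonneg _) fun j _ => ?_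
    rw [norm_mul, norm_div ((-ζ) ^ linePoint ε y j), mul_assoc, ← mul_div_right_comm]
    have e : ‖(-ζ) ^ linePoint ε y j‖ ≤
        ‖-ζ‖ ^ (-ε) * Real.exp (|Complex.arg (-ζ)| * |y j|) := by
      rw [Complex.norm_cpow_of_ne_zero hζ']
      have hre : (linePoint ε y j).re = -ε := by simp [linePoint]
      have him : (linePoint ε y j).im = y j := by simp [linePoint]
      rw [hre, him, div_eq_mul_inv, ← Real.exp_neg]
      refine mul_le_mul_of_nonneg_left (Real.exp_le_exp.2 ?_) (by positivity)
      rw [← abs_mul]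
      exact neg_le_abs _
    gcongr
  have h2 : ∀ y : Fin (n + 1) → ℝ, ‖cauchyPi q α t (qPow q (linePoint ε y)) /
      cauchyPi q α t (qPow q fun j => (a j : ℂ))‖ ≤ K₂ := fun y => by
    rw [norm_div]
    exact div_le_div_of_nonneg_right (hM _ (hzn y)) (norm_nonneg _)
  have h3 : ∀ y : Fin (n + 1) → ℝ, ‖∏ i, ∏ j, qPochInf q ((q : ℂ) ^ (linePoint ε y i - a j + 1)) /
      Complex.sin (π * (linePoint ε y i - a j))‖ ≤
      K₃ * ∏ i, Real.exp (-(π * |y i|)) ^ (n + 1) := fun y => by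
    rw [norm_prod, hK₃, ← Finset.prod_mul_distrib]
    refine Finset.prod_le_prod (fun _ _ => norm_nonneg _) fun i _ => ?_
    rw [norm_prod, ← Fin.prod_const, ← Finset.prod_mul_distrib]
    refine Finset.prod_le_prod (fun _ _ => norm_nonneg _) fun j _ => ?_
    have e : linePoint ε y i - a j = ((-ε - a j : ℝ) : ℂ) + Complex.I * y i := by
      rw [linePoint]; push_cast; ring
    rw [e]
    exact hC j (y i)
  have h4 : ∀ y : Fin (n + 1) → ℝ, ‖∏ i : Fin (n + 1), ∏ j ∈ Finset.Ioi i,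
      Complex.sin (π * (linePoint ε y j - linePoint ε y i)) *
      ((q : ℂ) ^ linePoint ε y j - (q : ℂ) ^ linePoint ε y i) * pairFactor q (a i) (a j)‖ ≤
      K₄ * ∏ i, Real.exp (π * |y i|) ^ n := fun y => by
    rw [norm_prod, hK₄, Finset.prod_pow, ← prod_Ioi_mul, ← Finset.prod_mul_distrib]
    refine Finset.prod_le_prod (fun _ _ => norm_nonneg _) fun i _ => ?_
    rw [norm_prod, ← Finset.prod_mul_distrib]
    refine Finset.prod_le_prod (fun _ _ => norm_nonneg _) fun j _ => ?_
    rw [norm_mul, norm_mul]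
    have e1 : ‖Complex.sin (π * (linePoint ε y j - linePoint ε y i))‖ ≤
        Real.exp (π * |y i|) * Real.exp (π * |y j|) := by
      refine (norm_sin_le_exp _).trans ?_
      rw [← Real.exp_add, Real.exp_le_exp, Complex.im_ofReal_mul, abs_mul, abs_of_pos hpi, ← mul_add]
      have : (linePoint ε y j - linePoint ε y i).im = y j - y i := by simp [linePoint]
      rw [this]
      refine mul_le_mul_of_nonneg_left ?_ hpi.le
      linarith [abs_sub (y j) (y i)]
    have e2 : ‖(q : ℂ) ^ linePoint ε y j - (q : ℂ) ^ linePoint ε y i‖ ≤ R + R := by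
      refine (norm_sub_le _ _).trans (le_of_eq ?_)
      have hj := hzn y j
      have hi := hzn y i
      rw [qPow] at hi hj
      rw [hi, hj]
    calc _ ≤ (Real.exp (π * |y i|) * Real.exp (π * |y j|)) * (R + R) *
          ‖pairFactor q (a i) (a j)‖ := by gcongr
      _ = _ := by ring
  have hint : Integrable fun y : Fin (n + 1) → ℝ =>
      (K₁ * K₂ * K₃ * K₄) * ∏ j, Real.exp (-(δ * |y j|)) :=
    (Integrable.fintype_prod (f := fun (_ : Fin (n + 1)) (y : ℝ) => Real.exp (-(δ * |y|)))
      fun _ => integrable_exp_neg_mul_abs hδ0).const_mul _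
  refine hint.mono' (measurable_nfoldIntegrand hq0 hq1 a α t ε ζ).aestronglyMeasurable
    (ae_of_all _ fun y => ?_)
  have hK₁0 : 0 ≤ K₁ := Finset.prod_nonneg fun j _ => by positivity
  have hK₂0 : 0 ≤ K₂ := by positivity
  have hK₃0 : 0 ≤ K₃ := Finset.prod_nonneg fun i _ => Finset.prod_nonneg fun j _ => hC0 j
  have hK₄0 : 0 ≤ K₄ := Finset.prod_nonneg fun i _ => Finset.prod_nonneg fun j _ => by positivity
  have e : ∏ j, Real.exp (-(δ * |y j|)) = (∏ j, Real.exp (|Complex.arg (-ζ)| * |y j|)) *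
      (∏ i, Real.exp (-(π * |y i|)) ^ (n + 1)) * ∏ i, Real.exp (π * |y i|) ^ n := by
    rw [← Finset.prod_mul_distrib, ← Finset.prod_mul_distrib]
    refine Finset.prod_congr rfl fun j _ => ?_
    rw [← Real.exp_nat_mul, ← Real.exp_nat_mul, ← Real.exp_add, ← Real.exp_add, hδ]
    congr 1
    push_cast
    ring
  rw [e, nfoldIntegrand, norm_mul, norm_mul, norm_mul]
  calc _ ≤ ((K₁ * ∏ j, Real.exp (|Complex.arg (-ζ)| * |y j|)) * K₂) *
        (K₃ * ∏ i, Real.exp (-(π * |y i|)) ^ (n + 1)) * (K₄ * ∏ i, Real.exp (π * |y i|) ^ n) := by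
        refine mul_le_mul (mul_le_mul (mul_le_mul (h1 y) (h2 y) (norm_nonneg _) ?_) (h3 y)
          (norm_nonneg _) ?_) (h4 y) (norm_nonneg _) ?_ <;> positivity
    _ = _ := by ring

end Decay

/-! ### Unfolding an integral over ℝ^n onto a period box. -/

section Unfolding

variable {n : ℕ}

/-- The translates of [0, 2π)^n tile ℝ^n. The L¹ norms over the tiles are summable, which allows the
sum to be moved inside the integral over one box. -/
theorem integral_eq_setIntegral_periodization {g H : (Fin n → ℝ) → ℂ} (hg : Integrable g)
    (hH : ∀ᵐ θ, HasSum (fun k : Fin n → ℤ => g fun i => θ i + 2 * π * k i) (H θ)) :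
    ∫ θ, g θ = ∫ θ in Set.Icc (0 : Fin n → ℝ) (fun _ => 2 * π), H θ := by
  have hpi := Real.two_pi_pos
  set box : (Fin n → ℤ) → Set (Fin n → ℝ) := fun k =>
    Set.univ.pi fun i => Set.Ico (2 * π * k i) (2 * π * k i + 2 * π) with hbox
  set B := Set.univ.pi fun _ : Fin n => Set.Ico (0 : ℝ) (2 * π) with hB
  have hm : ∀ k, MeasurableSet (box k) := fun k => MeasurableSet.univ_pi fun i => measurableSet_Ico
  have hdisj : Pairwise (Function.onFun Disjoint box) := fun k l hkl => by
    rw [Function.onFun, Set.disjoint_left]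
    intro θ hk hl
    obtain ⟨i, hi⟩ := Function.ne_iff.1 hkl
    have h1 := hk i (Set.mem_univ i)
    have h2 := hl i (Set.mem_univ i)
    refine hi ?_
    have h3 : (k i : ℝ) < l i + 1 := by
      have := h1.1.trans_lt h2.2
      nlinarith
    have h4 : (l i : ℝ) < k i + 1 := by
      have := h2.1.trans_lt h1.2
      nlinarith
    have h5 : k i < l i + 1 := by exact_mod_cast h3
    have h6 : l i < k i + 1 := by exact_mod_cast h4
    omega
  have hun : ⋃ k, box k = Set.univ := by
    refine Set.eq_univ_of_forall fun θ => Set.mem_iUnion.2 ⟨fun i => ⌊θ i / (2 * π)⌋, fun i _ => ?_⟩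
    have h1 := Int.floor_le (θ i / (2 * π))
    have h2 := Int.lt_floor_add_one (θ i / (2 * π))
    rw [le_div_iff₀ hpi] at h1
    rw [div_lt_iff₀ hpi] at h2
    constructor <;> linarith
  have htr : ∀ {E : Type} [NormedAddCommGroup E] [NormedSpace ℝ E] (f : (Fin n → ℝ) → E)
      (k : Fin n → ℤ), ∫ θ in box k, f θ = ∫ θ in B, f fun i => θ i + 2 * π * k i :=
    fun {E} _ _ f k => by
      have hmp := measurePreserving_add_right (volume : Measure (Fin n → ℝ)) fun i => 2 * π * (k i : ℝ)
      have hpre : (fun θ : Fin n → ℝ => θ + fun i => 2 * π * (k i : ℝ)) ⁻¹' box k = B := by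
        ext θ
        simp only [hbox, hB, Set.mem_preimage, Set.mem_univ_pi, Set.mem_Ico, Pi.add_apply]
        refine forall_congr' fun i => and_congr ?_ ?_
        · rw [le_add_iff_nonneg_left]
        · rw [add_comm, add_lt_add_iff_left]
      rw [← hmp.setIntegral_preimage_emb (measurableEmbedding_addRight _) f (box k), hpre]
      rfl
  have h1 := hasSum_integral_iUnion hm hdisj (f := g) hg.integrableOn
  have h2 := hasSum_integral_iUnion hm hdisj (f := fun θ => ‖g θ‖) hg.norm.integrableOn
  rw [hun, setIntegral_univ] at h1
  simp only [htr] at h1 h2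
  have hgi : ∀ k : Fin n → ℤ, Integrable (fun θ => g fun i => θ i + 2 * π * k i)
      (volume.restrict B) := fun k =>
    ((measurePreserving_add_right (volume : Measure (Fin n → ℝ)) fun i =>
      2 * π * (k i : ℝ)).integrable_comp_of_integrable hg).integrableOn
  have h3 := hasSum_integral_of_summable_integral_norm hgi h2.summable
  -- The tiles are half-open while the torus integral uses the closed box; the difference is null.
  have hae : B =ᵐ[volume] Set.Icc (0 : Fin n → ℝ) fun _ => 2 * π :=
    Measure.univ_pi_Ico_ae_eq_Icc
  rw [h1.unique h3, ← setIntegral_congr_set hae]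
  refine integral_congr_ae ?_
  filter_upwards [ae_restrict_of_ae hH] with θ hθ
  exact hθ.tsum_eq

end Unfolding

/-! ### Identification of the two sides. -/

section Main

variable {n : ℕ} {q : ℝ}

theorem neg_mem_slitPlane {ζ : ℂ} (hζ : ∀ r : ℝ, 0 ≤ r → ζ ≠ (r : ℂ)) :
    -ζ ∈ Complex.slitPlane := by
  rw [Complex.mem_slitPlane_iff]
  by_contra! h
  simp only [Complex.neg_re, Complex.neg_im, neg_eq_zero, Left.neg_nonpos_iff] at h
  exact hζ ζ.re h.1 (Complex.ext rfl (by simpa using h.2))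

theorem zpow_mul_ne_one (hq0 : 0 < q) {ζ : ℂ} (hζ : ∀ r : ℝ, 0 ≤ r → ζ ≠ (r : ℂ)) (m : ℤ) :
    (q : ℂ) ^ m * ζ ≠ 1 := fun h => by
  refine hζ (q ^ (-m)) (zpow_pos hq0 _).le ?_
  have hq : (q : ℂ) ≠ 0 := by exact_mod_cast hq0.ne'
  rw [Complex.ofReal_zpow, zpow_neg, eq_inv_of_mul_eq_one_right h]

theorem qPow_linePoint_div_log (hq0 : 0 < q) (hq1 : q < 1) (ε : ℝ) (θ : Fin n → ℝ) :
    qPow q (linePoint ε fun j => θ j / Real.log q) = torusMap 0 (fun _ => q ^ (-ε)) θ := by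
  rw [qPow_linePoint hq0]
  congr 1
  funext j
  exact mul_div_cancel₀ _ (Real.log_neg hq0 hq1).ne

/-- In the angle θ = y log q, a full turn is a shift of s by `qPeriod`. -/
theorem linePoint_div_log_add_two_pi_mul (ε : ℝ) (θ : Fin n → ℝ) (k : Fin n → ℤ) :
    (linePoint ε fun j => (θ j + 2 * π * k j) / Real.log q) =
      fun i => linePoint ε (fun j => θ j / Real.log q) i + k i * qPeriod q := by
  funext i
  simp only [linePoint, qPeriod]
  push_cast
  ring

theorem im_linePoint_add_mul_qPeriod_ne_zero (hq0 : 0 < q) (hq1 : q < 1) (ε : ℝ) {θ : Fin n → ℝ}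
    {i : Fin n} {k : ℤ} (h : θ i ≠ -(2 * π * k)) :
    (linePoint ε (fun j => θ j / Real.log q) i + k * qPeriod q).im ≠ 0 := by
  have hL := (Real.log_neg hq0 hq1).ne
  have : linePoint ε (fun j => θ j / Real.log q) i + k * qPeriod q =
      ((-ε : ℝ) : ℂ) + (((θ i + 2 * π * k) / Real.log q : ℝ) : ℂ) * Complex.I := by
    simp only [linePoint, qPeriod]
    push_cast
    ring
  rw [this, Complex.add_im, Complex.ofReal_im, zero_add, Complex.im_ofReal_mul, Complex.I_im,
    mul_one]
  exact div_ne_zero (fun h' => h (by linarith)) hL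

/-- The integral over the product of lines as an integral over a torus. -/
theorem integral_nfoldIntegrand (hq0 : 0 < q) (hq1 : q < 1) {a α : Fin (n + 1) → ℝ}
    (ha : ∀ i, 0 ≤ a i) (hα : ∀ i, 0 < α i) (t : ℝ) {ε : ℝ} (hε : 0 < ε) {ζ : ℂ}
    (hζ : ∀ r : ℝ, 0 ≤ r → ζ ≠ (r : ℂ)) :
    (-(π : ℂ)) ^ (n + 1) * ∫ y, nfoldIntegrand q a α t ζ (linePoint ε y) =
      ∫ θ in Set.Icc (0 : Fin (n + 1) → ℝ) (fun _ => 2 * π),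
        cauchyPi q α t (torusMap 0 (fun _ => q ^ (-ε)) θ) /
            cauchyPi q α t (qPow q fun j => (a j : ℂ)) *
          (laplaceKernel q ζ (qPow q fun j => (a j : ℂ)) (torusMap 0 (fun _ => q ^ (-ε)) θ) *
            sklyaninProd q (torusMap 0 (fun _ => q ^ (-ε)) θ)) := by
  have hL := Real.log_neg hq0 hq1
  have hLc : (-(Real.log q : ℂ)) ≠ 0 := neg_ne_zero.2 (by exact_mod_cast hL.ne)
  set f : (Fin (n + 1) → ℝ) → ℂ := fun y => nfoldIntegrand q a α t ζ (linePoint ε y) with hf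
  have hfi : Integrable f :=
    integrable_nfoldIntegrand hq0 hq1 (neg_mem_slitPlane hζ) ha hα t hε
  -- Substitution y = θ/log q. As log q < 0, the Jacobian is (-log q)^{n+1}, the constant that
  -- `hasSum_nfoldIntegrand` also produces.
  set g : (Fin (n + 1) → ℝ) → ℂ := fun θ =>
    (-(π : ℂ)) ^ (n + 1) * f ((Real.log q)⁻¹ • θ) with hg
  have hgi : Integrable g := (hfi.comp_smul (inv_ne_zero hL.ne)).const_mul _
  have hgf : ∫ θ, g θ = (-(Real.log q : ℂ)) ^ (n + 1) * ((-(π : ℂ)) ^ (n + 1) * ∫ y, f y) := by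
    rw [hg, integral_const_mul, Measure.integral_comp_smul, Module.finrank_fin_fun, inv_pow,
      inv_inv, abs_pow, abs_of_neg hL, Complex.real_smul]
    push_cast
    ring
  have hsmul : ∀ θ : Fin (n + 1) → ℝ, (Real.log q)⁻¹ • θ = fun j => θ j / Real.log q := fun θ => by
    funext j
    rw [Pi.smul_apply, smul_eq_mul, div_eq_inv_mul]
  -- The periodised formula fails only where some s_i + kω is real, a countable union of
  -- hyperplanes.
  have hae : ∀ᵐ θ : Fin (n + 1) → ℝ, ∀ i, ∀ k : ℤ, θ i ≠ -(2 * π * k) :=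
    ae_all_iff.2 fun i => ae_all_iff.2 fun k => by
    rw [volume_pi]; exact Measure.ae_eval_ne _ i _
  have key := integral_eq_setIntegral_periodization hgi (H := fun θ =>
    (-(Real.log q : ℂ)) ^ (n + 1) * (cauchyPi q α t (torusMap 0 (fun _ => q ^ (-ε)) θ) /
            cauchyPi q α t (qPow q fun j => (a j : ℂ)) *
          (laplaceKernel q ζ (qPow q fun j => (a j : ℂ)) (torusMap 0 (fun _ => q ^ (-ε)) θ) *
            sklyaninProd q (torusMap 0 (fun _ => q ^ (-ε)) θ)))) (by
    filter_upwards [hae] with θ hθ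
    have h := hasSum_nfoldIntegrand hq0 hq1 (neg_mem_slitPlane hζ) (zpow_mul_ne_one hq0 hζ)
      (s := linePoint ε fun j => θ j / Real.log q)
      (fun i k => im_linePoint_add_mul_qPeriod_ne_zero hq0 hq1 ε (hθ i k)) a α t
    rw [qPow_linePoint_div_log hq0 hq1, mul_assoc] at h
    simpa only [hg, hf, hsmul, linePoint_div_log_add_two_pi_mul] using h)
  rw [hgf, integral_const_mul] at key
  exact mul_left_cancel₀ (pow_ne_zero _ hLc) key

/-- On the circle dz/z = i dθ, so the factors 1/z_i absorb the Jacobian. -/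
theorem torusIntegral_laplaceKernel_mul_torusWeight (x : Fin (n + 1) → ℂ)
    (α : Fin (n + 1) → ℝ) (t : ℝ) (ζ : ℂ) {R : ℝ} (hR : 0 < R) :
    torusIntegral (fun z => laplaceKernel q ζ x z * torusWeight q α t z) 0 (fun _ => R) =
      Complex.I ^ (n + 1) * (1 / ((2 * π * Complex.I) ^ (n + 1) * ((n + 1).factorial : ℂ))) *
        ∫ θ in Set.Icc (0 : Fin (n + 1) → ℝ) (fun _ => 2 * π),
          cauchyPi q α t (torusMap 0 (fun _ => R) θ) *
            (laplaceKernel q ζ x (torusMap 0 (fun _ => R) θ) *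
              sklyaninProd q (torusMap 0 (fun _ => R) θ)) := by
  rw [torusIntegral, ← integral_const_mul]
  refine integral_congr_ae (.of_forall fun θ => ?_)
  have hz : ∀ i, (R : ℂ) * Complex.exp (θ i * Complex.I) ≠ 0 := fun i =>
    mul_ne_zero (by exact_mod_cast hR.ne') (Complex.exp_ne_zero _)
  have h : (∏ i, (R : ℂ) * Complex.exp (θ i * Complex.I) * Complex.I) *
      ∏ i, 1 / torusMap 0 (fun _ => R) θ i = Complex.I ^ (n + 1) := by
    rw [← Finset.prod_mul_distrib, Finset.prod_congr rfl (g := fun _ => Complex.I),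
      Finset.prod_const, Finset.card_univ, Fintype.card_fin]
    intro i _
    rw [torusMap, Pi.zero_apply, zero_add]
    rw [mul_one_div, mul_div_cancel_left₀ _ (hz i)]
  simp only [torusWeight, sklyanin, smul_eq_mul]
  rw [← h]
  simp only [sklyaninProd]
  ring

end Main

end QWhittaker

end

/-- The `q`-Laplace transform of `λ_N` under the two-sided `q`-Whittaker measure as an `N`-fold
integral over `(iℝ - ε)^N` (each line oriented upwards), with `N = n + 1`. The left-hand side is
the absolutely convergent sum `∑_λ W_t(λ) / (ζ q^{λ_N}; q)_∞`. -/
theorem proposition4 (n : ℕ) (q : ℝ) (hq0 : 0 < q) (hq1 : q < 1)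
    (a α : Fin (n + 1) → ℝ) (ha : ∀ i, 0 ≤ a i) (haα : ∀ i j, a j < α i)
    (t : ℝ) (ht : 0 ≤ t) (ε : ℝ) (hε : 0 < ε)
    (ζ : ℂ) (hζ : ∀ r : ℝ, 0 ≤ r → ζ ≠ (r : ℂ)) :
    Integrable (fun y : Fin (n + 1) → ℝ =>
      QWhittaker.nfoldIntegrand q a α t ζ (QWhittaker.linePoint ε y)) ∧
    HasSum
      (fun lam : QWhittaker.Signature (n + 1) =>
        QWhittaker.whittakerW q a α t lam.1 *
          (1 / QWhittaker.qPochInf q (ζ * (q : ℂ) ^ lam.1 (Fin.last n))))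
      ((-(π : ℂ)) ^ (n + 1) / ((2 * π * Complex.I) ^ (n + 1) * ((n + 1).factorial : ℂ)) *
        (Complex.I ^ (n + 1) * ∫ y : Fin (n + 1) → ℝ,
          QWhittaker.nfoldIntegrand q a α t ζ (QWhittaker.linePoint ε y))) := by
  have hα : ∀ i, 0 < α i := fun i => (ha i).trans_lt (haα i i)
  have hR : 1 < q ^ (-ε) := Real.one_lt_rpow_of_pos_of_lt_one_of_neg hq0 hq1 (neg_lt_zero.2 hε)
  have hζ0 : ζ ≠ 0 := by simpa using hζ 0 le_rfl
  refine ⟨QWhittaker.integrable_nfoldIntegrand hq0 hq1 (QWhittaker.neg_mem_slitPlane hζ) ha hα t hε,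
    ?_⟩
  have h := QWhittaker.hasSum_whittakerW hq0 hq1 hζ0 (QWhittaker.zpow_mul_ne_one hq0 hζ) ha hα t hR
  rw [QWhittaker.torusIntegral_laplaceKernel_mul_torusWeight _ α t ζ (zero_lt_one.trans hR)] at h
  -- The sum was taken over all of ℤ^N; P_λ vanishes unless λ is weakly decreasing, so only
  -- signatures contribute.
  have hsub := (hasSum_subtype_iff_of_support_subset
    (s := {lam : Fin (n + 1) → ℤ | Antitone lam}) fun lam hlam => by
      by_contra hanti
      refine hlam ?_
      simp only [QWhittaker.whittakerW, QWhittaker.whittakerP_eq_zero _ hanti, zero_mul,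
        zero_div]).2 h
  have hI := QWhittaker.integral_nfoldIntegrand hq0 hq1 ha hα t hε hζ
  have hval : ∀ A B C D : ℂ, A / B * (C * D) = C * (1 / B) * (A * D) := fun A B C D => by ring
  rw [mul_div_assoc, ← integral_div] at hsub
  rw [hval, hI]
  simp only [div_mul_eq_mul_div]
  exact hsub
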